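/- Let $(\Omega,\mu)$ be a measure space and let $(\mathcal T_t)_{t\ge 0}$ be a symmetric diffusion semigroup on it, that is, linear operators acting consistently on all real spaces $L^r(\Omega)$, $1\le r\le\infty$, with $\mathcal T_0=\mathrm{Id}$, $\mathcal T_t\mathcal T_s=\mathcal T_{t+s}$, $\|\mathcal T_t\|_{L^r\to L^r}\le 1$ for all $r\in[1,\infty]$, $\lim_{t\to0}\mathcal T_tf=f$ in $L^2$ for all $f\in L^2$, $\mathcal T_t^*=\mathcal T_t$ on $L^2$, $\mathcal T_tf\ge 0$ whenever $f\ge 0$, and $\mathcal T_t1=1$. For a (real or complex) Banach space $X$ and $1<r<\infty$, denote again by $\mathcal T_t$ the bounded extension $\mathcal T_t\otimes \mathrm{Id}_X$ to the Bochner space $L^r_X(\Omega)$, and let $$\mathcal P_tf=\frac1{\sqrt\pi}\int_0^\infty\frac{e^{-u}}{\sqrt u}\,\mathcal T_{t^2/4u}f\,du ,\qquad f\in L^r_X(\Omega),$$ be the subordinated Poisson semigroup. Let $F$ be the orthogonal projection of $L^2(\Omega)$ onto the subspace of all $f$ with $\mathcal P_tf=f$ for every $t>0$; $F$ extends to a bounded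 projection on $L^r(\Omega)$ and then, as $F\otimes\mathrm{Id}_X$, on $L^r_X(\Omega)$, denoted by the same letter. For $1<s<\infty$ and $f\in L^r_X(\Omega)$ put $$\mathfrak G_s f(x)=\Big(\int_0^\infty\Big\|t\,\frac{\partial \mathcal P_tf(x)}{\partial t}\Big\|_X^s\,\frac{dt}{t}\Big)^{1/s}\in[0,\infty],$$ where, for each $t>0$, the representative of $\mathcal P_tf$ is chosen so that for almost every $x$ the function $t\mapsto\mathcal P_tf(x)$ is differentiable on $(0,\infty)$. **Theorem.** Let $\mathbb B$ be a Banach space with dual $\mathbb B^*$, let $1<p,q<\infty$, and let $p',q'$ be the conjugate exponents. For the given semigroup, the following statements are equivalent: (i) There is a constant $C>0$ such that $$\|\mathfrak G_qf\|_{L^p(\Omega)}\le C\,\|f\|_{L^p_{\mathbb B}(\Omega)}\qquad\text{for all } f\in L^p_{\mathbb B}(\Omega).$$ (ii) There is a constant $C>0$ such that $$\|g\|_{L^{p'}_{\mathbb B^*}(\Omega)}\le C\big(\|F(g)\|_{L^{p'}_{\mathbb B^*}(\Omega)}+\|\mathfrak G_{q'}g\|_{L^{p'}(\Omega)}\big)\qquad\text{for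 all } g\in L^{p'}_{\mathbb B^*}(\Omega).$$ -/

import Mathlib

open MeasureTheory Filter Topology
open scoped ENNReal NNReal

noncomputable section

/-- A symmetric diffusion semigroup `(T t)_{t ≥ 0}` on a measure space `(Ω, μ)`. For each `t` the
operators `T t p` on the spaces `L^p(Ω)`, `1 ≤ p ≤ ∞`, are the incarnations of one operator: they
agree on functions belonging to several `L^p`. Negative times carry no information. -/
structure SymmetricDiffusionSemigroup {Ω : Type*} [MeasurableSpace Ω] (μ : Measure Ω) where
  T : ℝ → (p : ℝ≥0∞) → [Fact (1 ≤ p)] → Lp ℝ p μ →L[ℝ] Lp ℝ p μ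
  consistent : ∀ (t : ℝ), 0 ≤ t → ∀ (p r : ℝ≥0∞) [Fact (1 ≤ p)] [Fact (1 ≤ r)]
    (f : Lp ℝ p μ) (g : Lp ℝ r μ), (f : Ω → ℝ) =ᵐ[μ] g → (T t p f : Ω → ℝ) =ᵐ[μ] T t r g
  T_zero : ∀ (p : ℝ≥0∞) [Fact (1 ≤ p)], T 0 p = ContinuousLinearMap.id ℝ (Lp ℝ p μ)
  T_add : ∀ (s t : ℝ), 0 ≤ s → 0 ≤ t → ∀ (p : ℝ≥0∞) [Fact (1 ≤ p)],
    T (s + t) p = (T s p).comp (T t p)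
  contractive : ∀ (t : ℝ), 0 ≤ t → ∀ (p : ℝ≥0∞) [Fact (1 ≤ p)], ‖T t p‖ ≤ 1
  continuous_zero : ∀ f : Lp ℝ 2 μ, Tendsto (fun t : ℝ => T t 2 f) (𝓝[>] 0) (𝓝 f)
  symmetric : ∀ (t : ℝ), 0 ≤ t → IsSelfAdjoint (T t 2)
  positive : ∀ (t : ℝ), 0 ≤ t → ∀ (p : ℝ≥0∞) [Fact (1 ≤ p)] (f : Lp ℝ p μ), 0 ≤ f → 0 ≤ T t p f
  markov : ∀ (t : ℝ), 0 ≤ t →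
    T t ∞ ((memLp_top_const (1 : ℝ)).toLp (fun _ : Ω => (1 : ℝ)))
      = (memLp_top_const (1 : ℝ)).toLp (fun _ : Ω => (1 : ℝ))

/-- The subordination formula
`P_t f = π^{-1/2} ∫_0^∞ e^{-u} u^{-1/2} T_{t²/(4u)} f du` (Bochner integral in `E`). -/
def subordinate {E : Type*} [NormedAddCommGroup E] [NormedSpace ℝ E] (T : ℝ → E →L[ℝ] E)
    (t : ℝ) (f : E) : E :=
  (√Real.pi)⁻¹ • ∫ u in Set.Ioi (0 : ℝ), (Real.exp (-u) / √u) • T (t ^ 2 / (4 * u)) f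

section VectorValued

variable {Ω : Type*} [MeasurableSpace Ω] {μ : Measure Ω} {p : ℝ≥0∞} [Fact (1 ≤ p)]

/-- The elementary tensor `φ ⊗ b`, that is, the function `x ↦ φ x • b`. -/
def elemTensor {B : Type*} [NormedAddCommGroup B] [NormedSpace ℝ B] (φ : Lp ℝ p μ) (b : B) :
    Lp B p μ :=
  (ContinuousLinearMap.toSpanSingleton ℝ b).compLp φ

open Classical in
/-- The extension `A ⊗ Id_B` of an operator `A` on `L^p(Ω)` to a bounded operator on the Bochner
space `L^p_B(Ω)`, `p < ∞` (unique, as elementary tensors span a dense subspace; it exists for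
every positive `A`). The value is `0` if there is no bounded extension. -/
def tensorExtension (B : Type*) [NormedAddCommGroup B] [NormedSpace ℝ B]
    (A : Lp ℝ p μ →L[ℝ] Lp ℝ p μ) : Lp B p μ →L[ℝ] Lp B p μ :=
  if h : ∃ A' : Lp B p μ →L[ℝ] Lp B p μ,
      ∀ (φ : Lp ℝ p μ) (b : B), A' (elemTensor φ b) = elemTensor (A φ) b
  then h.choose else 0

open Classical in
/-- The bounded operator on `L^p(Ω)`, `p < ∞`, that agrees on `L^2 ∩ L^p` with a given operator
on `L^2(Ω)` (unique, as `L^2 ∩ L^p` is dense in `L^p`). The value is `0` if there is none. -/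
def lpExtension (p : ℝ≥0∞) [Fact (1 ≤ p)] (A : Lp ℝ 2 μ →L[ℝ] Lp ℝ 2 μ) :
    Lp ℝ p μ →L[ℝ] Lp ℝ p μ :=
  if h : ∃ A' : Lp ℝ p μ →L[ℝ] Lp ℝ p μ,
      ∀ (f : Lp ℝ 2 μ) (g : Lp ℝ p μ), (f : Ω → ℝ) =ᵐ[μ] g → (A f : Ω → ℝ) =ᵐ[μ] A' g
  then h.choose else 0

end VectorValued

namespace SymmetricDiffusionSemigroup

variable {Ω : Type*} [MeasurableSpace Ω] {μ : Measure Ω} (S : SymmetricDiffusionSemigroup μ)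

theorem norm_apply_le (p : ℝ≥0∞) [Fact (1 ≤ p)] {t : ℝ} (ht : 0 ≤ t) (f : Lp ℝ p μ) :
    ‖S.T t p f‖ ≤ ‖f‖ := by
  simpa using (S.T t p).le_of_opNorm_le (S.contractive t ht p) f

theorem norm_sub_le {s t : ℝ} (hs : 0 ≤ s) (hst : s ≤ t) (f : Lp ℝ 2 μ) :
    ‖S.T t 2 f - S.T s 2 f‖ ≤ ‖S.T (t - s) 2 f - f‖ := by
  have h : S.T t 2 = (S.T s 2).comp (S.T (t - s) 2) := by
    rw [← S.T_add s (t - s) hs (by linarith) 2]; congr 1; ring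
  rw [h, ContinuousLinearMap.comp_apply, ← map_sub]
  exact S.norm_apply_le 2 hs _

theorem continuousOn_orbit (f : Lp ℝ 2 μ) :
    ContinuousOn (fun t => S.T t 2 f) (Set.Ioi 0) := by
  intro t ht
  refine ContinuousAt.continuousWithinAt ?_
  rw [Metric.continuousAt_iff]
  intro ε hε
  obtain ⟨δ, hδ, h⟩ := (Metric.tendsto_nhdsWithin_nhds.1 (S.continuous_zero f)) ε hε
  refine ⟨min δ t, lt_min hδ ht, fun {s} hs => ?_⟩
  have hs1 : |s - t| < δ := lt_of_lt_of_le hs (min_le_left _ _)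
  have hs2 : |s - t| < t := lt_of_lt_of_le hs (min_le_right _ _)
  rw [abs_lt] at hs2
  have key : ∀ a : ℝ, 0 < a → a < δ → ‖S.T a 2 f - f‖ < ε := by
    intro a ha had
    have := h (x := a) ha (by rw [dist_zero_right, Real.norm_eq_abs, abs_of_pos ha]; exact had)
    rwa [dist_eq_norm] at this
  rcases lt_trichotomy s t with hlt | heq | hgt
  · rw [dist_comm, dist_eq_norm]
    refine lt_of_le_of_lt (S.norm_sub_le (by linarith) hlt.le f) (key _ (by linarith) ?_)
    rw [abs_lt] at hs1; linarith
  · rw [heq, dist_self]; exact hε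
  · rw [dist_eq_norm]
    refine lt_of_le_of_lt (S.norm_sub_le (le_of_lt ht) hgt.le f) (key _ (by linarith) ?_)
    rw [abs_lt] at hs1; linarith

theorem integrable_weight :
    IntegrableOn (fun u : ℝ => Real.exp (-u) / √u) (Set.Ioi 0) := by
  refine (Real.GammaIntegral_convergent (s := 1 / 2) (by norm_num)).congr_fun (fun u hu => ?_)
    measurableSet_Ioi
  simp only
  rw [show (1 / 2 - 1 : ℝ) = -(1 / 2) by norm_num, Real.rpow_neg (le_of_lt hu),
    ← Real.sqrt_eq_rpow, div_eq_mul_inv]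

theorem integrable_orbit {t : ℝ} (ht : 0 < t) (f : Lp ℝ 2 μ) :
    IntegrableOn (fun u : ℝ => (Real.exp (-u) / √u) • S.T (t ^ 2 / (4 * u)) 2 f)
      (Set.Ioi 0) := by
  refine Integrable.mono' (integrable_weight.mul_const ‖f‖) ?_ ?_
  · refine ContinuousOn.aestronglyMeasurable ?_ measurableSet_Ioi
    have h1 : ContinuousOn (fun u : ℝ => Real.exp (-u) / √u) (Set.Ioi 0) :=
      ContinuousOn.div (Continuous.continuousOn (by fun_prop))
        (Continuous.continuousOn (by fun_prop)) (fun u hu => (Real.sqrt_pos.2 hu).ne')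
    have h2 : ContinuousOn (fun u : ℝ => t ^ 2 / (4 * u)) (Set.Ioi 0) := by
      refine ContinuousOn.div (Continuous.continuousOn (by fun_prop))
        (Continuous.continuousOn (by fun_prop)) (fun u hu => ?_)
      have : (0 : ℝ) < u := hu
      positivity
    refine h1.smul ((S.continuousOn_orbit f).comp h2 (fun u hu => ?_))
    have : (0 : ℝ) < u := hu
    exact Set.mem_Ioi.2 (by positivity)
  · refine (ae_restrict_mem measurableSet_Ioi).mono (fun u hu => ?_)
    have hu' : (0 : ℝ) < u := hu
    rw [norm_smul, Real.norm_of_nonneg (by positivity)]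
    exact mul_le_mul_of_nonneg_left (S.norm_apply_le 2 (by positivity) f) (by positivity)

theorem norm_subordinate_le {t : ℝ} (f : Lp ℝ 2 μ) :
    ‖subordinate (fun s => S.T s 2) t f‖ ≤
      ((√Real.pi)⁻¹ * ∫ u in Set.Ioi (0 : ℝ), Real.exp (-u) / √u) * ‖f‖ := by
  unfold subordinate
  rw [norm_smul, Real.norm_of_nonneg (by positivity), mul_assoc, ← integral_mul_const]
  refine mul_le_mul_of_nonneg_left ?_ (by positivity)
  refine norm_integral_le_of_norm_le (integrable_weight.mul_const ‖f‖) ?_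
  refine (ae_restrict_mem measurableSet_Ioi).mono (fun u hu => ?_)
  have hu' : (0 : ℝ) < u := hu
  rw [norm_smul, Real.norm_of_nonneg (by positivity)]
  exact mul_le_mul_of_nonneg_left (S.norm_apply_le 2 (by positivity) f) (by positivity)

/-- The subordinated Poisson operator `P_t` on `L^2(Ω)`. -/
def poissonL2 (t : ℝ) (ht : 0 < t) : Lp ℝ 2 μ →L[ℝ] Lp ℝ 2 μ :=
  LinearMap.mkContinuous
    { toFun := fun f => subordinate (fun s => S.T s 2) t f
      map_add' := fun f g => by
        simp only [subordinate, map_add, smul_add]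
        rw [integral_add (S.integrable_orbit ht f) (S.integrable_orbit ht g), smul_add]
      map_smul' := fun c f => by
        have h : ∀ u : ℝ, (Real.exp (-u) / √u) • S.T (t ^ 2 / (4 * u)) 2 (c • f)
            = c • ((Real.exp (-u) / √u) • S.T (t ^ 2 / (4 * u)) 2 f) := fun u => by
          rw [map_smul, smul_comm]
        simp only [subordinate, h, RingHom.id_apply]
        rw [integral_smul, smul_comm] }
    _ (fun f => S.norm_subordinate_le f)

/-- The space `𝔽 ⊆ L^2(Ω)` of the fixed points of the subordinated Poisson semigroup. -/
def fixedSpace : Submodule ℝ (Lp ℝ 2 μ) where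
  carrier := {f | ∀ t : ℝ, 0 < t → subordinate (fun s => S.T s 2) t f = f}
  add_mem' := fun {f g} hf hg t ht => by
    have h := map_add (S.poissonL2 t ht) f g
    exact h.trans (congrArg₂ _ (hf t ht) (hg t ht))
  zero_mem' := fun t ht => map_zero (S.poissonL2 t ht)
  smul_mem' := fun c {f} hf t ht => by
    have h := map_smul (S.poissonL2 t ht) c f
    exact h.trans (congrArg _ (hf t ht))

theorem isClosed_fixedSpace : IsClosed (S.fixedSpace : Set (Lp ℝ 2 μ)) := by
  have h : (S.fixedSpace : Set (Lp ℝ 2 μ)) = ⋂ (t : ℝ) (ht : 0 < t),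
      {f | S.poissonL2 t ht f = f} := by
    ext f
    rw [Set.mem_iInter₂]
    rfl
  rw [h]
  exact isClosed_iInter fun t => isClosed_iInter fun ht =>
    isClosed_eq (S.poissonL2 t ht).continuous continuous_id

instance : CompleteSpace S.fixedSpace := S.isClosed_fixedSpace.completeSpace_coe

/-- The orthogonal projection of `L^2(Ω)` onto `𝔽`. -/
def fixProjL2 : Lp ℝ 2 μ →L[ℝ] Lp ℝ 2 μ := S.fixedSpace.starProjection

section BanachValued

variable {B : Type*} [NormedAddCommGroup B] [NormedSpace ℝ B] {p : ℝ≥0∞} [Fact (1 ≤ p)]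

/-- The extension of `T t` to `L^p_B(Ω)`. -/
def bochnerT (t : ℝ) : Lp B p μ →L[ℝ] Lp B p μ := tensorExtension B (S.T t p)

/-- The subordinated Poisson semigroup on `L^p_B(Ω)`. -/
def poisson (t : ℝ) (f : Lp B p μ) : Lp B p μ := subordinate (fun s => S.bochnerT s) t f

/-- The projection `F` onto the fixed points of the subordinated Poisson semigroup, extended
from `L^2(Ω)` to `L^p(Ω)` and then to `L^p_B(Ω)`. -/
def fixProj : Lp B p μ →L[ℝ] Lp B p μ := tensorExtension B (lpExtension p S.fixProjL2)

/-- `u t x` is a representative of `P_t f(x)`, `t > 0`, for which `∂/∂t P_t f(x)` makes sense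
pointwise: for almost every `x` it is differentiable at every `t > 0`. Two such
representatives satisfy, for almost every `x`, `u t x = v t x` for all `t > 0` at once (by
continuity in `t`, it is enough to compare them at rational times). -/
structure IsPoissonVersion (f : Lp B p μ) (u : ℝ → Ω → B) : Prop where
  ae_eq : ∀ t : ℝ, 0 < t → u t =ᵐ[μ] S.poisson t f
  differentiable : ∀ᵐ x ∂μ, ∀ t : ℝ, 0 < t → DifferentiableAt ℝ (fun s => u s x) t

open Classical in
/-- A version of `(t, x) ↦ P_t f(x)` that is differentiable in `t`. -/
def poissonVersion (f : Lp B p μ) : ℝ → Ω → B :=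
  if h : ∃ u, S.IsPoissonVersion f u then h.choose else 0

/-- The generalized Littlewood-Paley `g`-function
`𝔊_q f(x) = (∫_0^∞ ‖t ∂/∂t P_t f(x)‖^q dt/t)^{1/q}`, with values in `[0, ∞]`. -/
def gFunction (q : ℝ) (f : Lp B p μ) (x : Ω) : ℝ≥0∞ :=
  (∫⁻ t in Set.Ioi (0 : ℝ),
    ‖t • deriv (fun s => S.poissonVersion f s x) t‖ₑ ^ q / ENNReal.ofReal t) ^ (1 / q)

end BanachValued

end SymmetricDiffusionSemigroup

end

/-!
# Duality for the generalized Littlewood-Paley `g`-function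

Write `∂P_t` for the operator `∂/∂t P_t`, `F` for the projection onto the fixed points, and fix a
bilinear form `⟨b', b⟩` on `B' × B` that norms both spaces. Both implications come from the identity
`⟨g, f⟩ - ⟨F g, f⟩ = 4 ∫_0^∞ t ⟨∂P_t g, ∂P_t f⟩ dt`, used in opposite directions.

**Upper estimate implies lower estimate** (`lower_of_upper`). For `φ(t) = ⟨P_{2t} g, f⟩` the semigroup
law and symmetry give `φ'' = 4 ⟨∂P_t g, ∂P_t f⟩`, and `φ` runs from `⟨g, f⟩` to `⟨F g, f⟩` because
`P_t → F` strongly (`tendsto_poisson_fixProj`). Two integrations by parts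
(`ofReal_abs_sub_le_of_deriv2`) and Hölder's inequality, in `t` and in `x`, bound the difference by
the norms of `𝔊_{q'} g` and `𝔊_q f` (`ofReal_abs_lpPairing_sub_le`). The upper estimate for `𝔊_q f`
then controls `⟨g, f⟩`, and the supremum over `f` gives the lower estimate for `g`.

**Lower estimate implies upper estimate** (`upper_of_lower`). Up to constants the norm of `𝔊_q f` is
at most that of the dyadic square function `(∑_l ‖2^l ∂P_{2^l} f‖^q)^{1/q}` (`exists_gFunction_le`).
A family `(h_l)` in `L^{p'}(ℓ^{q'}_{B'})` norms these pieces (`exists_norming_family`), and by symmetry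
its pairing with them is `⟨g, f⟩`, where `g = ∑_l 2^l ∂P_{2^l} h_l` (`dyadicSum`). Here `F g = 0`,
so the lower estimate bounds `g` by `𝔊_{q'} g`, hence by the square function of `g`. The latter is
bounded by the mixed norm of `(h_l)` (`exists_mixedPow_dyadicSum_le`) because of almost orthogonality:
`2^j ∂P_{2^j} 2^l ∂P_{2^l} = 2^{j+l} ∂²P_{2^j+2^l}` is dominated by `2^{-|j-l|} P_{(2^j+2^l)/2}`.

What makes the vector-valued estimates possible is positivity: an operator averaging the `T_a ⊗ I`
with a signed density is dominated pointwise by the scalar operator with a larger density, applied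
to the pointwise norm (`normLp_kernelOp_le`). Comparing densities yields Harnack's inequality for
`P_t`, which discretizes the time variable, and the bound on `∂²P_t`. The scalar input is Stein's
inequality `‖(∑ |P_{t_i} h_i|^q)^{1/q}‖_p ≤ C ‖(∑ |h_i|^q)^{1/q}‖_p` (`exists_stein_const`): for
`q < p` it follows by Jensen's inequality and duality from the maximal theorem
(`exists_maximal_const`), which Harnack's inequality reduces to the maximal ergodic inequality
(`hopf_maximal`) for a single operator `P_δ`; the case `q > p` is dual, and `q = p` is trivial.

In the variable `t²` the function `P_t f` is, up to a factor, a Laplace transform. Its Taylor series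
converges normally in `L^p_B(Ω)`, thus pointwise almost everywhere (`ae_analyticOnNhd_tsum`), which
provides the pointwise differentiable representatives in the definition of `𝔊_q`
(`exists_isPoissonVersion`). The theorem is the case of the real part of the canonical pairing
between a Banach space and its dual (`reDualPairing`).
-/

noncomputable section

/-! ### Extension of positive operators to Bochner spaces -/

section TensorExtension

variable {Ω : Type*} [MeasurableSpace Ω] {μ : Measure Ω} {p : ℝ≥0∞}
  {B : Type*} [NormedAddCommGroup B]

/-- The pointwise norm `x ↦ ‖f x‖` of `f ∈ L^p_B(Ω)`, as an element of `L^p(Ω)`. -/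
def normLp (f : Lp B p μ) : Lp ℝ p μ :=
  lipschitzWith_one_norm.compLp norm_zero f

theorem coeFn_normLp (f : Lp B p μ) : normLp f =ᵐ[μ] fun x => ‖f x‖ :=
  LipschitzWith.coeFn_compLp _ _ _

theorem norm_normLp (f : Lp B p μ) : ‖normLp f‖ = ‖f‖ := by
  refine le_antisymm (Lp.norm_le_norm_of_ae_le ?_) (Lp.norm_le_norm_of_ae_le ?_) <;>
  filter_upwards [coeFn_normLp f] with x hx <;> simp [hx]

theorem normLp_nonneg (f : Lp B p μ) : 0 ≤ normLp f := by
  rw [← Lp.coeFn_nonneg]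
  filter_upwards [coeFn_normLp f] with x hx
  simp [hx]

variable [NormedSpace ℝ B]

theorem compLp_le_normLp {ξ : B →L[ℝ] ℝ} (hξ : ‖ξ‖ ≤ 1) (f : Lp B p μ) :
    ξ.compLp f ≤ normLp f := by
  rw [← Lp.coeFn_le]
  filter_upwards [ξ.coeFn_compLp f, coeFn_normLp f] with x h1 h2
  rw [h1, h2]
  exact (le_abs_self _).trans ((ξ.le_of_opNorm_le hξ _).trans (by simp))

/-- Domination of a vector-valued function can be tested on functionals, since its essential
range is separable and hence normed by countably many of them. -/
theorem normLp_le_of_forall_dual {f : Lp B p μ} {h : Lp ℝ p μ}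
    (H : ∀ ξ : B →L[ℝ] ℝ, ‖ξ‖ ≤ 1 → ξ.compLp f ≤ h) : normLp f ≤ h := by
  obtain ⟨t, htc, htd⟩ := (Lp.stronglyMeasurable f).isSeparable_range
  have hdual : ∀ b : B, ∃ ξ : B →L[ℝ] ℝ, ‖ξ‖ ≤ 1 ∧ ξ b = ‖b‖ := fun b => exists_dual_vector'' ℝ b
  choose ξ hξ1 hξ using hdual
  have hall : ∀ᵐ x ∂μ, ∀ b ∈ t, ξ b (f x) ≤ h x := by
    rw [ae_ball_iff htc]
    intro b _
    filter_upwards [(Lp.coeFn_le _ _).2 (H (ξ b) (hξ1 b)), (ξ b).coeFn_compLp f] with x h1 h2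
    rwa [← h2]
  rw [← Lp.coeFn_le]
  filter_upwards [hall, coeFn_normLp f] with x hx hn
  rw [hn]
  refine le_of_forall_pos_le_add fun ε hε => ?_
  obtain ⟨b, hbt, hb⟩ := Metric.mem_closure_iff.1 (htd (Set.mem_range_self x)) (ε / 2) (by linarith)
  have h1 := hx b hbt
  rw [dist_eq_norm] at hb
  have h2 : ξ b (b - f x) ≤ ‖f x - b‖ := by
    rw [norm_sub_rev]
    exact (le_abs_self _).trans (((ξ b).le_of_opNorm_le (hξ1 b) _).trans (by simp))
  rw [map_sub, hξ] at h2
  have h3 := norm_sub_norm_le (f x) b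
  linarith

theorem coeFn_elemTensor [Fact (1 ≤ p)] (φ : Lp ℝ p μ) (b : B) :
    elemTensor φ b =ᵐ[μ] fun x => φ x • b := by
  filter_upwards [(ContinuousLinearMap.toSpanSingleton ℝ b).coeFn_compLp φ] with x hx
  simp [elemTensor, hx]

variable [Fact (1 ≤ p)]

/-- The elementary tensors as a bilinear map. -/
def elemTensorₗ (p : ℝ≥0∞) [Fact (1 ≤ p)] (μ : Measure Ω) (B : Type*) [NormedAddCommGroup B]
    [NormedSpace ℝ B] : Lp ℝ p μ →ₗ[ℝ] B →ₗ[ℝ] Lp B p μ :=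
  LinearMap.mk₂ ℝ elemTensor
    (fun φ ψ b => by
      ext1
      filter_upwards [coeFn_elemTensor (φ + ψ) b, coeFn_elemTensor φ b, coeFn_elemTensor ψ b,
        Lp.coeFn_add φ ψ, Lp.coeFn_add (elemTensor φ b) (elemTensor ψ b)] with x h1 h2 h3 h4 h5
      rw [h1, h5, Pi.add_apply, h2, h3, h4, Pi.add_apply, add_smul])
    (fun c φ b => by
      ext1
      filter_upwards [coeFn_elemTensor (c • φ) b, coeFn_elemTensor φ b,
        Lp.coeFn_smul c φ, Lp.coeFn_smul c (elemTensor φ b)] with x h1 h2 h3 h4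
      simp [h1, h2, h3, h4, mul_smul])
    (fun φ b b' => by
      ext1
      filter_upwards [coeFn_elemTensor φ (b + b'), coeFn_elemTensor φ b, coeFn_elemTensor φ b',
        Lp.coeFn_add (elemTensor φ b) (elemTensor φ b')] with x h1 h2 h3 h4
      rw [h1, h4, Pi.add_apply, h2, h3, smul_add])
    (fun c φ b => by
      ext1
      filter_upwards [coeFn_elemTensor φ (c • b), coeFn_elemTensor φ b,
        Lp.coeFn_smul c (elemTensor φ b)] with x h1 h2 h3
      simp only [h1, h2, h3, Pi.smul_apply]
      rw [smul_comm])

@[simp] theorem elemTensorₗ_apply (φ : Lp ℝ p μ) (b : B) :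
    elemTensorₗ p μ B φ b = elemTensor φ b := rfl

theorem continuous_elemTensor (b : B) : Continuous fun φ : Lp ℝ p μ => elemTensor φ b :=
  ContinuousLinearMap.continuous ((ContinuousLinearMap.toSpanSingleton ℝ b).compLpL p μ)

theorem indicatorConstLp_eq_elemTensor {s : Set Ω} (hs : MeasurableSet s) (hμs : μ s ≠ ∞) (b : B) :
    indicatorConstLp p hs hμs b = elemTensor (indicatorConstLp p hs hμs (1 : ℝ)) b := by
  ext1
  filter_upwards [coeFn_elemTensor (indicatorConstLp p hs hμs (1 : ℝ)) b,
    indicatorConstLp_coeFn (p := p) (hs := hs) (hμs := hμs) (c := b),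
    indicatorConstLp_coeFn (p := p) (hs := hs) (hμs := hμs) (c := (1 : ℝ))] with x h1 h2 h3
  rw [h1, h2, h3]
  by_cases hx : x ∈ s <;> simp [hx]

/-- A closed property of `f ∈ L^p_B(Ω)` that is stable under sums holds as soon as it holds
for the tensors `1_s ⊗ b` with `s` of finite measure. -/
theorem Lp_induction_indicator (hp : p ≠ ∞) (P : Lp B p μ → Prop)
    (hind : ∀ (s : Set Ω) (hs : MeasurableSet s) (hμs : μ s ≠ ∞) (b : B),
      P (elemTensor (indicatorConstLp p hs hμs (1 : ℝ)) b))
    (hadd : ∀ f g, P f → P g → P (f + g)) (hcl : IsClosed {f | P f}) (f : Lp B p μ) : P f := by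
  refine Lp.induction hp P ?_ (fun f g hf hg _ h1 h2 => hadd _ _ h1 h2) hcl f
  intro c s hs hμs
  have := hind s hs hμs.ne c
  rw [← indicatorConstLp_eq_elemTensor] at this
  exact this

/-- Two bounded operators on `L^p_B(Ω)` that agree on the tensors `1_s ⊗ b` are equal. -/
theorem clm_ext_indicator {E : Type*} [NormedAddCommGroup E] [NormedSpace ℝ E] (hp : p ≠ ∞)
    {A A' : Lp B p μ →L[ℝ] E}
    (h : ∀ (s : Set Ω) (hs : MeasurableSet s) (hμs : μ s ≠ ∞) (b : B),
      A (elemTensor (indicatorConstLp p hs hμs (1 : ℝ)) b)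
        = A' (elemTensor (indicatorConstLp p hs hμs (1 : ℝ)) b)) : A = A' := by
  ext1 f
  refine Lp_induction_indicator hp (fun f => A f = A' f) h (fun f g hf hg => ?_)
    (isClosed_eq A.continuous A'.continuous) f
  rw [map_add, map_add, hf, hg]

theorem compLp_elemTensor (ξ : B →L[ℝ] ℝ) (φ : Lp ℝ p μ) (b : B) :
    ξ.compLp (elemTensor φ b) = ξ b • φ := by
  ext1
  filter_upwards [ξ.coeFn_compLp (elemTensor φ b), coeFn_elemTensor φ b,
    Lp.coeFn_smul (ξ b) φ] with x h1 h2 h3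
  simp [h1, h2, h3, mul_comm]

theorem denseRange_lift_elemTensor (hp : p ≠ ∞) :
    DenseRange (TensorProduct.lift (elemTensorₗ p μ B)) := by
  intro f
  refine Lp_induction_indicator hp (fun f => f ∈ closure _) (fun s hs hμs b => ?_)
    (fun f g hf hg => ?_) isClosed_closure f
  · exact subset_closure ⟨TensorProduct.tmul ℝ (indicatorConstLp p hs hμs (1 : ℝ)) b, by simp⟩
  · have := (TensorProduct.lift (elemTensorₗ p μ B)).range.topologicalClosure.add_mem hf hg
    exact this

theorem positive_mono {A : Lp ℝ p μ →L[ℝ] Lp ℝ p μ} (hA : ∀ φ, 0 ≤ φ → 0 ≤ A φ)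
    {φ ψ : Lp ℝ p μ} (h : φ ≤ ψ) : A φ ≤ A ψ := by
  have := hA (ψ - φ) (sub_nonneg.2 h)
  rwa [map_sub, sub_nonneg] at this

/-- A positive operator extends to `L^p_B(Ω)`: on the algebraic tensor product it is bounded
because, by testing on functionals, `‖(A ⊗ I) f‖ ≤ A ‖f‖` pointwise; then one extends by
density. -/
theorem exists_tensorExtension [CompleteSpace B] (hp : p ≠ ∞) {A : Lp ℝ p μ →L[ℝ] Lp ℝ p μ}
    (hA : ∀ φ, 0 ≤ φ → 0 ≤ A φ) :
    ∃ A' : Lp B p μ →L[ℝ] Lp B p μ, ∀ (φ : Lp ℝ p μ) (b : B),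
      A' (elemTensor φ b) = elemTensor (A φ) b := by
  obtain ⟨e, he, hed⟩ : ∃ e : TensorProduct ℝ (Lp ℝ p μ) B →ₗ[ℝ] Lp B p μ,
      (∀ φ b, e (TensorProduct.tmul ℝ φ b) = elemTensor φ b) ∧ DenseRange e :=
    ⟨TensorProduct.lift (elemTensorₗ p μ B), fun φ b => by simp, denseRange_lift_elemTensor hp⟩
  obtain ⟨e', he'⟩ : ∃ e' : TensorProduct ℝ (Lp ℝ p μ) B →ₗ[ℝ] Lp B p μ,
      ∀ φ b, e' (TensorProduct.tmul ℝ φ b) = elemTensor (A φ) b :=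
    ⟨e.comp (LinearMap.rTensor B (A : Lp ℝ p μ →ₗ[ℝ] Lp ℝ p μ)), fun φ b => by
      rw [LinearMap.comp_apply, LinearMap.rTensor_tmul, he]; rfl⟩
  have hξ : ∀ (ξ : B →L[ℝ] ℝ) (z : TensorProduct ℝ (Lp ℝ p μ) B),
      ξ.compLpL p μ (e' z) = A (ξ.compLpL p μ (e z)) := by
    intro ξ z
    induction z with
    | zero => simp
    | add z w hz hw => simp only [map_add, hz, hw]
    | tmul φ b =>
      rw [he, he']
      change ξ.compLp (elemTensor (A φ) b) = A (ξ.compLp (elemTensor φ b))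
      rw [compLp_elemTensor, compLp_elemTensor, map_smul]
  have hdom : ∀ z, normLp (e' z) ≤ A (normLp (e z)) := by
    refine fun z => normLp_le_of_forall_dual fun ξ h1 => ?_
    refine (hξ ξ z).le.trans (positive_mono hA (compLp_le_normLp h1 _))
  have hnorm : ∀ z, ‖e' z‖ ≤ ‖A‖ * ‖e z‖ := by
    intro z
    rw [← norm_normLp, ← norm_normLp (e z)]
    refine le_trans (norm_le_norm_of_abs_le_abs ?_) (A.le_opNorm _)
    rw [abs_of_nonneg (normLp_nonneg _)]
    exact (hdom z).trans (le_abs_self _)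
  refine ⟨e'.extendOfNorm e, fun φ b => ?_⟩
  have := LinearMap.extendOfNorm_eq hed ⟨_, hnorm⟩ (TensorProduct.tmul ℝ φ b)
  rwa [he, he'] at this

theorem tensorExtension_elemTensor_of_exists {A : Lp ℝ p μ →L[ℝ] Lp ℝ p μ}
    (h : ∃ A' : Lp B p μ →L[ℝ] Lp B p μ, ∀ (φ : Lp ℝ p μ) (b : B),
      A' (elemTensor φ b) = elemTensor (A φ) b) (φ : Lp ℝ p μ) (b : B) :
    tensorExtension B A (elemTensor φ b) = elemTensor (A φ) b := by
  rw [tensorExtension, dif_pos h]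
  exact h.choose_spec φ b

variable [CompleteSpace B]

theorem tensorExtension_elemTensor (hp : p ≠ ∞) {A : Lp ℝ p μ →L[ℝ] Lp ℝ p μ}
    (hA : ∀ φ, 0 ≤ φ → 0 ≤ A φ) (φ : Lp ℝ p μ) (b : B) :
    tensorExtension B A (elemTensor φ b) = elemTensor (A φ) b :=
  tensorExtension_elemTensor_of_exists (exists_tensorExtension hp hA) φ b

theorem compLp_tensorExtension (hp : p ≠ ∞) {A : Lp ℝ p μ →L[ℝ] Lp ℝ p μ}
    (hA : ∀ φ, 0 ≤ φ → 0 ≤ A φ) (ξ : B →L[ℝ] ℝ) (f : Lp B p μ) :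
    ξ.compLp (tensorExtension B A f) = A (ξ.compLp f) := by
  have : (ξ.compLpL p μ).comp (tensorExtension B A) = A.comp (ξ.compLpL p μ) := by
    refine clm_ext_indicator hp fun s hs hμs b => ?_
    change ξ.compLp (tensorExtension B A (elemTensor _ b)) = A (ξ.compLp (elemTensor _ b))
    rw [tensorExtension_elemTensor hp hA, compLp_elemTensor, compLp_elemTensor, map_smul]
  exact congrArg (fun L => L f) this

/-- Pointwise domination `‖(A ⊗ I) f‖ ≤ A ‖f‖` for positive `A`. -/
theorem normLp_tensorExtension_le (hp : p ≠ ∞) {A : Lp ℝ p μ →L[ℝ] Lp ℝ p μ}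
    (hA : ∀ φ, 0 ≤ φ → 0 ≤ A φ) (f : Lp B p μ) :
    normLp (tensorExtension B A f) ≤ A (normLp f) :=
  normLp_le_of_forall_dual fun ξ hξ => (compLp_tensorExtension hp hA ξ f).le.trans
    (positive_mono hA (compLp_le_normLp hξ _))

omit [NormedSpace ℝ B] [CompleteSpace B] in
theorem norm_le_norm_of_normLp_le {f : Lp B p μ} {h : Lp ℝ p μ} (H : normLp f ≤ h) :
    ‖f‖ ≤ ‖h‖ := by
  rw [← norm_normLp f]
  refine norm_le_norm_of_abs_le_abs ?_
  rw [abs_of_nonneg (normLp_nonneg _)]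
  exact H.trans (le_abs_self _)

theorem norm_tensorExtension_le (hp : p ≠ ∞) {A : Lp ℝ p μ →L[ℝ] Lp ℝ p μ}
    (hA : ∀ φ, 0 ≤ φ → 0 ≤ A φ) : ‖tensorExtension B A‖ ≤ ‖A‖ := by
  refine ContinuousLinearMap.opNorm_le_bound _ (norm_nonneg _) fun f => ?_
  rw [← norm_normLp f]
  exact (norm_le_norm_of_normLp_le (normLp_tensorExtension_le hp hA f)).trans (A.le_opNorm _)

omit [CompleteSpace B] in
/-- The extension is the only bounded operator that acts as expected on the `1_s ⊗ b`. -/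
theorem tensorExtension_eq (hp : p ≠ ∞) {A : Lp ℝ p μ →L[ℝ] Lp ℝ p μ}
    {A' : Lp B p μ →L[ℝ] Lp B p μ}
    (h : ∀ (φ : Lp ℝ p μ) (b : B), A' (elemTensor φ b) = elemTensor (A φ) b) :
    tensorExtension B A = A' :=
  clm_ext_indicator hp fun s hs hμs b => by
    rw [tensorExtension_elemTensor_of_exists ⟨A', h⟩, h]

theorem elemTensor_real (φ : Lp ℝ p μ) (b : ℝ) : elemTensor φ b = b • φ := by
  ext1
  filter_upwards [coeFn_elemTensor φ b, Lp.coeFn_smul b φ] with x h1 h2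
  simp [h1, h2, mul_comm]

theorem tensorExtension_real (hp : p ≠ ∞) (A : Lp ℝ p μ →L[ℝ] Lp ℝ p μ) :
    tensorExtension ℝ A = A :=
  tensorExtension_eq hp fun φ b => by rw [elemTensor_real, elemTensor_real, map_smul]

end TensorExtension

/-! ### The Poisson subordination kernel -/

section Kernel

open Set

theorem integrableOn_exp_div_sqrt {τ : ℝ} (hτ : 0 < τ) :
    IntegrableOn (fun v : ℝ => Real.exp (-(τ * v)) / √v) (Ioi 0) := by
  have h := integrableOn_rpow_mul_exp_neg_mul_rpow (p := 1) (s := -(1 / 2)) (b := τ)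
    (by norm_num) one_pos hτ
  refine h.congr_fun (fun v hv => ?_) measurableSet_Ioi
  have hv' : (0 : ℝ) < v := hv
  simp only [Real.rpow_one]
  rw [Real.rpow_neg hv'.le, ← Real.sqrt_eq_rpow, neg_mul]
  field_simp

theorem integrableOn_pow_mul_exp_div_sqrt {τ : ℝ} (hτ : 0 < τ) (m : ℕ) :
    IntegrableOn (fun v : ℝ => v ^ m * (Real.exp (-(τ * v)) / √v)) (Ioi 0) := by
  have h := integrableOn_rpow_mul_exp_neg_mul_rpow (p := 1) (s := m - 1 / 2) (b := τ)
    (by have : (0 : ℝ) ≤ m := m.cast_nonneg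
        linarith) one_pos hτ
  refine h.congr_fun (fun v hv => ?_) measurableSet_Ioi
  have hv' : (0 : ℝ) < v := hv
  simp only [Real.rpow_one]
  rw [Real.rpow_sub hv', Real.rpow_natCast, ← Real.sqrt_eq_rpow, neg_mul]
  field_simp

/-- The Cauchy–Schlömilch substitution `y = t √v - c / √v`, combined with the symmetry
`v ↦ c² / (t² v)` of the integrand. -/
theorem integral_exp_neg_add_div {t c : ℝ} (ht : 0 < t) (hc : 0 < c) :
    ∫ v in Ioi (0 : ℝ), Real.exp (-(t ^ 2 * v) - c ^ 2 / v) / √v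
      = √Real.pi / t * Real.exp (-(2 * t * c)) := by
  set E : ℝ → ℝ := fun v => Real.exp (-(t ^ 2 * v) - c ^ 2 / v) with hE
  have hA : IntegrableOn (fun v => E v / √v) (Ioi 0) := by
    refine Integrable.mono' (integrableOn_exp_div_sqrt (pow_pos ht 2)) ?_ ?_
    · refine Measurable.aestronglyMeasurable ?_
      simp only [hE]
      fun_prop
    · refine (ae_restrict_mem measurableSet_Ioi).mono fun v hv => ?_
      have hv' : (0 : ℝ) < v := hv
      rw [Real.norm_of_nonneg (by positivity)]
      refine div_le_div_of_nonneg_right (Real.exp_le_exp.2 ?_) (by positivity)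
      have : 0 ≤ c ^ 2 / v := by positivity
      linarith
  -- the substitution `v ↦ c² / (t² v)`, which preserves `E`
  have hinv_deriv : ∀ v ∈ Ioi (0 : ℝ),
      HasDerivWithinAt (fun v => c ^ 2 / t ^ 2 / v) (-(c ^ 2 / t ^ 2) / v ^ 2) (Ioi 0) v := by
    intro v hv
    have hv' : (0 : ℝ) < v := hv
    have := ((hasDerivAt_const v (c ^ 2 / t ^ 2)).div (hasDerivAt_id v) hv'.ne').hasDerivWithinAt
      (s := Ioi 0)
    convert! this using 1
    simp
  have hinv_inj : InjOn (fun v : ℝ => c ^ 2 / t ^ 2 / v) (Ioi 0) := by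
    intro v hv w hw h
    have hv' : (0 : ℝ) < v := hv
    have hw' : (0 : ℝ) < w := hw
    have hk : 0 < c ^ 2 / t ^ 2 := by positivity
    simp only at h
    rw [div_eq_div_iff hv'.ne' hw'.ne'] at h
    exact (mul_left_cancel₀ hk.ne' h).symm
  have hinv_im : (fun v : ℝ => c ^ 2 / t ^ 2 / v) '' Ioi 0 = Ioi 0 := by
    ext w
    constructor
    · rintro ⟨v, hv, rfl⟩
      have hv' : (0 : ℝ) < v := hv
      exact mem_Ioi.2 (by positivity)
    · intro hw
      have hw' : (0 : ℝ) < w := hw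
      refine ⟨c ^ 2 / t ^ 2 / w, mem_Ioi.2 (by positivity), ?_⟩
      simp only
      field_simp
  have hswap : ∀ v ∈ Ioi (0 : ℝ), |-(c ^ 2 / t ^ 2) / v ^ 2| • ((fun v => E v / √v)
      (c ^ 2 / t ^ 2 / v)) = c / t * (E v / (v * √v)) := by
    intro v hv
    have hv' : (0 : ℝ) < v := hv
    have h1 : E (c ^ 2 / t ^ 2 / v) = E v := by
      simp only [hE]
      congr 1
      field_simp
      ring
    have h2 : √(c ^ 2 / t ^ 2 / v) = c / t / √v := by
      rw [Real.sqrt_div (by positivity), ← div_pow, Real.sqrt_sq (by positivity)]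
    have h3 : |-(c ^ 2 / t ^ 2) / v ^ 2| = c ^ 2 / t ^ 2 / v ^ 2 := by
      rw [neg_div, abs_neg, abs_of_nonneg (by positivity)]
    simp only [smul_eq_mul]
    rw [h1, h2, h3]
    have h4 : √v ≠ 0 := (Real.sqrt_pos.2 hv').ne'
    have h5 : v ^ 2 = v * (√v * √v) := by rw [Real.mul_self_sqrt hv'.le]; ring
    rw [h5]
    field_simp
  have hB : IntegrableOn (fun v => c / t * (E v / (v * √v))) (Ioi 0) := by
    have := (integrableOn_image_iff_integrableOn_abs_deriv_smul measurableSet_Ioi hinv_deriv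
      hinv_inj (fun v => E v / √v)).1 (by rw [hinv_im]; exact hA)
    exact this.congr_fun hswap measurableSet_Ioi
  have hAB : ∫ v in Ioi (0 : ℝ), E v / √v = ∫ v in Ioi (0 : ℝ), c / t * (E v / (v * √v)) := by
    have := integral_image_eq_integral_abs_deriv_smul measurableSet_Ioi hinv_deriv
      hinv_inj (fun v => E v / √v)
    rw [hinv_im] at this
    rw [this]
    exact setIntegral_congr_fun measurableSet_Ioi hswap
  -- the substitution `y = φ v`, which turns a Gaussian integral over `ℝ` into the average of
  -- the two integrals just compared
  set φ : ℝ → ℝ := fun v => t * √v - c / √v with hφ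
  have hφ_deriv : ∀ v ∈ Ioi (0 : ℝ),
      HasDerivWithinAt φ (t / (2 * √v) + c / (2 * (v * √v))) (Ioi 0) v := by
    intro v hv
    have hv' : (0 : ℝ) < v := hv
    have h4 : √v ≠ 0 := (Real.sqrt_pos.2 hv').ne'
    have hs := Real.hasDerivAt_sqrt hv'.ne'
    have := ((hs.const_mul t).sub ((hasDerivAt_const v c).div hs h4)).hasDerivWithinAt (s := Ioi 0)
    convert! this using 1
    rw [Real.sq_sqrt hv'.le]
    field_simp
    ring
  have hφ_mono : StrictMonoOn φ (Ioi 0) := by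
    intro v hv w hw hvw
    have hv' : (0 : ℝ) < v := hv
    have h1 : √v < √w := Real.sqrt_lt_sqrt hv'.le hvw
    have h0 : 0 < √v := Real.sqrt_pos.2 hv'
    have h2 : t * √v < t * √w := mul_lt_mul_of_pos_left h1 ht
    have h3 : c / √w < c / √v := div_lt_div_of_pos_left hc h0 h1
    simp only [hφ]
    linarith
  have hφ_im : φ '' Ioi 0 = univ := by
    refine eq_univ_of_forall fun y => ?_
    have hd : |y| < √(y ^ 2 + 4 * t * c) := by
      rw [← Real.sqrt_sq_eq_abs]
      refine Real.sqrt_lt_sqrt (sq_nonneg _) ?_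
      have : 0 < t * c := mul_pos ht hc
      linarith
    set d := √(y ^ 2 + 4 * t * c)
    have hd2 : d ^ 2 = y ^ 2 + 4 * t * c := Real.sq_sqrt (by positivity)
    have hyd : 0 < y + d := by
      have := neg_abs_le y
      linarith
    refine ⟨((y + d) / (2 * t)) ^ 2, mem_Ioi.2 (by positivity), ?_⟩
    simp only [hφ]
    rw [Real.sqrt_sq (by positivity)]
    field_simp
    nlinarith
  have hgauss := integral_image_eq_integral_abs_deriv_smul measurableSet_Ioi hφ_deriv
    hφ_mono.injOn (fun y => Real.exp (-1 * y ^ 2))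
  rw [hφ_im, Measure.restrict_univ, integral_gaussian] at hgauss
  have hint : ∀ v ∈ Ioi (0 : ℝ), |t / (2 * √v) + c / (2 * (v * √v))| • Real.exp (-1 * φ v ^ 2)
      = Real.exp (2 * t * c) * (t / 2) * (E v / √v + c / t * (E v / (v * √v))) := by
    intro v hv
    have hv' : (0 : ℝ) < v := hv
    have h4 : √v ≠ 0 := (Real.sqrt_pos.2 hv').ne'
    have h5 : Real.exp (-1 * φ v ^ 2) = Real.exp (2 * t * c) * E v := by
      simp only [hφ, hE]
      rw [← Real.exp_add]
      congr 1
      have : (t * √v - c / √v) ^ 2 = t ^ 2 * (√v) ^ 2 - 2 * t * c + c ^ 2 / (√v) ^ 2 := by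
        field_simp
        ring
      rw [this, Real.sq_sqrt hv'.le]
      ring
    rw [h5, abs_of_nonneg (by positivity), smul_eq_mul]
    field_simp
  rw [setIntegral_congr_fun measurableSet_Ioi hint, integral_const_mul, integral_add hA hB,
    ← hAB] at hgauss
  have hexp : Real.exp (2 * t * c) * Real.exp (-(2 * t * c)) = 1 := by
    rw [← Real.exp_add]; simp
  rw [div_one] at hgauss
  rw [hgauss]
  generalize Real.exp (2 * t * c) = e1 at hexp ⊢
  generalize Real.exp (-(2 * t * c)) = e2 at hexp ⊢
  generalize (∫ v in Ioi (0 : ℝ), E v / √v) = I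
  have : e1 * (t / 2) * (I + I) / t * e2 = (e1 * e2) * I := by
    field_simp
    ring
  rw [this, hexp, one_mul]

/-- The density `n_t(v) = t e^{-t² v} / √(π v)`, for which
`P_t f = ∫_0^∞ n_t(v) T_{1/(4v)} f dv`. -/
def subordKernel (t v : ℝ) : ℝ := (√Real.pi)⁻¹ * (t * (Real.exp (-(t ^ 2 * v)) / √v))

theorem measurable_subordKernel (t : ℝ) : Measurable (subordKernel t) := by
  unfold subordKernel
  fun_prop

theorem subordKernel_nonneg {t : ℝ} (ht : 0 ≤ t) (v : ℝ) : 0 ≤ subordKernel t v := by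
  unfold subordKernel
  positivity

theorem integrableOn_subordKernel {t : ℝ} (ht : 0 < t) : IntegrableOn (subordKernel t) (Ioi 0) :=
  ((integrableOn_exp_div_sqrt (pow_pos ht 2)).const_mul t).const_mul _

theorem integral_subordKernel {t : ℝ} (ht : 0 < t) : ∫ v in Ioi (0 : ℝ), subordKernel t v = 1 := by
  unfold subordKernel
  rw [integral_const_mul, integral_const_mul]
  have h : ∫ v in Ioi (0 : ℝ), Real.exp (-(t ^ 2 * v)) / √v = √Real.pi / t := by
    have h1 := integral_comp_mul_left_Ioi (fun u : ℝ => Real.exp (-u) * u ^ ((1 / 2 : ℝ) - 1)) 0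
      (pow_pos ht 2)
    rw [mul_zero, ← Real.Gamma_eq_integral one_half_pos, Real.Gamma_one_half_eq] at h1
    have h2 : ∀ v ∈ Ioi (0 : ℝ), Real.exp (-(t ^ 2 * v)) / √v
        = t * (Real.exp (-(t ^ 2 * v)) * (t ^ 2 * v) ^ ((1 / 2 : ℝ) - 1)) := by
      intro v hv
      have hv' : (0 : ℝ) < v := hv
      rw [show (1 / 2 - 1 : ℝ) = -(1 / 2) by norm_num, Real.rpow_neg (by positivity),
        ← Real.sqrt_eq_rpow, Real.sqrt_mul (by positivity), Real.sqrt_sq ht.le]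
      field_simp
    rw [setIntegral_congr_fun measurableSet_Ioi h2, integral_const_mul, h1, smul_eq_mul]
    field_simp
  rw [h]
  have : √Real.pi ≠ 0 := (Real.sqrt_pos.2 Real.pi_pos).ne'
  field_simp

/-- The identity behind subordination: the law of `1/(4v)` under `n_t(v) dv` has the Laplace
transform `l ↦ e^{-t √l}`. -/
theorem integral_exp_subordKernel {t l : ℝ} (ht : 0 < t) (hl : 0 < l) :
    ∫ v in Ioi (0 : ℝ), subordKernel t v * Real.exp (-(l * (1 / (4 * v))))
      = Real.exp (-(t * √l)) := by
  have h := integral_exp_neg_add_div ht (c := √l / 2) (by positivity)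
  have h2 : ∀ v ∈ Ioi (0 : ℝ), subordKernel t v * Real.exp (-(l * (1 / (4 * v))))
      = (√Real.pi)⁻¹ * t * (Real.exp (-(t ^ 2 * v) - (√l / 2) ^ 2 / v) / √v) := by
    intro v hv
    have hv' : (0 : ℝ) < v := hv
    rw [sub_eq_add_neg, Real.exp_add, subordKernel]
    have : (√l / 2) ^ 2 / v = l * (1 / (4 * v)) := by
      rw [div_pow, Real.sq_sqrt hl.le]
      field_simp
      norm_num
    rw [this]
    field_simp
  rw [setIntegral_congr_fun measurableSet_Ioi h2, integral_const_mul, h]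
  have : √Real.pi ≠ 0 := (Real.sqrt_pos.2 Real.pi_pos).ne'
  field_simp

/-- The law of `1/(4v)` under `n_t(v) dv`: the one-sided `1/2`-stable law, so that `P_t` is the
average of `T_a` over `a` distributed according to it. -/
def stableLaw (t : ℝ) : Measure ℝ :=
  ((volume.restrict (Ioi 0)).withDensity fun v => ENNReal.ofReal (subordKernel t v)).map
    fun v => 1 / (4 * v)

theorem measurable_quarter_inv : Measurable fun v : ℝ => 1 / (4 * v) := by fun_prop

theorem isProbabilityMeasure_stableLaw {t : ℝ} (ht : 0 < t) :
    IsProbabilityMeasure (stableLaw t) := by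
  constructor
  rw [stableLaw, Measure.map_apply measurable_quarter_inv MeasurableSet.univ, preimage_univ,
    withDensity_apply _ MeasurableSet.univ, Measure.restrict_univ,
    ← ofReal_integral_eq_lintegral_ofReal (integrableOn_subordKernel ht)
      (Eventually.of_forall fun v => subordKernel_nonneg ht.le v), integral_subordKernel ht,
    ENNReal.ofReal_one]

theorem stableLaw_Iic (t : ℝ) : stableLaw t (Iic 0) = 0 := by
  rw [stableLaw, Measure.map_apply measurable_quarter_inv measurableSet_Iic,
    withDensity_apply _ (measurable_quarter_inv measurableSet_Iic),
    Measure.restrict_restrict (measurable_quarter_inv measurableSet_Iic)]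
  have : (fun v : ℝ => 1 / (4 * v)) ⁻¹' Iic 0 ∩ Ioi 0 = ∅ := by
    ext v
    simp only [mem_inter_iff, mem_preimage, mem_Iic, mem_Ioi, mem_empty_iff_false, iff_false]
    rintro ⟨h1, h2⟩
    have : 0 < 1 / (4 * v) := by positivity
    linarith
  rw [this]
  simp

theorem ae_stableLaw_pos (t : ℝ) : ∀ᵐ a ∂(stableLaw t), 0 < a := by
  rw [ae_iff]
  simpa using! stableLaw_Iic t

theorem integral_stableLaw {E : Type*} [NormedAddCommGroup E] [NormedSpace ℝ E] {t : ℝ}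
    (ht : 0 < t) {g : ℝ → E} (hg : AEStronglyMeasurable g (stableLaw t)) :
    ∫ a, g a ∂(stableLaw t) = ∫ v in Ioi (0 : ℝ), subordKernel t v • g (1 / (4 * v)) := by
  rw [stableLaw, integral_map measurable_quarter_inv.aemeasurable hg,
    integral_withDensity_eq_integral_toReal_smul
      (measurable_subordKernel t).ennreal_ofReal (Eventually.of_forall fun _ => by simp)]
  refine setIntegral_congr_fun measurableSet_Ioi fun v _ => ?_
  rw [ENNReal.toReal_ofReal (subordKernel_nonneg ht.le v)]

/-- Finite measures on `[0, ∞)` are determined by their Laplace transform at the natural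
numbers: in the variable `e^{-a} ∈ [0, 1]` these are the moments. -/
theorem measure_ext_of_laplace {M N : Measure ℝ} [IsFiniteMeasure M] [IsFiniteMeasure N]
    (hM : ∀ᵐ a ∂M, 0 ≤ a) (hN : ∀ᵐ a ∂N, 0 ≤ a)
    (h : ∀ n : ℕ, ∫ a, Real.exp (-(n * a)) ∂M = ∫ a, Real.exp (-(n * a)) ∂N) : M = N := by
  have hexp : Measurable fun a : ℝ => Real.exp (-a) := by fun_prop
  have key : M.map (fun a => Real.exp (-a)) = N.map (fun a => Real.exp (-a)) := by
    have hfin : ∀ M : Measure ℝ, IsFiniteMeasure M →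
        IsFiniteMeasure (M.map (fun a => Real.exp (-a))) := fun M _ => inferInstance
    have := hfin M inferInstance
    have := hfin N inferInstance
    refine ext_of_forall_integral_eq_of_IsFiniteMeasure fun f => ?_
    rw [integral_map hexp.aemeasurable (by fun_prop), integral_map hexp.aemeasurable (by fun_prop)]
    have hpoly : ∀ P : Polynomial ℝ, ∫ a, P.eval (Real.exp (-a)) ∂M
        = ∫ a, P.eval (Real.exp (-a)) ∂N := by
      have hint : ∀ (M : Measure ℝ) [IsFiniteMeasure M], (∀ᵐ a ∂M, 0 ≤ a) → ∀ (c : ℝ) (n : ℕ),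
          Integrable (fun a => c * Real.exp (-(n * a))) M := by
        intro M _ hM c n
        refine (Integrable.of_bound (C := 1) (by fun_prop) ?_).const_mul c
        filter_upwards [hM] with a ha
        rw [Real.norm_of_nonneg (by positivity)]
        exact Real.exp_le_one_iff.2 (by have : 0 ≤ (n : ℝ) * a := by positivity
                                        linarith)
      intro P
      have hP : ∀ a : ℝ, P.eval (Real.exp (-a)) =
          ∑ i ∈ Finset.range (P.natDegree + 1), P.coeff i * Real.exp (-(i * a)) := by
        intro a
        rw [Polynomial.eval_eq_sum_range]
        refine Finset.sum_congr rfl fun i _ => ?_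
        rw [← Real.exp_nat_mul, mul_neg]
      simp only [hP]
      rw [integral_finsetSum _ fun i _ => hint M hM _ _,
        integral_finsetSum _ fun i _ => hint N hN _ _]
      refine Finset.sum_congr rfl fun i _ => ?_
      rw [integral_const_mul, integral_const_mul, h]
    -- Weierstrass approximation on `[0, 1]` passes from polynomials to continuous functions
    have happrox : ∀ (M : Measure ℝ) [IsFiniteMeasure M], (∀ᵐ a ∂M, 0 ≤ a) →
        ∀ (P : Polynomial ℝ) (ε : ℝ),
        (∀ x ∈ Icc (0 : ℝ) 1, |P.eval x - f x| < ε) →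
        |∫ a, P.eval (Real.exp (-a)) ∂M - ∫ a, f (Real.exp (-a)) ∂M| ≤ ε * M.real univ := by
      intro M _ hM P ε hε
      have hmem : ∀ᵐ a ∂M, Real.exp (-a) ∈ Icc (0 : ℝ) 1 := by
        filter_upwards [hM] with a ha
        exact ⟨(Real.exp_pos _).le, Real.exp_le_one_iff.2 (by linarith)⟩
      have hf : Integrable (fun a => f (Real.exp (-a))) M :=
        Integrable.of_bound (C := ‖f‖) (by fun_prop)
          (Eventually.of_forall fun a => f.norm_coe_le_norm _)
      have hd : Integrable (fun a => P.eval (Real.exp (-a)) - f (Real.exp (-a))) M := by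
        refine Integrable.of_bound (C := ε) ?_ ?_
        · have := P.continuous
          exact Continuous.aestronglyMeasurable (by fun_prop)
        · filter_upwards [hmem] with a ha
          exact (hε _ ha).le
      have hP : Integrable (fun a => P.eval (Real.exp (-a))) M := by
        exact (hd.add hf).congr (Eventually.of_forall fun a => by simp)
      rw [← integral_sub hP hf, ← Real.norm_eq_abs]
      refine (norm_integral_le_of_norm_le_const (C := ε) ?_)
      filter_upwards [hmem] with a ha
      exact (hε _ ha).le
    refine eq_of_forall_dist_le fun δ hδ => ?_
    set K := M.real univ + N.real univ + 1
    have hK : 0 < K := by positivity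
    obtain ⟨P, hP⟩ := exists_polynomial_near_of_continuousOn 0 1 f f.continuous.continuousOn
      (δ / K) (by positivity)
    have h1 := happrox M hM P _ hP
    have h2 := happrox N hN P _ hP
    rw [hpoly P] at h1
    rw [Real.dist_eq]
    have h3 : δ / K * M.real univ + δ / K * N.real univ ≤ δ := by
      rw [← mul_add, div_mul_eq_mul_div, div_le_iff₀ hK]
      exact mul_le_mul_of_nonneg_left (by simp [K]) hδ.le
    rw [abs_le] at h1 h2 ⊢
    constructor <;> linarith [h1.1, h1.2, h2.1, h2.2]
  have hlog : Measurable fun x : ℝ => -Real.log x := by fun_prop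
  have hback : ∀ M : Measure ℝ, (M.map fun a => Real.exp (-a)).map (fun x => -Real.log x) = M := by
    intro M
    rw [Measure.map_map hlog hexp]
    convert Measure.map_id
    ext a
    simp
  rw [← hback M, key, hback N]

/-- The stable laws form a convolution semigroup, because their Laplace transforms `e^{-t √l}`
multiply. -/
theorem stableLaw_conv {s t : ℝ} (hs : 0 < s) (ht : 0 < t) :
    (stableLaw s).conv (stableLaw t) = stableLaw (s + t) := by
  have := isProbabilityMeasure_stableLaw hs
  have := isProbabilityMeasure_stableLaw ht
  have := isProbabilityMeasure_stableLaw (add_pos hs ht)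
  have hlap : ∀ t : ℝ, 0 < t → ∀ n : ℕ, ∫ a, Real.exp (-(n * a)) ∂(stableLaw t)
      = Real.exp (-(t * √n)) := by
    intro t ht n
    rw [integral_stableLaw ht (by fun_prop)]
    rcases Nat.eq_zero_or_pos n with rfl | hn
    · simpa using integral_subordKernel ht
    · exact integral_exp_subordKernel ht (Nat.cast_pos.2 hn)
  have hpos : ∀ᵐ a ∂((stableLaw s).conv (stableLaw t)), 0 ≤ a := by
    rw [Measure.conv, ae_map_iff (by fun_prop) measurableSet_Ici]
    filter_upwards [Measure.quasiMeasurePreserving_fst.ae (ae_stableLaw_pos s),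
      Measure.quasiMeasurePreserving_snd.ae (ae_stableLaw_pos t)] with x h1 h2
    linarith
  refine measure_ext_of_laplace hpos ((ae_stableLaw_pos _).mono fun a ha => ha.le) fun n => ?_
  rw [integral_conv, hlap _ (add_pos hs ht)]
  · have : ∀ x y : ℝ, Real.exp (-(n * (x + y))) = Real.exp (-(n * x)) * Real.exp (-(n * y)) := by
      intro x y
      rw [← Real.exp_add]
      congr 1
      ring
    simp only [this]
    simp only [integral_const_mul, integral_mul_const, hlap s hs, hlap t ht]
    rw [← Real.exp_add]
    congr 1
    ring
  · refine Integrable.of_bound (C := 1) (by fun_prop) ?_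
    filter_upwards [hpos] with a ha
    rw [Real.norm_of_nonneg (by positivity)]
    exact Real.exp_le_one_iff.2 (by have : 0 ≤ (n : ℝ) * a := by positivity
                                    linarith)

end Kernel

/-! ### Subordination of a contraction semigroup on a Banach space -/

section AbstractSemigroup

open Set

/-- A strongly continuous semigroup of contractions `(T_t)_{t ≥ 0}`; negative times carry no
information. -/
structure IsContractionSemigroup {E : Type*} [NormedAddCommGroup E] [NormedSpace ℝ E]
    (T : ℝ → E →L[ℝ] E) : Prop where
  norm_le : ∀ t : ℝ, 0 ≤ t → ∀ f, ‖T t f‖ ≤ ‖f‖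
  add : ∀ s t : ℝ, 0 ≤ s → 0 ≤ t → ∀ f, T (s + t) f = T s (T t f)
  tendsto : ∀ f, Tendsto (fun t => T t f) (𝓝[>] 0) (𝓝 f)

variable {E : Type*} [NormedAddCommGroup E] [NormedSpace ℝ E] {T : ℝ → E →L[ℝ] E}

/-- The operator `f ↦ ∫_0^∞ k(v) T_{1/(4v)} f dv` with kernel `k`. -/
def kernelOp (T : ℝ → E →L[ℝ] E) (k : ℝ → ℝ) (f : E) : E :=
  ∫ v in Ioi (0 : ℝ), k v • T (1 / (4 * v)) f

/-- The kernel `v^m e^{-τ v} / √v`. -/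
def laplaceKernel (m : ℕ) (τ v : ℝ) : ℝ := v ^ m * (Real.exp (-(τ * v)) / √v)

theorem integrableOn_laplaceKernel (m : ℕ) {τ : ℝ} (hτ : 0 < τ) :
    IntegrableOn (laplaceKernel m τ) (Ioi 0) :=
  integrableOn_pow_mul_exp_div_sqrt hτ m

theorem laplaceKernel_nonneg (m : ℕ) (τ : ℝ) {v : ℝ} (hv : 0 < v) : 0 ≤ laplaceKernel m τ v := by
  unfold laplaceKernel
  positivity

theorem measurable_laplaceKernel (m : ℕ) (τ : ℝ) : Measurable (laplaceKernel m τ) := by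
  unfold laplaceKernel
  fun_prop

/-- In the variable `t²` the subordinated semigroup is, up to a scalar factor, a Laplace
transform; its regularity in `t` comes from this. -/
theorem subordKernel_eq (t : ℝ) :
    subordKernel t = fun v => ((√Real.pi)⁻¹ * t) * laplaceKernel 0 (t ^ 2) v := by
  ext v
  simp only [subordKernel, laplaceKernel, pow_zero, one_mul]
  ring

/-- The time derivative `∂_t n_t(v)` of the subordination kernel. -/
def subordKernelDeriv (t v : ℝ) : ℝ :=
  (√Real.pi)⁻¹ * (laplaceKernel 0 (t ^ 2) v - 2 * t ^ 2 * laplaceKernel 1 (t ^ 2) v)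

/-- The second time derivative `∂_t² n_t(v)` of the subordination kernel. -/
def subordKernelDeriv2 (t v : ℝ) : ℝ :=
  (√Real.pi)⁻¹ * (4 * t ^ 3 * laplaceKernel 2 (t ^ 2) v - 6 * t * laplaceKernel 1 (t ^ 2) v)

theorem integrableOn_subordKernelDeriv {t : ℝ} (ht : 0 < t) :
    IntegrableOn (subordKernelDeriv t) (Ioi 0) :=
  ((integrableOn_laplaceKernel 0 (pow_pos ht 2)).sub
    ((integrableOn_laplaceKernel 1 (pow_pos ht 2)).const_mul _)).const_mul _

theorem integrableOn_subordKernelDeriv2 {t : ℝ} (ht : 0 < t) :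
    IntegrableOn (subordKernelDeriv2 t) (Ioi 0) :=
  (((integrableOn_laplaceKernel 2 (pow_pos ht 2)).const_mul _).sub
    ((integrableOn_laplaceKernel 1 (pow_pos ht 2)).const_mul _)).const_mul _

/-- The derivative `∂_t P_t f` of the subordinated semigroup. -/
def subordDeriv (T : ℝ → E →L[ℝ] E) (t : ℝ) (f : E) : E := kernelOp T (subordKernelDeriv t) f

/-- The second derivative `∂_t² P_t f` of the subordinated semigroup. -/
def subordDeriv2 (T : ℝ → E →L[ℝ] E) (t : ℝ) (f : E) : E := kernelOp T (subordKernelDeriv2 t) f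

theorem subordinate_eq_kernelOp {t : ℝ} (ht : 0 < t) (f : E) :
    subordinate T t f = kernelOp T (subordKernel t) f := by
  have h := integral_comp_mul_left_Ioi
    (fun u : ℝ => (Real.exp (-u) / √u) • T (t ^ 2 / (4 * u)) f) 0 (pow_pos ht 2)
  rw [mul_zero] at h
  rw [subordinate, kernelOp]
  have h2 : ∫ u in Ioi (0 : ℝ), (Real.exp (-u) / √u) • T (t ^ 2 / (4 * u)) f
      = t ^ 2 • ∫ v in Ioi (0 : ℝ), (Real.exp (-(t ^ 2 * v)) / √(t ^ 2 * v)) •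
        T (t ^ 2 / (4 * (t ^ 2 * v))) f := by
    rw [h, smul_smul, mul_inv_cancel₀ (pow_pos ht 2).ne', one_smul]
  rw [h2, smul_smul, ← integral_smul]
  refine setIntegral_congr_fun measurableSet_Ioi fun v hv => ?_
  have hv' : (0 : ℝ) < v := hv
  have h3 : t ^ 2 / (4 * (t ^ 2 * v)) = 1 / (4 * v) := by field_simp
  simp only [h3, smul_smul]
  congr 1
  rw [subordKernel, Real.sqrt_mul (by positivity), Real.sqrt_sq ht.le]
  field_simp

namespace IsContractionSemigroup

variable (hT : IsContractionSemigroup T)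
include hT

theorem norm_sub_le {s t : ℝ} (hs : 0 ≤ s) (hst : s ≤ t) (f : E) :
    ‖T t f - T s f‖ ≤ ‖T (t - s) f - f‖ := by
  have h : T t f = T s (T (t - s) f) := by
    rw [← hT.add s (t - s) hs (by linarith)]
    congr 2
    ring
  rw [h, ← map_sub]
  exact hT.norm_le s hs _

theorem continuousOn (f : E) : ContinuousOn (fun t => T t f) (Ioi 0) := by
  intro t ht
  refine ContinuousAt.continuousWithinAt ?_
  rw [Metric.continuousAt_iff]
  intro ε hε
  obtain ⟨δ, hδ, h⟩ := (Metric.tendsto_nhdsWithin_nhds.1 (hT.tendsto f)) ε hε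
  have ht' : (0 : ℝ) < t := ht
  refine ⟨min δ t, lt_min hδ ht', fun {s} hs => ?_⟩
  have hs1 : |s - t| < δ := lt_of_lt_of_le hs (min_le_left _ _)
  have hs2 : |s - t| < t := lt_of_lt_of_le hs (min_le_right _ _)
  rw [abs_lt] at hs1 hs2
  have key : ∀ a : ℝ, 0 < a → a < δ → ‖T a f - f‖ < ε := by
    intro a ha had
    have := h (x := a) ha (by rw [dist_zero_right, Real.norm_eq_abs, abs_of_pos ha]; exact had)
    rwa [dist_eq_norm] at this
  rcases lt_trichotomy s t with hlt | heq | hgt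
  · rw [dist_comm, dist_eq_norm]
    exact lt_of_le_of_lt (hT.norm_sub_le (by linarith) hlt.le f)
      (key _ (by linarith) (by linarith))
  · rw [heq, dist_self]; exact hε
  · rw [dist_eq_norm]
    exact lt_of_le_of_lt (hT.norm_sub_le ht'.le hgt.le f) (key _ (by linarith) (by linarith))

theorem aestronglyMeasurable_comp {c : ℝ} (hc : 0 < c) (f : E) :
    AEStronglyMeasurable (fun v => T (c / (4 * v)) f) (volume.restrict (Ioi 0)) := by
  refine ContinuousOn.aestronglyMeasurable ?_ measurableSet_Ioi
  refine (hT.continuousOn f).comp (ContinuousOn.div (by fun_prop) (by fun_prop) fun v hv => ?_)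
    fun v hv => ?_
  · have : (0 : ℝ) < v := hv
    positivity
  · have : (0 : ℝ) < v := hv
    exact mem_Ioi.2 (by positivity)

theorem integrable_smul {k : ℝ → ℝ} (hk : IntegrableOn k (Ioi 0)) (f : E) :
    IntegrableOn (fun v => k v • T (1 / (4 * v)) f) (Ioi 0) := by
  refine Integrable.mono' (hk.norm.mul_const ‖f‖)
    (hk.aestronglyMeasurable.smul (hT.aestronglyMeasurable_comp one_pos f)) ?_
  refine (ae_restrict_mem measurableSet_Ioi).mono fun v hv => ?_
  have hv' : (0 : ℝ) < v := hv
  rw [norm_smul]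
  exact mul_le_mul_of_nonneg_left (hT.norm_le _ (by positivity) f) (norm_nonneg _)

theorem norm_kernelOp_le {k : ℝ → ℝ} (hk : IntegrableOn k (Ioi 0)) (f : E) :
    ‖kernelOp T k f‖ ≤ (∫ v in Ioi (0 : ℝ), ‖k v‖) * ‖f‖ := by
  rw [kernelOp, ← integral_mul_const]
  refine norm_integral_le_of_norm_le (hk.norm.mul_const ‖f‖) ?_
  refine (ae_restrict_mem measurableSet_Ioi).mono fun v hv => ?_
  have hv' : (0 : ℝ) < v := hv
  rw [norm_smul]
  exact mul_le_mul_of_nonneg_left (hT.norm_le _ (by positivity) f) (norm_nonneg _)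

/-- `kernelOp` as a bounded operator. -/
def kernelCLM {k : ℝ → ℝ} (hk : IntegrableOn k (Ioi 0)) : E →L[ℝ] E :=
  LinearMap.mkContinuous
    { toFun := kernelOp T k
      map_add' := fun f g => by
        simp only [kernelOp, map_add, smul_add]
        exact integral_add (hT.integrable_smul hk f) (hT.integrable_smul hk g)
      map_smul' := fun c f => by
        simp only [kernelOp, map_smul, RingHom.id_apply]
        rw [← integral_smul]
        simp only [smul_comm c] } _ (hT.norm_kernelOp_le hk)

theorem kernelOp_sub {k l : ℝ → ℝ} (hk : IntegrableOn k (Ioi 0)) (hl : IntegrableOn l (Ioi 0))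
    (f : E) : kernelOp T (fun v => k v - l v) f = kernelOp T k f - kernelOp T l f := by
  simp only [kernelOp, sub_smul]
  exact integral_sub (hT.integrable_smul hk f) (hT.integrable_smul hl f)

omit hT in
theorem kernelOp_const_mul (c : ℝ) (k : ℝ → ℝ) (f : E) :
    kernelOp T (fun v => c * k v) f = c • kernelOp T k f := by
  simp only [kernelOp, mul_smul]
  exact integral_smul _ _

/-- The subordinated operator `P_t` as a bounded operator. -/
def subordCLM {t : ℝ} (ht : 0 < t) : E →L[ℝ] E := hT.kernelCLM (integrableOn_subordKernel ht)

theorem subordCLM_apply {t : ℝ} (ht : 0 < t) (f : E) : hT.subordCLM ht f = subordinate T t f :=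
  (subordinate_eq_kernelOp ht f).symm

/-- `∂_t P_t` as a bounded operator. -/
def derivCLM {t : ℝ} (ht : 0 < t) : E →L[ℝ] E := hT.kernelCLM (integrableOn_subordKernelDeriv ht)

theorem derivCLM_apply {t : ℝ} (ht : 0 < t) (f : E) : hT.derivCLM ht f = subordDeriv T t f := rfl

theorem norm_subordinate_le {t : ℝ} (ht : 0 < t) (f : E) : ‖subordinate T t f‖ ≤ ‖f‖ := by
  rw [subordinate_eq_kernelOp ht]
  refine (hT.norm_kernelOp_le (integrableOn_subordKernel ht) f).trans (le_of_eq ?_)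
  have : ∀ v, ‖subordKernel t v‖ = subordKernel t v := fun v =>
    Real.norm_of_nonneg (subordKernel_nonneg ht.le v)
  simp only [this]
  rw [integral_subordKernel ht, one_mul]

theorem tendsto_subordinate (f : E) [CompleteSpace E] :
    Tendsto (fun t => subordinate T t f) (𝓝[>] 0) (𝓝 f) := by
  have hw := integrableOn_exp_div_sqrt one_pos
  simp only [one_mul] at hw
  have hlim : (√Real.pi)⁻¹ • ∫ u in Ioi (0 : ℝ), (Real.exp (-u) / √u) • f = f := by
    have h := integral_subordKernel one_pos
    simp only [subordKernel, one_pow, one_mul, integral_const_mul] at h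
    rw [integral_smul_const, smul_smul, h, one_smul]
  have : Tendsto (fun t => subordinate T t f) (𝓝[>] 0)
      (𝓝 ((√Real.pi)⁻¹ • ∫ u in Ioi (0 : ℝ), (Real.exp (-u) / √u) • f)) := by
    refine Tendsto.const_smul ?_ _
    refine tendsto_integral_filter_of_dominated_convergence
      (fun u => ‖Real.exp (-u) / √u‖ * ‖f‖) ?_ ?_ (hw.norm.mul_const _) ?_
    · filter_upwards [self_mem_nhdsWithin] with t ht
      exact hw.aestronglyMeasurable.smul (hT.aestronglyMeasurable_comp (pow_pos ht 2) f)
    · filter_upwards [self_mem_nhdsWithin] with t ht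
      refine (ae_restrict_mem measurableSet_Ioi).mono fun u hu => ?_
      have hu' : (0 : ℝ) < u := hu
      rw [norm_smul]
      exact mul_le_mul_of_nonneg_left (hT.norm_le _ (by positivity) f) (norm_nonneg _)
    · refine (ae_restrict_mem measurableSet_Ioi).mono fun u hu => ?_
      have hu' : (0 : ℝ) < u := hu
      refine Tendsto.const_smul ((hT.tendsto f).comp ?_) _
      refine tendsto_nhdsWithin_iff.2 ⟨?_, ?_⟩
      · have : Tendsto (fun t : ℝ => t ^ 2 / (4 * u)) (𝓝 0) (𝓝 (0 ^ 2 / (4 * u))) :=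
          Continuous.tendsto (by fun_prop) 0
        simp only [ne_eq, OfNat.ofNat_ne_zero, not_false_eq_true, zero_pow, zero_div] at this
        exact this.mono_left nhdsWithin_le_nhds
      · filter_upwards [self_mem_nhdsWithin] with t ht
        have ht' : (0 : ℝ) < t := ht
        exact mem_Ioi.2 (by positivity)
  rwa [hlim] at this

/-- An operator that intertwines two semigroups intertwines the kernel operators. -/
theorem map_kernelOp {F : Type*} [NormedAddCommGroup F] [NormedSpace ℝ F] [CompleteSpace E]
    [CompleteSpace F] {T' : ℝ → F →L[ℝ] F} (L : E →L[ℝ] F)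
    (hL : ∀ t : ℝ, 0 ≤ t → ∀ f, L (T t f) = T' t (L f)) {k : ℝ → ℝ}
    (hk : IntegrableOn k (Ioi 0)) (f : E) : L (kernelOp T k f) = kernelOp T' k (L f) := by
  rw [kernelOp, ← ContinuousLinearMap.integral_comp_comm L (hT.integrable_smul hk f)]
  refine setIntegral_congr_fun measurableSet_Ioi fun v hv => ?_
  have hv' : (0 : ℝ) < v := hv
  simp only [map_smul]
  rw [hL _ (by positivity)]

theorem map_kernelOp_functional [CompleteSpace E] (L : E →L[ℝ] ℝ) {k : ℝ → ℝ}
    (hk : IntegrableOn k (Ioi 0)) (f : E) :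
    L (kernelOp T k f) = ∫ v in Ioi (0 : ℝ), k v * L (T (1 / (4 * v)) f) := by
  rw [kernelOp, ← ContinuousLinearMap.integral_comp_comm L (hT.integrable_smul hk f)]
  refine setIntegral_congr_fun measurableSet_Ioi fun v _ => ?_
  simp

theorem integrable_stableLaw {t : ℝ} (ht : 0 < t) (f : E) :
    Integrable (fun a => T a f) (stableLaw t) := by
  have := isProbabilityMeasure_stableLaw ht
  refine Integrable.of_bound (C := ‖f‖) ?_ ?_
  · have h := (hT.continuousOn f).aestronglyMeasurable (μ := stableLaw t) measurableSet_Ioi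
    have hr : (stableLaw t).restrict (Ioi 0) = stableLaw t :=
      Measure.restrict_eq_self_of_ae_mem (ae_stableLaw_pos t)
    rwa [hr] at h
  · filter_upwards [ae_stableLaw_pos t] with a ha using hT.norm_le a ha.le f

theorem subordinate_eq_integral_stableLaw {t : ℝ} (ht : 0 < t) (f : E) :
    subordinate T t f = ∫ a, T a f ∂(stableLaw t) := by
  rw [integral_stableLaw ht (hT.integrable_stableLaw ht f).1, subordinate_eq_kernelOp ht, kernelOp]

/-- `P_t f` is the mean of `T_a f` under the stable law of parameter `t`, so that the semigroup
law of `P` is that of `T` combined with `stableLaw_conv`. -/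
theorem subordinate_add [CompleteSpace E] {s t : ℝ} (hs : 0 < s) (ht : 0 < t) (f : E) :
    subordinate T (s + t) f = subordinate T s (subordinate T t f) := by
  have := isProbabilityMeasure_stableLaw hs
  have := isProbabilityMeasure_stableLaw ht
  rw [hT.subordinate_eq_integral_stableLaw (add_pos hs ht), ← stableLaw_conv hs ht,
    integral_conv (by rw [stableLaw_conv hs ht]; exact hT.integrable_stableLaw (add_pos hs ht) f),
    hT.subordinate_eq_integral_stableLaw hs]
  refine integral_congr_ae ?_
  filter_upwards [ae_stableLaw_pos s] with x hx
  rw [hT.subordinate_eq_integral_stableLaw ht,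
    ← ContinuousLinearMap.integral_comp_comm _ (hT.integrable_stableLaw ht f)]
  refine integral_congr_ae ?_
  filter_upwards [ae_stableLaw_pos t] with y hy
  exact hT.add x y hx.le hy.le f

theorem hasDerivAt_laplace (m : ℕ) {τ : ℝ} (hτ : 0 < τ) (f : E) :
    HasDerivAt (fun τ => kernelOp T (laplaceKernel m τ) f)
      (-kernelOp T (laplaceKernel (m + 1) τ) f) τ := by
  have hd := hasDerivAt_integral_of_dominated_loc_of_deriv_le (μ := volume.restrict (Ioi 0))
    (F := fun τ v => laplaceKernel m τ v • T (1 / (4 * v)) f)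
    (F' := fun τ v => (-laplaceKernel (m + 1) τ v) • T (1 / (4 * v)) f)
    (bound := fun v => laplaceKernel (m + 1) (τ / 2) v * ‖f‖) (x₀ := τ)
    (Ioi_mem_nhds (half_lt_self hτ)) ?_
    (hT.integrable_smul (integrableOn_laplaceKernel m hτ) f)
    (hT.integrable_smul (integrableOn_laplaceKernel (m + 1) hτ).neg f).1 ?_
    ((integrableOn_laplaceKernel (m + 1) (half_pos hτ)).mul_const _) ?_
  · have := hd.2
    simp only [neg_smul, integral_neg] at this
    exact this
  · refine Eventually.of_forall fun τ' => ?_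
    exact (measurable_laplaceKernel m τ').aestronglyMeasurable.smul
      (hT.aestronglyMeasurable_comp one_pos f)
  · refine (ae_restrict_mem measurableSet_Ioi).mono fun v hv τ' hτ' => ?_
    have hv' : (0 : ℝ) < v := hv
    have hτ'' : τ / 2 < τ' := hτ'
    rw [norm_smul, norm_neg, Real.norm_of_nonneg (laplaceKernel_nonneg _ _ hv')]
    refine mul_le_mul ?_ (hT.norm_le _ (by positivity) f) (norm_nonneg _)
      (laplaceKernel_nonneg _ _ hv')
    unfold laplaceKernel
    gcongr
  · refine (ae_restrict_mem measurableSet_Ioi).mono fun v hv τ' _ => ?_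
    refine HasDerivAt.smul_const ?_ _
    have h1 : HasDerivAt (fun τ : ℝ => -(τ * v)) (-v) τ' := by
      convert! ((hasDerivAt_id τ').mul_const v).neg using 1
      simp
    have h2 := ((h1.exp.div_const (√v)).const_mul (v ^ m))
    convert! h2 using 1
    unfold laplaceKernel
    ring

omit hT in
theorem subordinate_eq_laplace {t : ℝ} (ht : 0 < t) (f : E) :
    subordinate T t f = ((√Real.pi)⁻¹ * t) • kernelOp T (laplaceKernel 0 (t ^ 2)) f := by
  rw [subordinate_eq_kernelOp ht, subordKernel_eq, kernelOp_const_mul]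

theorem subordDeriv_eq_laplace {t : ℝ} (ht : 0 < t) (f : E) :
    subordDeriv T t f = (√Real.pi)⁻¹ • (kernelOp T (laplaceKernel 0 (t ^ 2)) f
      - (2 * t ^ 2) • kernelOp T (laplaceKernel 1 (t ^ 2)) f) := by
  unfold subordDeriv subordKernelDeriv
  rw [kernelOp_const_mul, hT.kernelOp_sub (integrableOn_laplaceKernel 0 (pow_pos ht 2))
    ((integrableOn_laplaceKernel 1 (pow_pos ht 2)).const_mul _), kernelOp_const_mul]

theorem subordDeriv2_eq_laplace {t : ℝ} (ht : 0 < t) (f : E) :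
    subordDeriv2 T t f = (√Real.pi)⁻¹ • ((4 * t ^ 3) • kernelOp T (laplaceKernel 2 (t ^ 2)) f
      - (6 * t) • kernelOp T (laplaceKernel 1 (t ^ 2)) f) := by
  unfold subordDeriv2 subordKernelDeriv2
  rw [kernelOp_const_mul, hT.kernelOp_sub
    ((integrableOn_laplaceKernel 2 (pow_pos ht 2)).const_mul _)
    ((integrableOn_laplaceKernel 1 (pow_pos ht 2)).const_mul _), kernelOp_const_mul,
    kernelOp_const_mul]

theorem hasDerivAt_laplace_sq (m : ℕ) {t : ℝ} (ht : 0 < t) (f : E) :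
    HasDerivAt (fun t => kernelOp T (laplaceKernel m (t ^ 2)) f)
      (-(2 * t) • kernelOp T (laplaceKernel (m + 1) (t ^ 2)) f) t := by
  have h1 : HasDerivAt (fun t : ℝ => t ^ 2) (2 * t) t := by simpa using hasDerivAt_pow 2 t
  have := HasDerivAt.scomp (h := fun t : ℝ => t ^ 2)
    (g₁ := fun τ => kernelOp T (laplaceKernel m τ) f) t
    (hT.hasDerivAt_laplace m (pow_pos ht 2) f) h1
  convert! this using 1
  rw [neg_smul, smul_neg]

theorem hasDerivAt_subordinate {t : ℝ} (ht : 0 < t) (f : E) :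
    HasDerivAt (fun t => subordinate T t f) (subordDeriv T t f) t := by
  have h1 : HasDerivAt (fun t : ℝ => (√Real.pi)⁻¹ * t) (√Real.pi)⁻¹ t := by
    simpa using (hasDerivAt_id t).const_mul (√Real.pi)⁻¹
  have h := h1.smul (hT.hasDerivAt_laplace_sq 0 ht f)
  have h2 : HasDerivAt (fun t => subordinate T t f) _ t :=
    h.congr_of_eventuallyEq (eventually_of_mem (Ioi_mem_nhds ht) fun s hs => subordinate_eq_laplace hs f)
  convert h2 using 1
  rw [hT.subordDeriv_eq_laplace ht]
  simp only [zero_add]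
  module

theorem hasDerivAt_subordDeriv {t : ℝ} (ht : 0 < t) (f : E) :
    HasDerivAt (fun t => subordDeriv T t f) (subordDeriv2 T t f) t := by
  have h1 : HasDerivAt (fun t : ℝ => 2 * t ^ 2) (4 * t) t := by
    have := (hasDerivAt_pow 2 t).const_mul (2 : ℝ)
    convert! this using 1
    norm_num
    ring
  have h := ((hT.hasDerivAt_laplace_sq 0 ht f).sub
    (h1.smul (hT.hasDerivAt_laplace_sq 1 ht f))).const_smul (√Real.pi)⁻¹
  have h2 : HasDerivAt (fun t => subordDeriv T t f) _ t :=
    h.congr_of_eventuallyEq (eventually_of_mem (Ioi_mem_nhds ht) fun s hs => hT.subordDeriv_eq_laplace hs f)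
  convert h2 using 1
  rw [hT.subordDeriv2_eq_laplace ht]
  simp only [zero_add, one_add_one_eq_two]
  module

theorem continuousOn_subordDeriv2 (f : E) : ContinuousOn (fun t => subordDeriv2 T t f) (Ioi 0) := by
  have hc : ∀ m, ContinuousOn (fun t => kernelOp T (laplaceKernel m (t ^ 2)) f) (Ioi 0) :=
    fun m t ht => (hT.hasDerivAt_laplace_sq m ht f).continuousAt.continuousWithinAt
  have : ContinuousOn (fun t => (√Real.pi)⁻¹ • ((4 * t ^ 3) • kernelOp T (laplaceKernel 2 (t ^ 2)) f
      - (6 * t) • kernelOp T (laplaceKernel 1 (t ^ 2)) f)) (Ioi 0) :=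
    continuousOn_const.smul (((by fun_prop : Continuous fun t : ℝ => 4 * t ^ 3).continuousOn.smul
      (hc 2)).sub ((by fun_prop : Continuous fun t : ℝ => 6 * t).continuousOn.smul (hc 1)))
  exact this.congr fun t ht => hT.subordDeriv2_eq_laplace ht f

theorem subordDeriv_add [CompleteSpace E] {s t : ℝ} (hs : 0 < s) (ht : 0 < t) (f : E) :
    subordDeriv T (s + t) f = subordinate T s (subordDeriv T t f) := by
  have h1 : HasDerivAt (fun t => subordinate T (s + t) f) (subordDeriv T (s + t) f) t :=
    (hT.hasDerivAt_subordinate (add_pos hs ht) f).comp_const_add s t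
  have h2 : HasDerivAt (fun t => hT.subordCLM hs (subordinate T t f))
      (hT.subordCLM hs (subordDeriv T t f)) t :=
    (hT.subordCLM hs).hasFDerivAt.comp_hasDerivAt t (hT.hasDerivAt_subordinate ht f)
  rw [← hT.subordCLM_apply hs]
  refine h1.unique (h2.congr_of_eventuallyEq (eventually_of_mem (Ioi_mem_nhds ht) fun r hr => ?_))
  simp only
  rw [hT.subordCLM_apply hs, hT.subordinate_add hs hr]

theorem subordDeriv2_add [CompleteSpace E] {s t : ℝ} (hs : 0 < s) (ht : 0 < t) (f : E) :
    subordDeriv2 T (s + t) f = subordDeriv T s (subordDeriv T t f) := by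
  have h1 : HasDerivAt (fun s => subordDeriv T (s + t) f) (subordDeriv2 T (s + t) f) s :=
    (hT.hasDerivAt_subordDeriv (add_pos hs ht) f).comp_add_const s t
  refine h1.unique ((hT.hasDerivAt_subordinate hs (subordDeriv T t f)).congr_of_eventuallyEq
    (eventually_of_mem (Ioi_mem_nhds hs) fun r hr => ?_))
  exact hT.subordDeriv_add hr ht f

/-- Since `v^n / n! ≤ e^{ρ' v} / ρ'^n`, the coefficients of the Taylor series at `τ₀` of
`τ ↦ ∫ e^{-τ v} v^{-1/2} T_{1/(4v)} f dv` decay geometrically. -/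
theorem summable_norm_taylor {τ₀ ρ : ℝ} (hρ : 0 ≤ ρ) (hρτ : ρ < τ₀) (f : E) :
    Summable fun n : ℕ => ∫ v in Ioi (0 : ℝ),
      ‖(ρ ^ n / n.factorial * laplaceKernel n τ₀ v) • T (1 / (4 * v)) f‖ := by
  set ρ' := (ρ + τ₀) / 2
  have h1 : ρ < ρ' := by simp only [ρ']; linarith
  have h2 : ρ' < τ₀ := by simp only [ρ']; linarith
  have h0 : 0 < ρ' := lt_of_le_of_lt hρ h1
  have hI := integrableOn_laplaceKernel 0 (sub_pos.2 h2)
  refine Summable.of_nonneg_of_le (fun n => integral_nonneg fun v => norm_nonneg _) (fun n => ?_)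
    ((summable_geometric_of_lt_one (div_nonneg hρ h0.le) ((div_lt_one h0).2 h1)).mul_right
      ((∫ v in Ioi (0 : ℝ), laplaceKernel 0 (τ₀ - ρ') v) * ‖f‖))
  have hint := hT.integrable_smul
    ((integrableOn_laplaceKernel n (h0.trans h2)).const_mul (ρ ^ n / n.factorial)) f
  rw [← integral_mul_const, ← integral_const_mul]
  refine setIntegral_mono_on hint.norm ((hI.mul_const _).const_mul _) measurableSet_Ioi
    fun v hv => ?_
  have hv' : (0 : ℝ) < v := hv
  rw [norm_smul, Real.norm_of_nonneg
    (mul_nonneg (by positivity) (laplaceKernel_nonneg _ _ hv')), ← mul_assoc]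
  refine mul_le_mul ?_ (hT.norm_le _ (by positivity) f) (norm_nonneg _)
    (mul_nonneg (by positivity) (laplaceKernel_nonneg _ _ hv'))
  have h3 : (ρ' * v) ^ n / n.factorial ≤ Real.exp (ρ' * v) :=
    Real.pow_div_factorial_le_exp _ (by positivity) n
  have h4 : Real.exp (-((τ₀ - ρ') * v)) = Real.exp (ρ' * v) * Real.exp (-(τ₀ * v)) := by
    rw [← Real.exp_add]; congr 1; ring
  unfold laplaceKernel
  rw [h4]
  calc ρ ^ n / n.factorial * (v ^ n * (Real.exp (-(τ₀ * v)) / √v))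
      = (ρ / ρ') ^ n * ((ρ' * v) ^ n / n.factorial) * (Real.exp (-(τ₀ * v)) / √v) := by
        rw [div_pow, mul_pow]; field_simp
    _ ≤ (ρ / ρ') ^ n * Real.exp (ρ' * v) * (Real.exp (-(τ₀ * v)) / √v) := by gcongr
    _ = _ := by ring

theorem summable_taylor {τ₀ ρ : ℝ} (hρ : 0 ≤ ρ) (hρτ : ρ < τ₀) (f : E) :
    Summable fun n : ℕ => ρ ^ n / n.factorial * ‖kernelOp T (laplaceKernel n τ₀) f‖ := by
  refine Summable.of_nonneg_of_le (fun n => by positivity) (fun n => ?_)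
    (hT.summable_norm_taylor hρ hρτ f)
  have h : ‖(ρ ^ n / n.factorial : ℝ)‖ = ρ ^ n / n.factorial := Real.norm_of_nonneg (by positivity)
  rw [← h, ← norm_smul, ← kernelOp_const_mul, h]
  exact norm_integral_le_integral_norm _

/-- The Taylor series at `τ₀` of the Laplace transform `τ ↦ ∫ e^{-τ v} v^{-1/2} T_{1/(4v)} f dv`
converges as soon as `|τ₀ - τ| < τ₀`. -/
theorem hasSum_taylor {τ₀ τ : ℝ} (hτ : |τ₀ - τ| < τ₀) (f : E) :
    HasSum (fun n : ℕ => ((τ₀ - τ) ^ n / n.factorial : ℝ) • kernelOp T (laplaceKernel n τ₀) f)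
      (kernelOp T (laplaceKernel 0 τ) f) := by
  have hτ₀ : 0 < τ₀ := lt_of_le_of_lt (abs_nonneg _) hτ
  have h := hasSum_integral_of_summable_integral_norm (μ := volume.restrict (Ioi (0 : ℝ)))
    (F := fun (n : ℕ) v => ((τ₀ - τ) ^ n / n.factorial * laplaceKernel n τ₀ v) • T (1 / (4 * v)) f)
    (fun n => hT.integrable_smul ((integrableOn_laplaceKernel n hτ₀).const_mul _) f) ?_
  · convert h using 1
    · ext n
      rw [← kernelOp_const_mul, kernelOp]
    · refine setIntegral_congr_fun measurableSet_Ioi fun v hv => ?_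
      have h1 : HasSum (fun n : ℕ => (τ₀ - τ) ^ n / n.factorial * laplaceKernel n τ₀ v)
          (laplaceKernel 0 τ v) := by
        have he := NormedSpace.expSeries_div_hasSum_exp ((τ₀ - τ) * v)
        rw [← Real.exp_eq_exp_ℝ] at he
        have he2 := he.mul_right (Real.exp (-(τ₀ * v)) / √v)
        convert! he2 using 1
        · ext n
          rw [laplaceKernel, mul_pow]
          ring
        · rw [laplaceKernel, pow_zero, one_mul, ← mul_div_assoc, ← Real.exp_add]
          congr 2
          ring
      exact (h1.smul_const (T (1 / (4 * v)) f)).tsum_eq.symm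
  · refine (hT.summable_norm_taylor (abs_nonneg _) hτ f).congr fun n => ?_
    refine integral_congr_ae (Eventually.of_forall fun v => ?_)
    simp [norm_smul]

end IsContractionSemigroup

end AbstractSemigroup

/-! ### The semigroup on the Bochner spaces -/

section LpPreliminaries

variable {Ω : Type*} [MeasurableSpace Ω] {μ : Measure Ω} {p : ℝ≥0∞}

instance instIsOrderedModuleLp : IsOrderedModule ℝ (Lp ℝ p μ) :=
  IsOrderedModule.of_smul_nonneg fun c hc f hf => by
    rw [← Lp.coeFn_nonneg] at hf ⊢
    filter_upwards [hf, Lp.coeFn_smul c f] with x h1 h2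
    rw [h2]
    exact mul_nonneg hc h1

theorem lintegral_enorm_rpow_eq {E : Type*} [NormedAddCommGroup E] {f : Ω → E} (h0 : p ≠ 0)
    (hp : p ≠ ∞) : ∫⁻ x, ‖f x‖ₑ ^ p.toReal ∂μ = eLpNorm f p μ ^ p.toReal := by
  rw [eLpNorm_eq_lintegral_rpow_enorm_toReal h0 hp, ← ENNReal.rpow_mul, one_div,
    inv_mul_cancel₀ (ENNReal.toReal_pos h0 hp).ne', ENNReal.rpow_one]

/-- Convergence to zero in `L^2` together with boundedness in all `L^r`, `1 < r < ∞`, implies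
convergence to zero in all `L^p`, `1 < p < ∞`, by Lyapunov's inequality. -/
theorem tendsto_eLpNorm_zero_of_tendsto_two {ι : Type*} {l : Filter ι} {h : ι → Ω → ℝ}
    (hm : ∀ i, AEStronglyMeasurable (h i) μ) (h1p : 1 < p) (hp : p ≠ ∞)
    (hb : ∀ r : ℝ≥0∞, 1 < r → r ≠ ∞ → ∃ K : ℝ≥0∞, K ≠ ∞ ∧ ∀ᶠ i in l, eLpNorm (h i) r μ ≤ K)
    (h2 : Tendsto (fun i => eLpNorm (h i) 2 μ) l (𝓝 0)) :
    Tendsto (fun i => eLpNorm (h i) p μ) l (𝓝 0) := by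
  have hp0 : p ≠ 0 := (zero_lt_one.trans h1p).ne'
  set P := p.toReal with hP
  have hP1 : 1 < P := by
    rw [hP, ← ENNReal.toReal_one]
    exact (ENNReal.toReal_lt_toReal ENNReal.one_ne_top hp).2 h1p
  -- `P` is a convex combination of `2` and an exponent `R` on the other side of it, still above `1`
  obtain ⟨R, θ, hR, hθ0, hθ1, hPR⟩ : ∃ R θ : ℝ, 1 < R ∧ 0 < θ ∧ θ ≤ 1 ∧ (1 - θ) * R + θ * 2 = P := by
    rcases lt_or_ge P 2 with h | h
    · refine ⟨(1 + P) / 2, (P - 1) / (3 - P), by linarith, div_pos (by linarith) (by linarith),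
        (div_le_one (by linarith)).2 (by linarith), ?_⟩
      have : 3 - P ≠ 0 := by linarith
      field_simp
      ring
    · refine ⟨P + 1, 1 / (P - 1), by linarith, div_pos one_pos (by linarith),
        (div_le_one (by linarith)).2 (by linarith), ?_⟩
      have : P - 1 ≠ 0 := by linarith
      field_simp
      ring
  obtain ⟨K, hK, hKb⟩ := hb (ENNReal.ofReal R) (by simpa using hR) ENNReal.ofReal_ne_top
  have hR0 : 0 < R := by linarith
  have hRr : (ENNReal.ofReal R).toReal = R := ENNReal.toReal_ofReal hR0.le
  have key : ∀ᶠ i in l, eLpNorm (h i) p μ ≤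
      ((K ^ R) ^ (1 - θ) * (eLpNorm (h i) 2 μ ^ (2 : ℝ)) ^ θ) ^ (1 / P) := by
    filter_upwards [hKb] with i hi
    have e1 : ∫⁻ x, ‖h i x‖ₑ ^ ((1 - θ) * R + θ * 2) ∂μ
        ≤ (∫⁻ x, ‖h i x‖ₑ ^ R ∂μ) ^ (1 - θ) * (∫⁻ x, ‖h i x‖ₑ ^ (2 : ℝ) ∂μ) ^ θ := by
      refine le_trans (le_of_eq (lintegral_congr fun x => ?_)) (ENNReal.lintegral_mul_norm_pow_le
        ((hm i).enorm.pow_const R) ((hm i).enorm.pow_const 2) (by linarith : 0 ≤ 1 - θ) hθ0.le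
        (by ring))
      rw [ENNReal.rpow_add_of_nonneg _ _ (mul_nonneg (by linarith) hR0.le) (by linarith),
        ← ENNReal.rpow_mul, ← ENNReal.rpow_mul, mul_comm R, mul_comm 2]
    rw [one_div, ENNReal.le_rpow_inv_iff (by linarith), ← lintegral_enorm_rpow_eq hp0 hp, ← hP, ← hPR]
    refine e1.trans ?_
    gcongr
    · have := lintegral_enorm_rpow_eq (μ := μ) (f := h i) (p := ENNReal.ofReal R)
        (by simpa using hR0) ENNReal.ofReal_ne_top
      rw [hRr] at this
      rw [this]
      gcongr
    · have := lintegral_enorm_rpow_eq (μ := μ) (f := h i) (p := 2) (by simp) (by simp)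
      simp only [ENNReal.toReal_ofNat] at this
      rw [this]
  refine tendsto_of_tendsto_of_tendsto_of_le_of_le' tendsto_const_nhds ?_
    (Eventually.of_forall fun _ => zero_le) key
  have hc : Tendsto (fun y : ℝ≥0∞ => ((K ^ R) ^ (1 - θ) * (y ^ (2 : ℝ)) ^ θ) ^ (1 / P)) (𝓝 0)
      (𝓝 (((K ^ R) ^ (1 - θ) * ((0 : ℝ≥0∞) ^ (2 : ℝ)) ^ θ) ^ (1 / P))) := by
    refine ((ENNReal.continuous_rpow_const).tendsto _).comp ?_
    refine ENNReal.Tendsto.const_mul ?_ (Or.inr ?_)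
    · exact ((ENNReal.continuous_rpow_const.comp ENNReal.continuous_rpow_const).tendsto _)
    · exact ENNReal.rpow_ne_top_of_nonneg (by linarith) (ENNReal.rpow_ne_top_of_nonneg hR0.le hK)
  have h0 : ((K ^ R) ^ (1 - θ) * ((0 : ℝ≥0∞) ^ (2 : ℝ)) ^ θ) ^ (1 / P) = 0 := by
    rw [ENNReal.zero_rpow_of_pos two_pos, ENNReal.zero_rpow_of_pos hθ0, mul_zero,
      ENNReal.zero_rpow_of_pos (by positivity)]
  rw [h0] at hc
  exact hc.comp h2

variable [Fact (1 ≤ p)]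

theorem isClosed_setOf_ae_le (c : ℝ) : IsClosed {g : Lp ℝ p μ | ∀ᵐ x ∂μ, g x ≤ c} := by
  refine isClosed_of_closure_subset fun g hg => ?_
  obtain ⟨u, hu, hug⟩ := mem_closure_iff_seq_limit.1 hg
  obtain ⟨ns, _, hns⟩ := (tendstoInMeasure_of_tendsto_Lp hug).exists_seq_tendsto_ae
  have hall : ∀ᵐ x ∂μ, ∀ n, u n x ≤ c := ae_all_iff.2 hu
  filter_upwards [hns, hall] with x h1 h2
  exact le_of_tendsto' h1 fun n => h2 _

theorem isClosed_setOf_ae_eq {r : ℝ≥0∞} [Fact (1 ≤ r)] {E : Type*} [NormedAddCommGroup E] :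
    IsClosed {g : Lp E p μ × Lp E r μ | (g.1 : Ω → E) =ᵐ[μ] g.2} := by
  refine isClosed_of_closure_subset fun g hg => ?_
  obtain ⟨u, hu, hug⟩ := mem_closure_iff_seq_limit.1 hg
  have h1 : Tendsto (fun n => (u n).1) atTop (𝓝 g.1) := (continuous_fst.tendsto _).comp hug
  have h2 : Tendsto (fun n => (u n).2) atTop (𝓝 g.2) := (continuous_snd.tendsto _).comp hug
  obtain ⟨ns, hns, hn⟩ := (tendstoInMeasure_of_tendsto_Lp h1).exists_seq_tendsto_ae
  obtain ⟨ms, hms, hm⟩ := (tendstoInMeasure_of_tendsto_Lp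
    (h2.comp hns.tendsto_atTop)).exists_seq_tendsto_ae
  have hall : ∀ᵐ x ∂μ, ∀ n, (u n).1 x = (u n).2 x := ae_all_iff.2 hu
  filter_upwards [hn, hm, hall] with x h1 h2 h3
  refine tendsto_nhds_unique (h1.comp hms.tendsto_atTop) (h2.congr fun n => ?_)
  simp [h3]

/-- For a family of operators of norm at most one, the set of convergence to a given bounded
operator is closed. -/
theorem isClosed_setOf_tendsto {E F ι : Type*} [NormedAddCommGroup E] [NormedSpace ℝ E]
    [NormedAddCommGroup F] [NormedSpace ℝ F] {l : Filter ι} {A : ι → E →L[ℝ] F} {L : E →L[ℝ] F}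
    (hA : ∀ᶠ i in l, ∀ f, ‖A i f‖ ≤ ‖f‖) : IsClosed {f | Tendsto (fun i => A i f) l (𝓝 (L f))} := by
  refine isClosed_of_closure_subset fun f hf => ?_
  refine Metric.tendsto_nhds.2 fun ε hε => ?_
  have hK : 0 < 1 + ‖L‖ := by positivity
  obtain ⟨g, hg, hfg⟩ := Metric.mem_closure_iff.1 hf (ε / (2 * (1 + ‖L‖))) (by positivity)
  filter_upwards [Metric.tendsto_nhds.1 hg (ε / 2) (by positivity), hA] with i h1 h2
  rw [dist_eq_norm] at *
  have e : A i f - L f = A i (f - g) + (A i g - L g) - L (f - g) := by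
    simp only [map_sub]; abel
  rw [e]
  have h3 := h2 (f - g)
  have h4 := L.le_opNorm (f - g)
  have h5 : (1 + ‖L‖) * ‖f - g‖ < ε / 2 := by
    rw [lt_div_iff₀ (by positivity)] at hfg
    linarith
  have h6 := norm_sub_le (A i (f - g) + (A i g - L g)) (L (f - g))
  have h7 := norm_add_le (A i (f - g)) (A i g - L g)
  linarith

end LpPreliminaries

namespace SymmetricDiffusionSemigroup

variable {Ω : Type*} [MeasurableSpace Ω] {μ : Measure Ω} (S : SymmetricDiffusionSemigroup μ)
  {p : ℝ≥0∞} [Fact (1 ≤ p)]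

/-- Strong continuity at zero in `L^p`, on indicator functions: these lie in all `L^r`, so that the
continuity in `L^2` can be interpolated. -/
theorem tendsto_T_indicator (h1p : 1 < p) (hp : p ≠ ∞) {s : Set Ω} (hs : MeasurableSet s)
    (hμs : μ s ≠ ∞) : Tendsto (fun t : ℝ => S.T t p (indicatorConstLp p hs hμs (1 : ℝ))) (𝓝[>] 0)
      (𝓝 (indicatorConstLp p hs hμs (1 : ℝ))) := by
  rw [Lp.tendsto_Lp_iff_tendsto_eLpNorm']
  have hind : ∀ (r : ℝ≥0∞), (indicatorConstLp p hs hμs (1 : ℝ) : Ω → ℝ)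
      =ᵐ[μ] indicatorConstLp r hs hμs (1 : ℝ) := fun r =>
    indicatorConstLp_coeFn.trans indicatorConstLp_coeFn.symm
  have hcons : ∀ (r : ℝ≥0∞) [Fact (1 ≤ r)] (t : ℝ), 0 ≤ t →
      eLpNorm (⇑(S.T t p (indicatorConstLp p hs hμs (1 : ℝ)))
        - ⇑(indicatorConstLp p hs hμs (1 : ℝ))) r μ
      = ‖S.T t r (indicatorConstLp r hs hμs (1 : ℝ)) - indicatorConstLp r hs hμs (1 : ℝ)‖ₑ := by
    intro r _ t ht
    rw [Lp.enorm_def]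
    refine eLpNorm_congr_ae ?_
    filter_upwards [S.consistent t ht p r _ _ (hind r), hind r,
      Lp.coeFn_sub (S.T t r (indicatorConstLp r hs hμs (1 : ℝ))) (indicatorConstLp r hs hμs (1 : ℝ))]
      with x h1 h2 h3
    rw [h3, Pi.sub_apply, Pi.sub_apply, h1, h2]
  refine tendsto_eLpNorm_zero_of_tendsto_two
    (fun t => (Lp.aestronglyMeasurable _).sub (Lp.aestronglyMeasurable _)) h1p hp ?_ ?_
  · intro r h1r hr
    have : Fact (1 ≤ r) := ⟨h1r.le⟩
    refine ⟨ENNReal.ofReal (2 * ‖indicatorConstLp r hs hμs (1 : ℝ)‖), ENNReal.ofReal_ne_top, ?_⟩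
    filter_upwards [self_mem_nhdsWithin] with t ht
    have ht' : (0 : ℝ) < t := ht
    rw [hcons r t ht'.le, ← ofReal_norm]
    refine ENNReal.ofReal_le_ofReal ((_root_.norm_sub_le _ _).trans ?_)
    have := S.norm_apply_le r ht'.le (indicatorConstLp r hs hμs (1 : ℝ))
    linarith
  · have h2 := S.continuous_zero (indicatorConstLp 2 hs hμs (1 : ℝ))
    rw [tendsto_iff_norm_sub_tendsto_zero] at h2
    have h3 := ENNReal.tendsto_ofReal h2
    rw [ENNReal.ofReal_zero] at h3
    refine h3.congr' ?_
    filter_upwards [self_mem_nhdsWithin] with t ht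
    have ht' : (0 : ℝ) < t := ht
    rw [hcons 2 t ht'.le, ← ofReal_norm]

section Bochner

variable {B : Type*} [NormedAddCommGroup B] [NormedSpace ℝ B] [CompleteSpace B]

theorem bochnerT_elemTensor (hp : p ≠ ∞) {t : ℝ} (ht : 0 ≤ t) (φ : Lp ℝ p μ) (b : B) :
    S.bochnerT t (elemTensor φ b) = elemTensor (S.T t p φ) b :=
  tensorExtension_elemTensor hp (S.positive t ht p) φ b

theorem bochnerT_real (hp : p ≠ ∞) (t : ℝ) :
    (S.bochnerT t : Lp ℝ p μ →L[ℝ] Lp ℝ p μ) = S.T t p :=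
  tensorExtension_real hp _

/-- The extensions to `L^p_B(Ω)`, `1 < p < ∞`, form a strongly continuous contraction semigroup.
Contractivity is due to positivity; the other properties need only be checked on `1_s ⊗ b`. -/
theorem isContractionSemigroup_bochnerT (h1p : 1 < p) (hp : p ≠ ∞) :
    IsContractionSemigroup (fun t => (S.bochnerT t : Lp B p μ →L[ℝ] Lp B p μ)) := by
  have hnorm : ∀ t : ℝ, 0 ≤ t → ∀ f : Lp B p μ, ‖S.bochnerT t f‖ ≤ ‖f‖ := fun t ht f => by
    refine (ContinuousLinearMap.le_of_opNorm_le _ ((norm_tensorExtension_le hp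
      (S.positive t ht p)).trans (S.contractive t ht p)) f).trans ?_
    rw [one_mul]
  refine ⟨hnorm, fun s t hs ht f => ?_, fun f => ?_⟩
  · have : (S.bochnerT (s + t) : Lp B p μ →L[ℝ] Lp B p μ)
        = (S.bochnerT s).comp (S.bochnerT t) := by
      refine clm_ext_indicator hp fun A hA hμA b => ?_
      rw [ContinuousLinearMap.comp_apply, S.bochnerT_elemTensor hp (add_nonneg hs ht),
        S.bochnerT_elemTensor hp ht, S.bochnerT_elemTensor hp hs, S.T_add s t hs ht]
      rfl
    exact congrArg (fun L => L f) this
  · refine Lp_induction_indicator hp (fun f => Tendsto (fun t => S.bochnerT t f) (𝓝[>] 0) (𝓝 f))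
      (fun A hA hμA b => ?_) (fun f g hf hg => ?_) ?_ f
    · refine Tendsto.congr' ?_ (((continuous_elemTensor b).tendsto _).comp
        (S.tendsto_T_indicator h1p hp hA hμA))
      filter_upwards [self_mem_nhdsWithin] with t ht
      exact (S.bochnerT_elemTensor hp (le_of_lt ht) _ b).symm
    · simpa only [map_add] using hf.add hg
    · refine isClosed_setOf_tendsto (L := ContinuousLinearMap.id ℝ (Lp B p μ)) ?_
      filter_upwards [self_mem_nhdsWithin] with t ht using hnorm t (le_of_lt ht)

theorem isContractionSemigroup_T (h1p : 1 < p) (hp : p ≠ ∞) :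
    IsContractionSemigroup (fun t => S.T t p) := by
  have := S.isContractionSemigroup_bochnerT (B := ℝ) h1p hp
  simpa only [S.bochnerT_real hp] using this

theorem T_mono {t : ℝ} (ht : 0 ≤ t) {f g : Lp ℝ p μ} (h : f ≤ g) : S.T t p f ≤ S.T t p g :=
  positive_mono (S.positive t ht p) h

theorem kernelOp_mono_kernel (h1p : 1 < p) (hp : p ≠ ∞) {k k' : ℝ → ℝ}
    (hk : IntegrableOn k (Set.Ioi 0)) (hk' : IntegrableOn k' (Set.Ioi 0))
    (hkk' : ∀ v : ℝ, 0 < v → k v ≤ k' v) {f : Lp ℝ p μ} (hf : 0 ≤ f) :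
    kernelOp (fun t => S.T t p) k f ≤ kernelOp (fun t => S.T t p) k' f := by
  have hT := S.isContractionSemigroup_T h1p hp
  refine integral_mono_ae (hT.integrable_smul hk f) (hT.integrable_smul hk' f) ?_
  refine (ae_restrict_mem measurableSet_Ioi).mono fun v hv => ?_
  have hv' : (0 : ℝ) < v := hv
  exact smul_le_smul_of_nonneg_right (hkk' v hv') (S.positive _ (by positivity) p f hf)

theorem kernelOp_mono (h1p : 1 < p) (hp : p ≠ ∞) {k : ℝ → ℝ}
    (hk : IntegrableOn k (Set.Ioi 0)) (hk0 : ∀ v : ℝ, 0 < v → 0 ≤ k v) {f g : Lp ℝ p μ}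
    (hfg : f ≤ g) : kernelOp (fun t => S.T t p) k f ≤ kernelOp (fun t => S.T t p) k g := by
  have hT := S.isContractionSemigroup_T h1p hp
  refine integral_mono_ae (hT.integrable_smul hk f) (hT.integrable_smul hk g) ?_
  refine (ae_restrict_mem measurableSet_Ioi).mono fun v hv => ?_
  have hv' : (0 : ℝ) < v := hv
  exact smul_le_smul_of_nonneg_left (S.T_mono (by positivity) hfg) (hk0 v hv')

/-- A kernel operator on `L^p_B(Ω)` is dominated pointwise by the scalar operator with any
larger kernel, applied to the pointwise norm. -/
theorem normLp_kernelOp_le (h1p : 1 < p) (hp : p ≠ ∞) {k k' : ℝ → ℝ}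
    (hk : IntegrableOn k (Set.Ioi 0)) (hk' : IntegrableOn k' (Set.Ioi 0))
    (hkk' : ∀ v : ℝ, 0 < v → |k v| ≤ k' v) (f : Lp B p μ) :
    normLp (kernelOp (fun t => S.bochnerT t) k f)
      ≤ kernelOp (fun t => S.T t p) k' (normLp f) := by
  have hT := S.isContractionSemigroup_T h1p hp
  refine normLp_le_of_forall_dual fun ξ hξ => ?_
  have h1 := (S.isContractionSemigroup_bochnerT (B := B) h1p hp).map_kernelOp
    (T' := fun t => S.T t p) (ξ.compLpL p μ)
    (fun t ht f => compLp_tensorExtension hp (S.positive t ht p) ξ f) hk f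
  refine h1.le.trans ?_
  refine integral_mono_ae (hT.integrable_smul hk _) (hT.integrable_smul hk' _) ?_
  refine (ae_restrict_mem measurableSet_Ioi).mono fun v hv => ?_
  have hv' : (0 : ℝ) < v := hv
  have hv0 : 0 ≤ 1 / (4 * v) := by positivity
  have h2 : S.T (1 / (4 * v)) p (ξ.compLpL p μ f) ≤ S.T (1 / (4 * v)) p (normLp f) :=
    S.T_mono hv0 (compLp_le_normLp hξ f)
  have h3 : -S.T (1 / (4 * v)) p (ξ.compLpL p μ f) ≤ S.T (1 / (4 * v)) p (normLp f) := by
    rw [← map_neg]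
    refine S.T_mono hv0 ?_
    have h4 := compLp_le_normLp (ξ := -ξ) (by rwa [norm_neg]) f
    refine le_trans (le_of_eq ?_) h4
    have := ContinuousLinearMap.smul_compLp (-1 : ℝ) ξ f
    change -(ξ.compLp f) = _
    simpa using this.symm
  have h5 : 0 ≤ S.T (1 / (4 * v)) p (normLp f) := S.positive _ hv0 p _ (normLp_nonneg f)
  refine le_trans ?_ (smul_le_smul_of_nonneg_right (hkk' v hv') h5)
  rcases le_total 0 (k v) with h0 | h0
  · rw [abs_of_nonneg h0]
    exact smul_le_smul_of_nonneg_left h2 h0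
  · rw [abs_of_nonpos h0]
    have := smul_le_smul_of_nonneg_left h3 (neg_nonneg.2 h0)
    simpa using this

end Bochner

end SymmetricDiffusionSemigroup

/-! ### Duality of the semigroup -/

section Duality

variable {Ω : Type*} [MeasurableSpace Ω] {μ : Measure Ω} {p p' : ℝ≥0∞} [Fact (1 ≤ p)]
  [Fact (1 ≤ p')]
  {B : Type*} [NormedAddCommGroup B] [NormedSpace ℝ B]
  {B' : Type*} [NormedAddCommGroup B'] [NormedSpace ℝ B']

theorem lpPairing_elemTensor [ENNReal.HolderConjugate p' p] (β : B' →L[ℝ] B →L[ℝ] ℝ)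
    (φ : Lp ℝ p' μ) (b' : B') (ψ : Lp ℝ p μ) (b : B) :
    β.lpPairing μ p' p (elemTensor φ b') (elemTensor ψ b) = β b' b * ∫ x, φ x * ψ x ∂μ := by
  rw [ContinuousLinearMap.lpPairing_eq_integral, ← integral_const_mul]
  refine integral_congr_ae ?_
  filter_upwards [coeFn_elemTensor φ b', coeFn_elemTensor ψ b] with x h1 h2
  simp only [h1, h2, map_smul, smul_apply, smul_eq_mul]
  ring

namespace SymmetricDiffusionSemigroup

variable (S : SymmetricDiffusionSemigroup μ)

/-- Symmetry of `T_t` on indicator functions, read off in `L^2`. -/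
theorem integral_T_indicator_mul {t : ℝ} (ht : 0 ≤ t) {A C : Set Ω} (hA : MeasurableSet A)
    (hμA : μ A ≠ ∞) (hC : MeasurableSet C) (hμC : μ C ≠ ∞) :
    ∫ x, S.T t p' (indicatorConstLp p' hA hμA (1 : ℝ)) x * indicatorConstLp p hC hμC (1 : ℝ) x ∂μ
      = ∫ x, indicatorConstLp p' hA hμA (1 : ℝ) x
          * S.T t p (indicatorConstLp p hC hμC (1 : ℝ)) x ∂μ := by
  have hind : ∀ (r : ℝ≥0∞) {A : Set Ω} (hA : MeasurableSet A) (hμA : μ A ≠ ∞),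
      (indicatorConstLp r hA hμA (1 : ℝ) : Ω → ℝ) =ᵐ[μ] indicatorConstLp 2 hA hμA (1 : ℝ) :=
    fun r A hA hμA => indicatorConstLp_coeFn.trans indicatorConstLp_coeFn.symm
  have h := ContinuousLinearMap.adjoint_inner_right (S.T t 2) (indicatorConstLp 2 hA hμA (1 : ℝ))
    (indicatorConstLp 2 hC hμC (1 : ℝ))
  rw [(ContinuousLinearMap.isSelfAdjoint_iff'.1 (S.symmetric t ht)), L2.inner_def, L2.inner_def] at h
  refine Eq.trans (integral_congr_ae ?_) (h.symm.trans (integral_congr_ae ?_))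
  · filter_upwards [S.consistent t ht p' 2 _ _ (hind p' hA hμA), hind p hC hμC] with x h1 h2
    simp [h1, h2, mul_comm]
  · filter_upwards [S.consistent t ht p 2 _ _ (hind p hC hμC), hind p' hA hμA] with x h1 h2
    simp [h1, h2, mul_comm]

variable [CompleteSpace B] [CompleteSpace B']

/-- `T_t ⊗ I` on `L^{p'}_{B'}(Ω)` and on `L^p_B(Ω)` are transposes of each other with respect to any
bounded bilinear form on `B' × B`. -/
theorem lpPairing_bochnerT [ENNReal.HolderConjugate p' p] (hp : p ≠ ∞) (hp' : p' ≠ ∞)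
    (β : B' →L[ℝ] B →L[ℝ] ℝ) {t : ℝ} (ht : 0 ≤ t) (g : Lp B' p' μ) (f : Lp B p μ) :
    β.lpPairing μ p' p (S.bochnerT t g) f = β.lpPairing μ p' p g (S.bochnerT t f) := by
  have key : (β.lpPairing μ p' p).comp (S.bochnerT t)
      = ((ContinuousLinearMap.compL ℝ (Lp B p μ) (Lp B p μ) ℝ).flip (S.bochnerT t)).comp
        (β.lpPairing μ p' p) := by
    refine clm_ext_indicator hp' fun A hA hμA b' => clm_ext_indicator hp fun C hC hμC b => ?_
    change β.lpPairing μ p' p (S.bochnerT t (elemTensor _ b')) (elemTensor _ b)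
      = β.lpPairing μ p' p (elemTensor _ b') (S.bochnerT t (elemTensor _ b))
    rw [S.bochnerT_elemTensor hp' ht, S.bochnerT_elemTensor hp ht, lpPairing_elemTensor,
      lpPairing_elemTensor, S.integral_T_indicator_mul ht]
  exact congrArg (fun L => L g f) key

/-- The kernel operators on `L^{p'}_{B'}(Ω)` and `L^p_B(Ω)` are transposes of each other. -/
theorem lpPairing_kernelOp [ENNReal.HolderConjugate p' p] (h1p : 1 < p) (hp : p ≠ ∞)
    (h1p' : 1 < p') (hp' : p' ≠ ∞) (β : B' →L[ℝ] B →L[ℝ] ℝ) {k : ℝ → ℝ}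
    (hk : IntegrableOn k (Set.Ioi 0)) (g : Lp B' p' μ) (f : Lp B p μ) :
    β.lpPairing μ p' p (kernelOp (fun t => S.bochnerT t) k g) f
      = β.lpPairing μ p' p g (kernelOp (fun t => S.bochnerT t) k f) := by
  have h1 := (S.isContractionSemigroup_bochnerT (B := B') h1p' hp').map_kernelOp_functional
    ((β.lpPairing μ p' p).flip f) hk g
  have h2 := (S.isContractionSemigroup_bochnerT (B := B) h1p hp).map_kernelOp_functional
    (β.lpPairing μ p' p g) hk f
  rw [ContinuousLinearMap.flip_apply] at h1
  rw [h1, h2]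
  refine setIntegral_congr_fun measurableSet_Ioi fun v hv => ?_
  have hv' : (0 : ℝ) < v := hv
  simp only [ContinuousLinearMap.flip_apply]
  rw [S.lpPairing_bochnerT hp hp' β (by positivity)]

theorem lpPairing_poisson [ENNReal.HolderConjugate p' p] (h1p : 1 < p) (hp : p ≠ ∞)
    (h1p' : 1 < p') (hp' : p' ≠ ∞) (β : B' →L[ℝ] B →L[ℝ] ℝ) {t : ℝ} (ht : 0 < t)
    (g : Lp B' p' μ) (f : Lp B p μ) :
    β.lpPairing μ p' p (S.poisson t g) f = β.lpPairing μ p' p g (S.poisson t f) := by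
  rw [poisson, poisson, subordinate_eq_kernelOp ht, subordinate_eq_kernelOp ht]
  exact S.lpPairing_kernelOp h1p hp h1p' hp' β (integrableOn_subordKernel ht) g f

end SymmetricDiffusionSemigroup

end Duality

/-! ### Consistency, positivity and the Markov property of the subordinated semigroup -/

namespace SymmetricDiffusionSemigroup

variable {Ω : Type*} [MeasurableSpace Ω] {μ : Measure Ω} (S : SymmetricDiffusionSemigroup μ)
  {p r : ℝ≥0∞} [Fact (1 ≤ p)] [Fact (1 ≤ r)]

/-- The operators `P_t` on different `L^p` agree: the pairs of functions that agree almost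
everywhere form a closed convex set, and `P_t f` is an average of the functions `T_a f`. -/
theorem subordinate_consistent (h1p : 1 < p) (hp : p ≠ ∞) (h1r : 1 < r) (hr : r ≠ ∞) {t : ℝ}
    (ht : 0 < t) {f : Lp ℝ p μ} {g : Lp ℝ r μ} (hfg : (f : Ω → ℝ) =ᵐ[μ] g) :
    ⇑(subordinate (fun s => S.T s p) t f) =ᵐ[μ] ⇑(subordinate (fun s => S.T s r) t g) := by
  have := isProbabilityMeasure_stableLaw ht
  have hTp := S.isContractionSemigroup_T h1p hp
  have hTr := S.isContractionSemigroup_T h1r hr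
  have hconv : Convex ℝ {g : Lp ℝ p μ × Lp ℝ r μ | (g.1 : Ω → ℝ) =ᵐ[μ] g.2} := by
    intro u hu v hv a b _ _ _
    have hu' : (u.1 : Ω → ℝ) =ᵐ[μ] u.2 := hu
    have hv' : (v.1 : Ω → ℝ) =ᵐ[μ] v.2 := hv
    change ((a • u.1 + b • v.1 : Lp ℝ p μ) : Ω → ℝ) =ᵐ[μ] (a • u.2 + b • v.2 : Lp ℝ r μ)
    filter_upwards [hu', hv', Lp.coeFn_add (a • u.1) (b • v.1), Lp.coeFn_add (a • u.2) (b • v.2),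
      Lp.coeFn_smul a u.1, Lp.coeFn_smul a u.2, Lp.coeFn_smul b v.1, Lp.coeFn_smul b v.2]
      with x h1 h2 h3 h4 h5 h6 h7 h8
    rw [h3, h4, Pi.add_apply, Pi.add_apply, h5, h6, h7, h8]
    simp only [Pi.smul_apply, h1, h2]
  have h := Convex.integral_mem hconv isClosed_setOf_ae_eq
    (f := fun a => (S.T a p f, S.T a r g)) (μ := stableLaw t) ?_
    ((hTp.integrable_stableLaw ht f).prodMk (hTr.integrable_stableLaw ht g))
  · rw [integral_pair (hTp.integrable_stableLaw ht f) (hTr.integrable_stableLaw ht g),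
      ← hTp.subordinate_eq_integral_stableLaw ht, ← hTr.subordinate_eq_integral_stableLaw ht] at h
    exact h
  · filter_upwards [ae_stableLaw_pos t] with a ha
    exact S.consistent a ha.le p r f g hfg

/-- The sub-Markov property, from contractivity on `L^∞`. -/
theorem T_le_const {t : ℝ} (ht : 0 ≤ t) {f : Lp ℝ p μ} (hf : 0 ≤ f) {c : ℝ} (hc : 0 ≤ c)
    (hfc : ∀ᵐ x ∂μ, f x ≤ c) : ∀ᵐ x ∂μ, S.T t p f x ≤ c := by
  have hb : ∀ᵐ x ∂μ, ‖f x‖ ≤ c := by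
    filter_upwards [hfc, (Lp.coeFn_nonneg f).2 hf] with x h1 h2
    rwa [Real.norm_of_nonneg h2]
  have hm : MemLp f ∞ μ := memLp_top_of_bound (Lp.aestronglyMeasurable f) c hb
  have hg : ‖hm.toLp f‖ ≤ c := by
    rw [Lp.norm_toLp]
    refine ENNReal.toReal_le_of_le_ofReal hc ?_
    exact eLpNorm_le_of_ae_bound (p := ∞) hb |>.trans (by simp)
  have h1 : ‖S.T t ∞ (hm.toLp f)‖ ≤ c := (S.norm_apply_le ∞ ht _).trans hg
  filter_upwards [S.consistent t ht p ∞ f (hm.toLp f) hm.coeFn_toLp.symm,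
    ae_le_eLpNormEssSup (f := S.T t ∞ (hm.toLp f)) (μ := μ)] with x h2 h3
  rw [h2]
  rw [← eLpNorm_exponent_top, ← Lp.enorm_def, enorm_le_iff_norm_le] at h3
  exact (le_abs_self _).trans (h3.trans h1)

/-- The sub-Markov property passes to averages, since `{g | g ≤ c}` is closed and convex. -/
theorem subordinate_le_const (h1p : 1 < p) (hp : p ≠ ∞) {t : ℝ} (ht : 0 < t) {f : Lp ℝ p μ}
    (hf : 0 ≤ f) {c : ℝ} (hc : 0 ≤ c) (hfc : ∀ᵐ x ∂μ, f x ≤ c) :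
    ∀ᵐ x ∂μ, subordinate (fun s => S.T s p) t f x ≤ c := by
  have := isProbabilityMeasure_stableLaw ht
  have hTp := S.isContractionSemigroup_T h1p hp
  have hconv : Convex ℝ {g : Lp ℝ p μ | ∀ᵐ x ∂μ, g x ≤ c} := by
    intro u hu v hv a b ha hb hab
    have hu' : ∀ᵐ x ∂μ, u x ≤ c := hu
    have hv' : ∀ᵐ x ∂μ, v x ≤ c := hv
    change ∀ᵐ x ∂μ, (a • u + b • v : Lp ℝ p μ) x ≤ c
    filter_upwards [hu', hv', Lp.coeFn_add (a • u) (b • v), Lp.coeFn_smul a u, Lp.coeFn_smul b v]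
      with x h1 h2 h3 h4 h5
    rw [h3, Pi.add_apply, h4, h5, Pi.smul_apply, Pi.smul_apply, smul_eq_mul, smul_eq_mul]
    calc a * u x + b * v x ≤ a * c + b * c := by gcongr
      _ = c := by rw [← add_mul, hab, one_mul]
  have h := Convex.integral_mem hconv (isClosed_setOf_ae_le c)
    (f := fun a => S.T a p f) (μ := stableLaw t) ?_ (hTp.integrable_stableLaw ht f)
  · rwa [← hTp.subordinate_eq_integral_stableLaw ht] at h
  · filter_upwards [ae_stableLaw_pos t] with a ha
    exact S.T_le_const ha.le hf hc hfc

theorem subordinate_mono (h1p : 1 < p) (hp : p ≠ ∞) {t : ℝ} (ht : 0 < t) {f g : Lp ℝ p μ}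
    (hfg : f ≤ g) :
    subordinate (fun s => S.T s p) t f ≤ subordinate (fun s => S.T s p) t g := by
  rw [subordinate_eq_kernelOp ht, subordinate_eq_kernelOp ht]
  exact S.kernelOp_mono h1p hp (integrableOn_subordKernel ht)
    (fun v _ => subordKernel_nonneg ht.le v) hfg

theorem subordinate_nonneg (h1p : 1 < p) (hp : p ≠ ∞) {t : ℝ} (ht : 0 < t) {f : Lp ℝ p μ}
    (hf : 0 ≤ f) : 0 ≤ subordinate (fun s => S.T s p) t f := by
  have h := S.subordinate_mono h1p hp ht hf
  rwa [← (S.isContractionSemigroup_T h1p hp).subordCLM_apply ht, map_zero] at h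

end SymmetricDiffusionSemigroup

/-! ### The limit of the subordinated semigroup at infinity -/

namespace SymmetricDiffusionSemigroup

variable {Ω : Type*} [MeasurableSpace Ω] {μ : Measure Ω} (S : SymmetricDiffusionSemigroup μ)

theorem inner_subordinate {t : ℝ} (ht : 0 < t) (f g : Lp ℝ 2 μ) :
    inner ℝ (subordinate (fun s => S.T s 2) t f) g
      = inner ℝ f (subordinate (fun s => S.T s 2) t g) := by
  have hT := S.isContractionSemigroup_T (p := 2) (by norm_num) (by norm_num)
  have h : ∀ f g : Lp ℝ 2 μ, inner ℝ g (subordinate (fun s => S.T s 2) t f)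
      = ∫ v in Set.Ioi (0 : ℝ), subordKernel t v * inner ℝ g (S.T (1 / (4 * v)) 2 f) := by
    intro f g
    rw [subordinate_eq_kernelOp ht]
    exact hT.map_kernelOp_functional (innerSL ℝ g) (integrableOn_subordKernel ht) f
  rw [real_inner_comm, h, h]
  refine setIntegral_congr_fun measurableSet_Ioi fun v hv => ?_
  have hv' : (0 : ℝ) < v := hv
  rw [← ContinuousLinearMap.adjoint_inner_left, ContinuousLinearMap.isSelfAdjoint_iff'.1
    (S.symmetric _ (by positivity)), real_inner_comm]

/-- By symmetry and the semigroup law, `⟨P_t f, f⟩ = ‖P_{t/2} f‖²` decreases in `t`, and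
`‖P_s f - P_t f‖²` is a second difference of this function. -/
theorem cauchySeq_subordinate_two (f : Lp ℝ 2 μ) :
    CauchySeq fun t : ℝ => subordinate (fun s => S.T s 2) t f := by
  have hT := S.isContractionSemigroup_T (p := 2) (by norm_num) (by norm_num)
  set P : ℝ → Lp ℝ 2 μ := fun t => subordinate (fun s => S.T s 2) t f with hP
  have hinner : ∀ s t : ℝ, 0 < s → 0 < t → inner ℝ (P s) (P t) = ‖P ((s + t) / 2)‖ ^ 2 := by
    intro s t hs ht
    have h1 : ∀ s t : ℝ, 0 < s → 0 < t → inner ℝ (P s) (P t) = inner ℝ f (P (s + t)) := by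
      intro s t hs ht
      rw [hP]
      simp only
      rw [S.inner_subordinate hs, ← hT.subordinate_add hs ht]
    rw [← real_inner_self_eq_norm_sq, h1 s t hs ht, h1 _ _ (by positivity) (by positivity),
      add_halves]
  have hanti : Antitone fun t : ℝ => ‖P (max t 1)‖ ^ 2 := by
    intro s t hst
    have h1 : max s 1 ≤ max t 1 := max_le_max_right 1 hst
    have h2 : 0 < max s 1 := lt_of_lt_of_le one_pos (le_max_right _ _)
    refine pow_le_pow_left₀ (norm_nonneg _) ?_ 2
    rcases h1.eq_or_lt with h | h
    · rw [h]
    · have h3 := hT.subordinate_add (sub_pos.2 h) h2 f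
      rw [sub_add_cancel] at h3
      rw [hP]
      simp only
      rw [h3]
      exact hT.norm_subordinate_le (sub_pos.2 h) _
  obtain ⟨L, hL⟩ : ∃ L, Tendsto (fun t : ℝ => ‖P t‖ ^ 2) atTop (𝓝 L) := by
    refine ⟨_, (tendsto_atTop_ciInf hanti ⟨0, ?_⟩).congr' ?_⟩
    · rintro _ ⟨t, rfl⟩
      positivity
    · filter_upwards [eventually_ge_atTop 1] with t ht
      rw [max_eq_left ht]
  rw [cauchySeq_iff_tendsto_dist_atTop_0]
  have h1 : Tendsto (fun n : ℝ × ℝ => ‖P n.1‖ ^ 2) atTop (𝓝 L) := by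
    rw [← prod_atTop_atTop_eq]; exact hL.comp tendsto_fst
  have h2 : Tendsto (fun n : ℝ × ℝ => ‖P n.2‖ ^ 2) atTop (𝓝 L) := by
    rw [← prod_atTop_atTop_eq]; exact hL.comp tendsto_snd
  have h3 : Tendsto (fun n : ℝ × ℝ => ‖P ((n.1 + n.2) / 2)‖ ^ 2) atTop (𝓝 L) := by
    rw [← prod_atTop_atTop_eq]
    refine hL.comp (Tendsto.atTop_div_const two_pos (tendsto_fst.atTop_add_atTop tendsto_snd))
  have h4 := Real.continuous_sqrt.tendsto _ |>.comp ((h1.add h2).sub (h3.const_mul 2))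
  have h5 : √(L + L - 2 * L) = 0 := by
    rw [Real.sqrt_eq_zero']; linarith
  rw [h5] at h4
  refine h4.congr' ?_
  have hpos : ∀ᶠ n : ℝ × ℝ in atTop, 0 < n.1 ∧ 0 < n.2 := by
    rw [← prod_atTop_atTop_eq]
    exact (tendsto_fst.eventually (eventually_gt_atTop 0)).and
      (tendsto_snd.eventually (eventually_gt_atTop 0))
  filter_upwards [hpos] with n hn
  rw [dist_eq_norm, Function.comp_apply, ← Real.sqrt_sq (norm_nonneg (P n.1 - P n.2)),
    norm_sub_sq_real, hinner n.1 n.2 hn.1 hn.2]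
  congr 1
  ring

/-- On `L^2` the limit of `P_t f` is a fixed point and `f - lim P_t f` is orthogonal to all fixed
points. -/
theorem tendsto_subordinate_two (f : Lp ℝ 2 μ) :
    Tendsto (fun t : ℝ => subordinate (fun s => S.T s 2) t f) atTop (𝓝 (S.fixProjL2 f)) := by
  have hT := S.isContractionSemigroup_T (p := 2) (by norm_num) (by norm_num)
  obtain ⟨g, hg⟩ := cauchySeq_tendsto_of_complete (S.cauchySeq_subordinate_two f)
  suffices h : S.fixProjL2 f = g by rwa [h]
  refine Submodule.eq_starProjection_of_mem_of_inner_eq_zero ?_ fun w hw => ?_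
  · intro t ht
    have h1 := ((hT.subordCLM ht).continuous.tendsto g).comp hg
    rw [hT.subordCLM_apply ht] at h1
    have h2 : Tendsto (fun s : ℝ => subordinate (fun s => S.T s 2) (t + s) f) atTop (𝓝 g) :=
      hg.comp (tendsto_atTop_add_const_left _ t tendsto_id)
    refine tendsto_nhds_unique h1 (h2.congr' ?_)
    filter_upwards [eventually_gt_atTop 0] with s hs
    rw [hT.subordinate_add ht hs, Function.comp_apply, hT.subordCLM_apply ht]
  · have h1 : Tendsto (fun t : ℝ => inner ℝ (f - subordinate (fun s => S.T s 2) t f) w) atTop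
        (𝓝 (inner ℝ (f - g) w)) :=
      (tendsto_const_nhds.sub hg).inner tendsto_const_nhds
    refine tendsto_nhds_unique (h1.congr' ?_) tendsto_const_nhds
    filter_upwards [eventually_gt_atTop 0] with t ht
    rw [inner_sub_left, S.inner_subordinate ht, hw t ht, sub_self]

variable {p : ℝ≥0∞} [Fact (1 ≤ p)]

/-- Interpolation between the convergence in `L^2` and the boundedness in the other `L^r`. -/
theorem cauchySeq_subordinate_indicator (h1p : 1 < p) (hp : p ≠ ∞) {A : Set Ω}
    (hA : MeasurableSet A) (hμA : μ A ≠ ∞) :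
    CauchySeq fun t : ℝ => subordinate (fun s => S.T s p) t (indicatorConstLp p hA hμA (1 : ℝ)) := by
  have hind : ∀ (r : ℝ≥0∞), (indicatorConstLp p hA hμA (1 : ℝ) : Ω → ℝ)
      =ᵐ[μ] indicatorConstLp r hA hμA (1 : ℝ) := fun r =>
    indicatorConstLp_coeFn.trans indicatorConstLp_coeFn.symm
  set P : (r : ℝ≥0∞) → [Fact (1 ≤ r)] → ℝ → Lp ℝ r μ := fun r _ t =>
    subordinate (fun s => S.T s r) t (indicatorConstLp r hA hμA (1 : ℝ)) with hPdef
  have hpos : ∀ᶠ n : ℝ × ℝ in atTop, 0 < n.1 ∧ 0 < n.2 := by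
    rw [← prod_atTop_atTop_eq]
    exact (tendsto_fst.eventually (eventually_gt_atTop 0)).and
      (tendsto_snd.eventually (eventually_gt_atTop 0))
  have hcons : ∀ (r : ℝ≥0∞) [Fact (1 ≤ r)], 1 < r → r ≠ ∞ → ∀ s t : ℝ, 0 < s → 0 < t →
      eLpNorm (⇑(P p s) - ⇑(P p t)) r μ = ‖P r s - P r t‖ₑ := by
    intro r _ h1r hr s t hs ht
    rw [Lp.enorm_def]
    refine eLpNorm_congr_ae ?_
    filter_upwards [S.subordinate_consistent h1p hp h1r hr hs (hind r),
      S.subordinate_consistent h1p hp h1r hr ht (hind r), Lp.coeFn_sub (P r s) (P r t)]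
      with x h1 h2 h3
    rw [h3, Pi.sub_apply, Pi.sub_apply]
    exact congrArg₂ _ h1 h2
  rw [cauchySeq_iff_tendsto_dist_atTop_0]
  have key : Tendsto (fun n : ℝ × ℝ => eLpNorm (⇑(P p n.1) - ⇑(P p n.2)) p μ) atTop (𝓝 0) := by
    refine tendsto_eLpNorm_zero_of_tendsto_two
      (fun t => (Lp.aestronglyMeasurable _).sub (Lp.aestronglyMeasurable _)) h1p hp ?_ ?_
    · intro r h1r hr
      have : Fact (1 ≤ r) := ⟨h1r.le⟩
      refine ⟨ENNReal.ofReal (2 * ‖indicatorConstLp r hA hμA (1 : ℝ)‖), ENNReal.ofReal_ne_top, ?_⟩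
      filter_upwards [hpos] with n hn
      rw [hcons r h1r hr _ _ hn.1 hn.2, ← ofReal_norm]
      refine ENNReal.ofReal_le_ofReal ((_root_.norm_sub_le _ _).trans ?_)
      have hT := S.isContractionSemigroup_T h1r hr
      have h1 := hT.norm_subordinate_le hn.1 (indicatorConstLp r hA hμA (1 : ℝ))
      have h2 := hT.norm_subordinate_le hn.2 (indicatorConstLp r hA hμA (1 : ℝ))
      rw [two_mul]
      exact add_le_add h1 h2
    · have h2 := cauchySeq_iff_tendsto_dist_atTop_0.1
        (S.cauchySeq_subordinate_two (indicatorConstLp 2 hA hμA (1 : ℝ)))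
      have h3 := ENNReal.tendsto_ofReal h2
      rw [ENNReal.ofReal_zero] at h3
      refine h3.congr' ?_
      filter_upwards [hpos] with n hn
      rw [hcons 2 (by norm_num) (by norm_num) _ _ hn.1 hn.2, ← ofReal_norm, dist_eq_norm]
  have h3 := (ENNReal.tendsto_toReal ENNReal.zero_ne_top).comp key
  refine h3.congr' ?_
  filter_upwards [hpos] with n hn
  rw [Function.comp_apply, hcons p h1p hp _ _ hn.1 hn.2, dist_eq_norm, toReal_enorm]

section Bochner

variable {B : Type*} [NormedAddCommGroup B] [NormedSpace ℝ B] [CompleteSpace B]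

theorem poisson_elemTensor (h1p : 1 < p) (hp : p ≠ ∞) {t : ℝ} (ht : 0 < t) (φ : Lp ℝ p μ) (b : B) :
    S.poisson t (elemTensor φ b) = elemTensor (subordinate (fun s => S.T s p) t φ) b := by
  rw [poisson, subordinate_eq_kernelOp ht, subordinate_eq_kernelOp ht]
  exact ((S.isContractionSemigroup_T h1p hp).map_kernelOp
    ((ContinuousLinearMap.toSpanSingleton ℝ b).compLpL p μ)
    (fun t ht φ => (S.bochnerT_elemTensor hp ht φ b).symm) (integrableOn_subordKernel ht) φ).symm

/-- Strong convergence extends from indicator functions to `L^p_B(Ω)` by tensoring, contractivity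
and density. -/
theorem exists_tendsto_poisson (h1p : 1 < p) (hp : p ≠ ∞) :
    ∃ Q : Lp B p μ →L[ℝ] Lp B p μ, ∀ f, Tendsto (fun t : ℝ => S.poisson t f) atTop (𝓝 (Q f)) := by
  have hT := S.isContractionSemigroup_bochnerT (B := B) h1p hp
  have hC : ∀ f : Lp B p μ, CauchySeq fun t : ℝ => S.poisson t f := by
    refine Lp_induction_indicator hp _ (fun A hA hμA b => ?_) (fun f g hf hg => ?_) ?_
    · have h := ((ContinuousLinearMap.toSpanSingleton ℝ b).compLpL p μ).uniformContinuous.comp_cauchySeq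
        (S.cauchySeq_subordinate_indicator h1p hp hA hμA)
      obtain ⟨g, hg⟩ := cauchySeq_tendsto_of_complete h
      refine (hg.congr' ?_).cauchySeq
      filter_upwards [eventually_gt_atTop 0] with t ht
      exact (S.poisson_elemTensor h1p hp ht _ b).symm
    · obtain ⟨f', hf'⟩ := cauchySeq_tendsto_of_complete hf
      obtain ⟨g', hg'⟩ := cauchySeq_tendsto_of_complete hg
      refine ((hf'.add hg').congr' ?_).cauchySeq
      filter_upwards [eventually_gt_atTop 0] with t ht
      have := map_add (hT.subordCLM ht) f g
      simp only [hT.subordCLM_apply] at this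
      exact this.symm
    · refine isClosed_of_closure_subset fun f hf => Metric.cauchySeq_iff.2 fun ε hε => ?_
      obtain ⟨g, hg, hfg⟩ := Metric.mem_closure_iff.1 hf (ε / 3) (by positivity)
      obtain ⟨N, hN⟩ := Metric.cauchySeq_iff.1 hg (ε / 3) (by positivity)
      refine ⟨max N 1, fun s hs t ht => ?_⟩
      have hle : ∀ t : ℝ, 0 < t → dist (S.poisson t f) (S.poisson t g) ≤ dist f g := by
        intro t ht
        have h1 := hT.norm_subordinate_le ht (f - g)
        rw [← hT.subordCLM_apply ht, map_sub, hT.subordCLM_apply, hT.subordCLM_apply] at h1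
        rw [dist_eq_norm, dist_eq_norm]
        exact h1
      have hs0 : 0 < s := lt_of_lt_of_le one_pos ((le_max_right N 1).trans hs)
      have ht0 : 0 < t := lt_of_lt_of_le one_pos ((le_max_right N 1).trans ht)
      have h1 := hle s hs0
      have h2 := hle t ht0
      have h3 := hN s ((le_max_left N 1).trans hs) t ((le_max_left N 1).trans ht)
      have h4 := dist_triangle4_right (S.poisson s f) (S.poisson t f) (S.poisson s g) (S.poisson t g)
      linarith
  choose Q hQ using fun f => cauchySeq_tendsto_of_complete (hC f)
  have hlim : Tendsto (fun (n : ℕ) (f : Lp B p μ) =>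
      hT.subordCLM (t := (n : ℝ) + 1) (by positivity) f) atTop (𝓝 Q) := by
    refine tendsto_pi_nhds.2 fun f => ?_
    simp only [hT.subordCLM_apply]
    exact (hQ f).comp (tendsto_atTop_add_const_right _ 1 tendsto_natCast_atTop_atTop)
  exact ⟨continuousLinearMapOfTendsto _ hlim, hQ⟩

/-- The strong limit on `L^p` agrees with the projection on `L^2 ∩ L^p`; in particular the
projection does extend to `L^p`. -/
theorem tendsto_subordinate_lpExtension (h1p : 1 < p) (hp : p ≠ ∞) (f : Lp ℝ p μ) :
    Tendsto (fun t : ℝ => subordinate (fun s => S.T s p) t f) atTop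
      (𝓝 (lpExtension p S.fixProjL2 f)) := by
  obtain ⟨Q, hQ⟩ := S.exists_tendsto_poisson (B := ℝ) h1p hp
  simp only [poisson, S.bochnerT_real hp] at hQ
  have hspec : ∀ (f : Lp ℝ 2 μ) (g : Lp ℝ p μ), (f : Ω → ℝ) =ᵐ[μ] g →
      (S.fixProjL2 f : Ω → ℝ) =ᵐ[μ] Q g := by
    intro f g hfg
    refine isClosed_setOf_ae_eq.mem_of_tendsto
      ((S.tendsto_subordinate_two f).prodMk_nhds (hQ g)) ?_
    filter_upwards [eventually_gt_atTop 0] with t ht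
    exact S.subordinate_consistent (by norm_num) (by norm_num) h1p hp ht hfg
  have hex : ∃ A' : Lp ℝ p μ →L[ℝ] Lp ℝ p μ, ∀ (f : Lp ℝ 2 μ) (g : Lp ℝ p μ),
      (f : Ω → ℝ) =ᵐ[μ] g → (S.fixProjL2 f : Ω → ℝ) =ᵐ[μ] A' g := ⟨Q, hspec⟩
  have heq : lpExtension p S.fixProjL2 = Q := by
    rw [lpExtension, dif_pos hex]
    refine clm_ext_indicator hp fun A hA hμA b => ?_
    rw [elemTensor_real, map_smul, map_smul]
    congr 1
    ext1
    have hind : (indicatorConstLp 2 hA hμA (1 : ℝ) : Ω → ℝ)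
      =ᵐ[μ] indicatorConstLp p hA hμA (1 : ℝ) :=
      indicatorConstLp_coeFn.trans indicatorConstLp_coeFn.symm
    exact (hex.choose_spec _ _ hind).symm.trans (hspec _ _ hind)
  rw [heq]
  exact hQ f

/-- The subordinated semigroup converges strongly to the projection onto its fixed points. -/
theorem tendsto_poisson_fixProj (h1p : 1 < p) (hp : p ≠ ∞) (f : Lp B p μ) :
    Tendsto (fun t : ℝ => S.poisson t f) atTop (𝓝 (S.fixProj f)) := by
  obtain ⟨Q, hQ⟩ := S.exists_tendsto_poisson (B := B) h1p hp
  have : tensorExtension B (lpExtension p S.fixProjL2) = Q := by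
    refine tensorExtension_eq hp fun φ b => ?_
    refine tendsto_nhds_unique (hQ _) ?_
    refine Tendsto.congr' ?_ (((continuous_elemTensor b).tendsto _).comp
      (S.tendsto_subordinate_lpExtension h1p hp φ))
    filter_upwards [eventually_gt_atTop 0] with t ht
    exact (S.poisson_elemTensor h1p hp ht φ b).symm
  rw [fixProj, this]
  exact hQ f

/-- `F ∂_t P_t = 0`, since `F P_t = F` for all `t`. -/
theorem fixProj_subordDeriv (h1p : 1 < p) (hp : p ≠ ∞) {t : ℝ} (ht : 0 < t) (f : Lp B p μ) :
    S.fixProj (subordDeriv (fun s => S.bochnerT s) t f) = 0 := by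
  have hT := S.isContractionSemigroup_bochnerT (B := B) h1p hp
  have hinv : ∀ s : ℝ, 0 < s → S.fixProj (S.poisson s f) = S.fixProj f := by
    intro s hs
    refine tendsto_nhds_unique (S.tendsto_poisson_fixProj h1p hp _)
      (Tendsto.congr' ?_ ((S.tendsto_poisson_fixProj h1p hp f).comp
        (tendsto_atTop_add_const_right _ s tendsto_id)))
    filter_upwards [eventually_gt_atTop 0] with r hr
    exact hT.subordinate_add hr hs f
  have h1 : HasDerivAt (fun s => S.fixProj (S.poisson s f)) _ t :=
    (S.fixProj (B := B) (p := p)).hasFDerivAt.comp_hasDerivAt t (hT.hasDerivAt_subordinate ht f)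
  refine h1.unique ((hasDerivAt_const t (S.fixProj f)).congr_of_eventuallyEq ?_)
  filter_upwards [Ioi_mem_nhds ht] with s hs using hinv s hs

end Bochner

end SymmetricDiffusionSemigroup

/-! ### The maximal ergodic theorem -/

section MaximalErgodic

/-- Absorption: a finite quantity bounded by a constant times a power `θ < 1` of itself. -/
theorem rpow_one_sub_le_of_le_mul_rpow {I K : ℝ≥0∞} {θ : ℝ} (hI : I ≠ ∞) (hθ : θ < 1)
    (h : I ≤ K * I ^ θ) : I ^ (1 - θ) ≤ K := by
  rcases eq_or_ne I 0 with h0 | h0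
  · rw [h0, ENNReal.zero_rpow_of_pos (by linarith)]
    exact zero_le
  · rw [ENNReal.rpow_sub _ _ h0 hI, ENNReal.rpow_one]
    exact ENNReal.div_le_of_le_mul h

variable {Ω : Type*} [MeasurableSpace Ω] {μ : Measure Ω}

/-- Doob's argument: the weak type inequality `λ μ{Φ > λ} ≤ ∫_{Φ > λ} f`, integrated against
`λ^{R-2} dλ`, bounds the `L^R` norm of `Φ` by that of `f`. -/
theorem lintegral_rpow_le_of_weak_type {R : ℝ} (hR : 1 < R) {f Φ : Ω → ℝ} (hf : Measurable f)
    (hΦ : Measurable Φ) (hΦ0 : 0 ≤ᵐ[μ] Φ)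
    (hfin : ∫⁻ x, ENNReal.ofReal (Φ x ^ R) ∂μ ≠ ∞)
    (hw : ∀ c : ℝ, 0 < c → ENNReal.ofReal c * μ {x | c < Φ x}
      ≤ ∫⁻ x in {x | c < Φ x}, ENNReal.ofReal (f x) ∂μ) :
    ∫⁻ x, ENNReal.ofReal (Φ x ^ R) ∂μ
      ≤ ENNReal.ofReal (R / (R - 1)) ^ R * ∫⁻ x, ENNReal.ofReal (f x) ^ R ∂μ := by
  have hR0 : 0 < R := by linarith
  have hR1 : 0 < R - 1 := by linarith
  have hfm : Measurable fun x => ENNReal.ofReal (f x) := hf.ennreal_ofReal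
  set ν := μ.withDensity fun x => ENNReal.ofReal (f x) with hν
  set I := ∫⁻ x, ENNReal.ofReal (Φ x ^ R) ∂μ with hI
  have hν0 : 0 ≤ᵐ[ν] Φ := (withDensity_absolutelyContinuous μ _).ae_le hΦ0
  have h1 : I ≤ ENNReal.ofReal R * ∫⁻ t in Set.Ioi (0 : ℝ),
      ν {x | t < Φ x} * ENNReal.ofReal (t ^ (R - 1 - 1)) := by
    rw [hI, lintegral_rpow_eq_lintegral_meas_lt_mul μ hΦ0 hΦ.aemeasurable hR0]
    gcongr ENNReal.ofReal R * ?_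
    refine setLIntegral_mono' measurableSet_Ioi fun t ht => ?_
    have ht' : (0 : ℝ) < t := ht
    have e1 : t ^ (R - 1) = t * t ^ (R - 1 - 1) := by
      rw [Real.rpow_sub_one ht'.ne' (R - 1)]
      field_simp
    rw [e1, ENNReal.ofReal_mul ht'.le, ← mul_assoc, mul_comm (μ _),
      withDensity_apply _ (measurableSet_lt measurable_const hΦ)]
    gcongr
    exact hw t ht'
  have h2 : ENNReal.ofReal (R - 1) * ∫⁻ t in Set.Ioi (0 : ℝ),
      ν {x | t < Φ x} * ENNReal.ofReal (t ^ (R - 1 - 1))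
      = ∫⁻ x, ENNReal.ofReal (f x) * ENNReal.ofReal (Φ x ^ (R - 1)) ∂μ := by
    rw [← lintegral_rpow_eq_lintegral_meas_lt_mul ν hν0 hΦ.aemeasurable hR1, hν,
      lintegral_withDensity_eq_lintegral_mul _ hfm (by fun_prop)]
    rfl
  set K := ∫⁻ x, ENNReal.ofReal (f x) ^ R ∂μ with hK
  have h3 : ∫⁻ x, ENNReal.ofReal (f x) * ENNReal.ofReal (Φ x ^ (R - 1)) ∂μ
      ≤ K ^ (1 / R) * I ^ (1 / (R / (R - 1))) := by
    refine (ENNReal.lintegral_mul_le_Lp_mul_Lq μ (Real.HolderConjugate.conjExponent hR)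
      hfm.aemeasurable (by fun_prop)).trans (le_of_eq ?_)
    congr 2
    refine lintegral_congr_ae ?_
    filter_upwards [hΦ0] with x hx
    have hx' : 0 ≤ Φ x := hx
    change ENNReal.ofReal (Φ x ^ (R - 1)) ^ (R / (R - 1)) = _
    rw [ENNReal.ofReal_rpow_of_nonneg (by positivity) (by positivity), ← Real.rpow_mul hx']
    congr 2
    field_simp
  have h4 : I ≤ (ENNReal.ofReal (R / (R - 1)) * K ^ (1 / R)) * I ^ ((R - 1) / R) := by
    have e2 : ENNReal.ofReal R = ENNReal.ofReal (R / (R - 1)) * ENNReal.ofReal (R - 1) := by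
      rw [← ENNReal.ofReal_mul (by positivity)]
      congr 1
      field_simp
    rw [e2, mul_assoc, h2] at h1
    refine h1.trans ?_
    rw [mul_assoc]
    gcongr
    simpa using h3
  have h5 := rpow_one_sub_le_of_le_mul_rpow hfin (by rw [div_lt_one hR0]; linarith) h4
  have e3 : 1 - (R - 1) / R = 1 / R := by field_simp; ring
  rw [e3, one_div, ENNReal.rpow_inv_le_iff hR0, ENNReal.mul_rpow_of_nonneg _ _ hR0.le,
    ← ENNReal.rpow_mul, inv_mul_cancel₀ hR0.ne', ENNReal.rpow_one] at h5
  exact h5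

variable {r : ℝ≥0∞} [Fact (1 ≤ r)]

/-- The ergodic sum `f + T f + ⋯ + T^{n-1} f`. -/
def ergodicSum (T : Lp ℝ r μ →L[ℝ] Lp ℝ r μ) (f : Lp ℝ r μ) (n : ℕ) : Lp ℝ r μ :=
  ∑ k ∈ Finset.range n, (T ^ k) f

variable {T : Lp ℝ r μ →L[ℝ] Lp ℝ r μ}

theorem ergodicSum_succ (f : Lp ℝ r μ) (n : ℕ) :
    ergodicSum T f (n + 1) = f + T (ergodicSum T f n) := by
  rw [ergodicSum, Finset.sum_range_succ', ergodicSum, map_sum, add_comm]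
  congr 1
  refine Finset.sum_congr rfl fun k _ => ?_
  rw [pow_succ']
  rfl

theorem ergodicSum_nonneg (hT : ∀ f, 0 ≤ f → 0 ≤ T f) {f : Lp ℝ r μ} (hf : 0 ≤ f) (n : ℕ) :
    0 ≤ ergodicSum T f n := by
  induction n with
  | zero => simp [ergodicSum]
  | succ n ih =>
    rw [ergodicSum_succ]
    exact add_nonneg hf (hT _ ih)

/-- The functional inequality `M ≤ f - c + T M` on `{M > 0}` for
`M = max_{n ≤ N} (S_n f - n c)⁺`, where `S_n f` are the ergodic sums. -/
theorem exists_ergodic_majorant (hT : ∀ f, 0 ≤ f → 0 ≤ T f)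
    (hsub : ∀ (f : Lp ℝ r μ) (c : ℝ), 0 ≤ f → 0 ≤ c → (∀ᵐ x ∂μ, f x ≤ c) → ∀ᵐ x ∂μ, T f x ≤ c)
    {f : Lp ℝ r μ} (hf : 0 ≤ f) {c : ℝ} (hc : 0 < c) (N : ℕ) :
    ∃ M : Lp ℝ r μ, 0 ≤ M ∧ (∀ n ≤ N, ∀ᵐ x ∂μ, ergodicSum T f n x - n * c ≤ M x) ∧
      (∀ᵐ x ∂μ, 0 < M x → ∃ n ≤ N, 1 ≤ n ∧ n * c < ergodicSum T f n x) ∧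
      ∀ᵐ x ∂μ, 0 < M x → M x ≤ f x - c + T M x := by
  have hS0 := ergodicSum_nonneg hT hf
  have hz : ∀ᵐ x ∂μ, ergodicSum T f 0 x = 0 := by
    filter_upwards [Lp.coeFn_zero ℝ r μ] with x hx
    rw [ergodicSum, Finset.range_zero, Finset.sum_empty, hx, Pi.zero_apply]
  have hD : ∀ n : ℕ, ∃ D : Lp ℝ r μ, ∀ᵐ x ∂μ, D x = max (ergodicSum T f n x - n * c) 0 := by
    intro n
    have hm : MemLp (fun x => max (ergodicSum T f n x - n * c) 0) r μ := by
      refine (Lp.memLp (ergodicSum T f n)).mono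
        (((Lp.aestronglyMeasurable _).sub aestronglyMeasurable_const).sup
          aestronglyMeasurable_const) ?_
      filter_upwards [(Lp.coeFn_nonneg _).2 (hS0 n)] with x hx
      have hx' : 0 ≤ ergodicSum T f n x := hx
      rw [Real.norm_of_nonneg (le_max_right _ _), Real.norm_of_nonneg hx']
      exact max_le (by have : 0 ≤ n * c := by positivity
                       linarith) hx'
    exact ⟨hm.toLp _, hm.coeFn_toLp⟩
  choose D hD using hD
  have hD0 : ∀ n, 0 ≤ D n := fun n => by
    rw [← Lp.coeFn_nonneg]
    filter_upwards [hD n] with x hx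
    rw [hx]
    exact le_max_right _ _
  -- a maximum of finitely many functions in the lattice `L^r`; where positive, it is attained
  have hM : ∀ N : ℕ, ∃ M : Lp ℝ r μ, 0 ≤ M ∧ (∀ n ≤ N, D n ≤ M) ∧
      ∀ᵐ x ∂μ, 0 < M x → ∃ n ≤ N, M x = D n x := by
    intro N
    induction N with
    | zero =>
      refine ⟨D 0, hD0 0, fun n hn => by rw [Nat.le_zero.1 hn], Eventually.of_forall fun x _ =>
        ⟨0, le_rfl, rfl⟩⟩
    | succ N ih =>
      obtain ⟨M, hM0, hM1, hM2⟩ := ih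
      refine ⟨M ⊔ D (N + 1), hM0.trans le_sup_left, fun n hn => ?_, ?_⟩
      · rcases Nat.le_succ_iff.1 hn with h | h
        · exact (hM1 n h).trans le_sup_left
        · rw [h]; exact le_sup_right
      · filter_upwards [hM2, Lp.coeFn_sup M (D (N + 1))] with x h1 h2 h3
        rw [h2, Pi.sup_apply] at h3 ⊢
        rcases le_total (M x) (D (N + 1) x) with h | h
        · exact ⟨N + 1, le_rfl, sup_eq_right.2 h⟩
        · rw [sup_eq_left.2 h] at h3 ⊢
          obtain ⟨n, hn, e⟩ := h1 h3
          exact ⟨n, hn.trans (Nat.le_succ N), e⟩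
  obtain ⟨M, hM0, hM1, hM2⟩ := hM N
  have hDall : ∀ᵐ x ∂μ, ∀ n, D n x = max (ergodicSum T f n x - n * c) 0 := ae_all_iff.2 hD
  refine ⟨M, hM0, fun n hn => ?_, ?_, ?_⟩
  · filter_upwards [hD n, (Lp.coeFn_le _ _).2 (hM1 n hn)] with x h1 h2
    exact (le_max_left _ _).trans (h1.symm.le.trans h2)
  · filter_upwards [hM2, hDall, hz] with x h1 h2 h0 h3
    obtain ⟨n, hn, e⟩ := h1 h3
    rw [e, h2, lt_max_iff] at h3
    have h4 := h3.resolve_right (lt_irrefl _)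
    refine ⟨n, hn, Nat.one_le_iff_ne_zero.2 ?_, by linarith⟩
    rintro rfl
    simp [h0] at h4
  · -- `S_{n+1} f = f + T (S_n f)`, where `S_n f - D_n = min (S_n f, n c)` is mapped below `n c` by
    -- `hsub`, and `D_n ≤ M`
    have hstep : ∀ n, n + 1 ≤ N → ∀ᵐ x ∂μ, 0 < D (n + 1) x → D (n + 1) x ≤ f x - c + T M x := by
      intro n hn
      have hle : 0 ≤ ergodicSum T f n - D n := by
        rw [sub_nonneg, ← Lp.coeFn_le]
        filter_upwards [hD n, (Lp.coeFn_nonneg _).2 (hS0 n)] with x h1 h2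
        rw [h1]
        have : 0 ≤ n * c := by positivity
        exact max_le (by linarith) h2
      have hbd : ∀ᵐ x ∂μ, (ergodicSum T f n - D n) x ≤ n * c := by
        filter_upwards [hD n, Lp.coeFn_sub (ergodicSum T f n) (D n)] with x h1 h2
        rw [h2, Pi.sub_apply, h1]
        linarith [le_max_left (ergodicSum T f n x - n * c) 0]
      have h5 := hsub _ _ hle (by positivity) hbd
      have h6 : T (D n) ≤ T M := positive_mono hT (hM1 n (by omega))
      have h7 : ergodicSum T f (n + 1) = f + (T (ergodicSum T f n - D n) + T (D n)) := by
        rw [ergodicSum_succ, map_sub, sub_add_cancel]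
      filter_upwards [hD (n + 1), h5, (Lp.coeFn_le _ _).2 h6,
        Lp.coeFn_add f (T (ergodicSum T f n - D n) + T (D n)),
        Lp.coeFn_add (T (ergodicSum T f n - D n)) (T (D n))] with x e1 e2 e3 e4 e5 e6
      rw [e1] at e6 ⊢
      rw [lt_max_iff] at e6
      rw [max_eq_left (e6.resolve_right (lt_irrefl _)).le, h7, e4, Pi.add_apply, e5, Pi.add_apply]
      push_cast
      linarith
    have hall : ∀ᵐ x ∂μ, ∀ n, n + 1 ≤ N → 0 < D (n + 1) x → D (n + 1) x ≤ f x - c + T M x := by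
      rw [ae_all_iff]
      intro n
      by_cases hn : n + 1 ≤ N
      · filter_upwards [hstep n hn] with x hx _ using hx
      · exact Eventually.of_forall fun x h => absurd h hn
    filter_upwards [hM2, hall, hD 0, hz] with x h1 h2 h3 h4 h5
    obtain ⟨n, hn, e⟩ := h1 h5
    rw [e] at h5 ⊢
    cases n with
    | zero =>
      rw [h3] at h5
      simp [h4] at h5
    | succ n => exact h2 n hn h5

/-- Hopf's maximal ergodic inequality, by Garsia's argument: integrate `M ≤ f - c + T M` over
`{M > 0}`, a set of finite measure, and cancel `∫ M` against `∫ T M ≤ ∫ M`. The contractivity on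
`L^1` enters as the hypothesis `hL1`, as `T` acts on `L^r` only. -/
theorem hopf_maximal (hr : r ≠ ∞) (hT : ∀ f, 0 ≤ f → 0 ≤ T f)
    (hsub : ∀ (f : Lp ℝ r μ) (c : ℝ), 0 ≤ f → 0 ≤ c → (∀ᵐ x ∂μ, f x ≤ c) → ∀ᵐ x ∂μ, T f x ≤ c)
    (hL1 : ∀ f : Lp ℝ r μ, 0 ≤ f → Integrable f μ → ∀ E : Set Ω, MeasurableSet E → μ E ≠ ∞ →
      ∫ x in E, T f x ∂μ ≤ ∫ x, f x ∂μ)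
    {f : Lp ℝ r μ} (hf : 0 ≤ f) {c : ℝ} (hc : 0 < c) (N : ℕ) :
    ENNReal.ofReal c * μ {x | ∃ n ≤ N, 1 ≤ n ∧ n * c < ergodicSum T f n x}
      ≤ ∫⁻ x in {x | ∃ n ≤ N, 1 ≤ n ∧ n * c < ergodicSum T f n x}, ENNReal.ofReal (f x) ∂μ := by
  obtain ⟨M, hM0, hM1, hM2, hM3⟩ := exists_ergodic_majorant hT hsub hf hc N
  have h1r : 1 ≤ r := Fact.out
  have hr0 : r ≠ 0 := (zero_lt_one.trans_le h1r).ne'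
  have hM0' := (Lp.coeFn_nonneg _).2 hM0
  set E := {x | 0 < M x} with hE
  have hEm : MeasurableSet E := measurableSet_lt measurable_const (Lp.stronglyMeasurable M).measurable
  have hEeq : {x | ∃ n ≤ N, 1 ≤ n ∧ n * c < ergodicSum T f n x} =ᵐ[μ] E := by
    have hall : ∀ᵐ x ∂μ, ∀ n, n ≤ N → ergodicSum T f n x - n * c ≤ M x := by
      rw [ae_all_iff]
      intro n
      by_cases hn : n ≤ N
      · filter_upwards [hM1 n hn] with x hx _ using hx
      · exact Eventually.of_forall fun x h => absurd h hn
    filter_upwards [hM2, hall] with x h1 h2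
    refine propext ⟨?_, fun h => h1 h⟩
    rintro ⟨n, hn, _, h3⟩
    have h4 : 0 < M x := lt_of_lt_of_le (by linarith) (h2 n hn)
    exact h4
  have hμE : μ E ≠ ∞ := by
    have h1 := (Lp.memLp (f + T M)).meas_ge_lt_top hr0 hr (ε := c.toNNReal) (by simpa using hc)
    refine ((measure_mono_ae ?_).trans_lt h1).ne
    filter_upwards [hM3, Lp.coeFn_add f (T M)] with x h2 h3 h4
    have h4' : 0 < M x := h4
    have h5 := h2 h4'
    change c.toNNReal ≤ ‖(f + T M) x‖₊
    rw [← NNReal.coe_le_coe, Real.coe_toNNReal _ hc.le, coe_nnnorm, h3, Pi.add_apply]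
    exact le_trans (by linarith) (le_abs_self _)
  rw [measure_congr hEeq, setLIntegral_congr hEeq]
  have hint : ∀ g : Lp ℝ r μ, IntegrableOn g E μ := fun g =>
    integrableOn_Lp_of_measure_ne_top g h1r hμE
  have hzero : ∀ᵐ x ∂μ, x ∉ E → M x = 0 := by
    filter_upwards [hM0'] with x h1 h2
    exact le_antisymm (not_lt.1 h2) h1
  have hMi : Integrable M μ := by
    refine IntegrableOn.integrable_of_ae_notMem_eq_zero (hint M) hzero
  have h1 : ∫ x in E, M x ∂μ ≤ ∫ x in E, (f x - c + T M x) ∂μ := by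
    refine setIntegral_mono_on_ae (hint M) (((hint f).sub (integrableOn_const hμE)).add (hint _))
      hEm ?_
    filter_upwards [hM3] with x h1 h2 using h1 h2
  have h2 := hL1 M hM0 hMi E hEm hμE
  have h3 : ∫ x in E, M x ∂μ = ∫ x, M x ∂μ := setIntegral_eq_integral_of_ae_compl_eq_zero hzero
  have hic : IntegrableOn (fun _ : Ω => c) E μ := integrableOn_const hμE
  have h5 : ∫ x in E, (f x - c + T M x) ∂μ = ∫ x in E, (f x - c) ∂μ + ∫ x in E, T M x ∂μ :=
    integral_add ((hint f).sub hic) (hint _)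
  rw [h5, integral_sub (hint f) hic, setIntegral_const, smul_eq_mul] at h1
  have h4 : μ.real E * c ≤ ∫ x in E, f x ∂μ := by linarith
  rw [← ofReal_integral_eq_lintegral_ofReal (hint f)
    (ae_restrict_of_ae ((Lp.coeFn_nonneg _).2 hf)), mul_comm, ← ENNReal.ofReal_toReal hμE,
    ← ENNReal.ofReal_mul ENNReal.toReal_nonneg]
  exact ENNReal.ofReal_le_ofReal h4

/-- The maximal ergodic theorem in `L^r`, with a constant independent of the number of averages. -/
theorem lintegral_iSup_ergodicAverage_le (h1r : 1 < r) (hr : r ≠ ∞) (hT : ∀ f, 0 ≤ f → 0 ≤ T f)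
    (hsub : ∀ (f : Lp ℝ r μ) (c : ℝ), 0 ≤ f → 0 ≤ c → (∀ᵐ x ∂μ, f x ≤ c) → ∀ᵐ x ∂μ, T f x ≤ c)
    (hL1 : ∀ f : Lp ℝ r μ, 0 ≤ f → Integrable f μ → ∀ E : Set Ω, MeasurableSet E → μ E ≠ ∞ →
      ∫ x in E, T f x ∂μ ≤ ∫ x, f x ∂μ)
    {f : Lp ℝ r μ} (hf : 0 ≤ f) (N : ℕ) :
    ∃ Φ : Ω → ℝ, Measurable Φ ∧
      (∀ n ≤ N, ∀ x, ((n : ℝ) + 1)⁻¹ * ergodicSum T f (n + 1) x ≤ Φ x) ∧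
      ∫⁻ x, ENNReal.ofReal (Φ x) ^ r.toReal ∂μ
        ≤ ENNReal.ofReal (r.toReal / (r.toReal - 1)) ^ r.toReal
          * ∫⁻ x, ‖f x‖ₑ ^ r.toReal ∂μ := by
  have hr0 : r ≠ 0 := (zero_lt_one.trans h1r).ne'
  have hR : 1 < r.toReal := by
    rw [← ENNReal.toReal_one]
    exact (ENNReal.toReal_lt_toReal ENNReal.one_ne_top hr).2 h1r
  have hR0 : 0 < r.toReal := by linarith
  have hS0 := ergodicSum_nonneg hT hf
  set Φ : Ω → ℝ := fun x => (Finset.range (N + 1)).sup' Finset.nonempty_range_add_one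
    fun n => ((n : ℝ) + 1)⁻¹ * ergodicSum T f (n + 1) x with hΦ
  have hΦm : Measurable Φ := Finset.measurable_range_sup'' (n := N) fun n _ =>
    (Lp.stronglyMeasurable (ergodicSum T f (n + 1))).measurable.const_mul _
  have hle : ∀ n ≤ N, ∀ x, ((n : ℝ) + 1)⁻¹ * ergodicSum T f (n + 1) x ≤ Φ x := fun n hn x =>
    Finset.le_sup' (fun n : ℕ => ((n : ℝ) + 1)⁻¹ * ergodicSum T f (n + 1) x)
      (Finset.mem_range.2 (by omega))
  have hall : ∀ᵐ x ∂μ, ∀ n, 0 ≤ ergodicSum T f n x := by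
    rw [ae_all_iff]
    exact fun n => (Lp.coeFn_nonneg _).2 (hS0 n)
  have hΦ0 : 0 ≤ᵐ[μ] Φ := by
    filter_upwards [hall] with x hx
    refine le_trans ?_ (hle 0 (Nat.zero_le _) x)
    have := hx 1
    change 0 ≤ _
    positivity
  have hΦL : MemLp Φ r μ := by
    refine (memLp_finsetSum' (Finset.range (N + 1)) fun n _ =>
      (Lp.memLp (ergodicSum T f (n + 1)))).mono hΦm.aestronglyMeasurable ?_
    filter_upwards [hall, hΦ0] with x hx hx0
    rw [Real.norm_of_nonneg hx0, Finset.sum_apply, Real.norm_of_nonneg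
      (Finset.sum_nonneg fun n _ => hx _)]
    refine Finset.sup'_le _ _ fun n hn => ?_
    refine le_trans ?_ (Finset.single_le_sum (fun n _ => hx (n + 1)) hn)
    refine mul_le_of_le_one_left (hx _) (inv_le_one_of_one_le₀ ?_)
    linarith [(Nat.cast_nonneg n : (0 : ℝ) ≤ n)]
  have hconv : ∫⁻ x, ENNReal.ofReal (Φ x ^ r.toReal) ∂μ
      = ∫⁻ x, ENNReal.ofReal (Φ x) ^ r.toReal ∂μ := by
    refine lintegral_congr_ae ?_
    filter_upwards [hΦ0] with x hx
    rw [ENNReal.ofReal_rpow_of_nonneg hx hR0.le]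
  have hconv2 : ∫⁻ x, ENNReal.ofReal (Φ x) ^ r.toReal ∂μ = eLpNorm Φ r μ ^ r.toReal := by
    rw [← lintegral_enorm_rpow_eq hr0 hr]
    refine lintegral_congr_ae ?_
    filter_upwards [hΦ0] with x hx
    rw [Real.enorm_of_nonneg hx]
  have hf0 := (Lp.coeFn_nonneg _).2 hf
  have hmain := lintegral_rpow_le_of_weak_type hR (Lp.stronglyMeasurable f).measurable hΦm hΦ0
    (by rw [hconv, hconv2]; exact ENNReal.rpow_ne_top_of_nonneg hR0.le hΦL.2.ne) fun c hc => ?_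
  · refine ⟨Φ, hΦm, hle, ?_⟩
    rw [hconv] at hmain
    refine hmain.trans (le_of_eq ?_)
    congr 1
    refine lintegral_congr_ae ?_
    filter_upwards [hf0] with x hx
    rw [Real.enorm_of_nonneg hx]
  · have hset : {x | c < Φ x} = {x | ∃ n ≤ N + 1, 1 ≤ n ∧ n * c < ergodicSum T f n x} := by
      ext x
      simp only [Set.mem_ofPred_eq, hΦ, Finset.lt_sup'_iff, Finset.mem_range]
      constructor
      · rintro ⟨n, hn, h⟩
        refine ⟨n + 1, by omega, by omega, ?_⟩
        rw [inv_mul_eq_div, lt_div_iff₀ (by positivity)] at h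
        push_cast
        linarith
      · rintro ⟨n, hn, hn1, h⟩
        obtain ⟨m, rfl⟩ := Nat.exists_eq_add_of_le' hn1
        refine ⟨m, by omega, ?_⟩
        rw [inv_mul_eq_div, lt_div_iff₀ (by positivity)]
        push_cast at h
        linarith
    rw [hset]
    exact hopf_maximal hr hT hsub hL1 hf hc (N + 1)

end MaximalErgodic

/-! ### Mixed norms and norming functions -/

section MixedNorm

variable {Ω : Type*} [MeasurableSpace Ω] {μ : Measure Ω} {ι : Type*} [Fintype ι]

/-- The `P`-th power of the norm of `(F_i)` in `L^P(Ω; ℓ^q)`. -/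
def mixedPow {E : Type*} [NormedAddCommGroup E] (μ : Measure Ω) (q P : ℝ) (F : ι → Ω → E) : ℝ≥0∞ :=
  ∫⁻ x, (∑ i, ‖F i x‖ₑ ^ q) ^ (P / q) ∂μ

theorem mixedPow_mono {E E' : Type*} [NormedAddCommGroup E] [NormedAddCommGroup E'] {q P : ℝ}
    (hq : 0 ≤ q) (hP : 0 ≤ P) {F : ι → Ω → E} {G : ι → Ω → E'}
    (h : ∀ i, ∀ᵐ x ∂μ, ‖F i x‖ₑ ≤ ‖G i x‖ₑ) : mixedPow μ q P F ≤ mixedPow μ q P G := by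
  refine lintegral_mono_ae ?_
  filter_upwards [ae_all_iff.2 h] with x hx
  gcongr with i
  exact hx i

/-- The extremal case of Hölder's inequality in the mixed norm, pointwise: with `s = ∑ a_j^q` the
family `c_i = a_i^{q-1} s^{(P-q)/q}` pairs with `(a_i)` to `s^{P/q}`, and
`(∑ c_i^{q'})^{P'/q'} = s^{P/q}`. -/
theorem sum_rpow_norming {q q' P P' : ℝ} (hq : q.HolderConjugate q') (hP : P.HolderConjugate P')
    (a : ι → ℝ≥0) :
    ∑ i, (a i ^ (q - 1) * (∑ j, a j ^ q) ^ ((P - q) / q)) * a i = (∑ j, a j ^ q) ^ (P / q) ∧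
    (∑ i, (a i ^ (q - 1) * (∑ j, a j ^ q) ^ ((P - q) / q)) ^ q') ^ (P' / q')
      = (∑ j, a j ^ q) ^ (P / q) := by
  set s := ∑ j, a j ^ q with hs
  have hq0 := hq.pos
  have hq0' := hq.symm.pos
  have hP0 := hP.pos
  have hP0' := hP.symm.pos
  rcases eq_or_ne s 0 with h0 | h0
  · have ha : ∀ i, a i = 0 := by
      intro i
      have := (Finset.sum_eq_zero_iff.1 h0) i (Finset.mem_univ i)
      exact ((NNReal.rpow_eq_zero_iff).1 this).1
    have h1 : q - 1 ≠ 0 := hq.sub_one_ne_zero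
    have h2 : P / q ≠ 0 := by positivity
    have h3 : P' / q' ≠ 0 := by positivity
    simp [ha, h0, NNReal.zero_rpow h1, NNReal.zero_rpow h2, NNReal.zero_rpow h3,
      NNReal.zero_rpow hq0'.ne']
  · constructor
    · have h1 : ∀ i, a i ^ (q - 1) * s ^ ((P - q) / q) * a i = a i ^ q * s ^ ((P - q) / q) := by
        intro i
        have : a i ^ q = a i ^ (q - 1) * a i := by
          conv_rhs => rw [← NNReal.rpow_one (a i), ← NNReal.rpow_mul,
            ← NNReal.rpow_add_of_nonneg _ (by linarith [hq.lt]) one_pos.le]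
          congr 1
          ring
        rw [this]
        ring
      simp only [h1]
      rw [← Finset.sum_mul, ← hs]
      conv_lhs => rw [← NNReal.rpow_one s, ← NNReal.rpow_mul, ← NNReal.rpow_add h0]
      congr 1
      field_simp
      ring
    · have h1 : ∀ i, (a i ^ (q - 1) * s ^ ((P - q) / q)) ^ q' = a i ^ q * s ^ ((P - q) / q * q') := by
        intro i
        rw [NNReal.mul_rpow, ← NNReal.rpow_mul, ← NNReal.rpow_mul, hq.sub_one_mul_conj]
      simp only [h1]
      rw [← Finset.sum_mul, ← hs]
      conv_lhs => rw [← NNReal.rpow_one s, ← NNReal.rpow_mul, ← NNReal.rpow_add h0,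
        ← NNReal.rpow_mul]
      congr 1
      have e1 := hq.mul_eq_add
      have e2 := hP.mul_eq_add
      field_simp
      linear_combination (-P') * e1 + q' * e2

variable {B : Type*} [NormedAddCommGroup B] [NormedSpace ℝ B]
  {B' : Type*} [NormedAddCommGroup B'] [NormedSpace ℝ B']

/-- A measurable choice of functionals norming a vector-valued function up to a factor: use the
functional of the first point of a countable dense set that is close to the value. -/
theorem exists_norming_selection {β : B' →L[ℝ] B →L[ℝ] ℝ} (hβ : ‖β‖ ≤ 1)
    (hn : ∀ b, ∃ b', ‖b'‖ ≤ 1 ∧ ‖b‖ / 2 ≤ β b' b) {F : Ω → B} (hF : StronglyMeasurable F) :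
    ∃ ξ : Ω → B', StronglyMeasurable ξ ∧ (∀ x, ‖ξ x‖ ≤ 1) ∧ ∀ x, ‖F x‖ / 4 ≤ β (ξ x) (F x) := by
  classical
  choose φ hφ1 hφ using hn
  rcases isEmpty_or_nonempty Ω with hΩ | hΩ
  · exact ⟨fun _ => 0, stronglyMeasurable_const, fun x => isEmptyElim x, fun x => isEmptyElim x⟩
  obtain ⟨t, htc, htd⟩ := hF.isSeparable_range
  have htne : t.Nonempty := by
    obtain ⟨x⟩ := hΩ
    have : (closure t).Nonempty := ⟨F x, htd (Set.mem_range_self x)⟩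
    exact closure_nonempty_iff.1 this
  obtain ⟨d, hd⟩ := htc.exists_eq_range htne
  have hex : ∀ x, ∃ n, ‖F x‖ = 0 ∨ ‖F x - d n‖ < ‖F x‖ / 8 := by
    intro x
    by_cases h0 : ‖F x‖ = 0
    · exact ⟨0, Or.inl h0⟩
    · have hpos : 0 < ‖F x‖ / 8 := by positivity
      obtain ⟨b, hb, hlt⟩ := Metric.mem_closure_iff.1 (htd (Set.mem_range_self x)) _ hpos
      rw [hd] at hb
      obtain ⟨n, rfl⟩ := hb
      rw [dist_eq_norm] at hlt
      exact ⟨n, Or.inr hlt⟩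
  have hm : Measurable fun x => Nat.find (hex x) := by
    refine measurable_find hex fun k => ?_
    refine MeasurableSet.union (measurableSet_eq_fun hF.norm.measurable measurable_const) ?_
    exact measurableSet_lt (hF.sub stronglyMeasurable_const).norm.measurable
      (hF.norm.measurable.div_const 8)
  refine ⟨fun x => φ (d (Nat.find (hex x))),
    (StronglyMeasurable.of_discrete (f := fun n => φ (d n))).comp_measurable hm,
    fun x => hφ1 _, fun x => ?_⟩
  have hbd : ∀ b' : B', ‖b'‖ ≤ 1 → ∀ b, |β b' b| ≤ ‖b‖ := by
    intro b' hb' b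
    have h1 := β.le_opNorm₂ b' b
    rw [Real.norm_eq_abs] at h1
    refine h1.trans (mul_le_of_le_one_left (norm_nonneg _) ?_)
    exact mul_le_one₀ hβ (norm_nonneg _) hb'
  simp only
  rcases Nat.find_spec (hex x) with h | h
  · have := hbd _ (hφ1 (d (Nat.find (hex x)))) (F x)
    rw [abs_le] at this
    linarith [this.1]
  · set n := Nat.find (hex x)
    have h1 := hφ (d n)
    have h2 := hbd _ (hφ1 (d n)) (F x - d n)
    rw [map_sub, abs_le] at h2
    have h3 := norm_sub_norm_le (F x) (d n)
    linarith [h2.1]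

variable {p p' : ℝ≥0∞}

omit [NormedSpace ℝ B] in
theorem mixedPow_ne_top (h0 : p ≠ 0) (hp : p ≠ ∞) {q : ℝ} (hq : 0 < q) (F : ι → Lp B p μ) :
    mixedPow μ q p.toReal (fun i => F i) ≠ ∞ := by
  have hP := ENNReal.toReal_pos h0 hp
  have hS : MemLp (fun x => ∑ i, ‖F i x‖) p μ := memLp_finsetSum _ fun i _ => (Lp.memLp (F i)).norm
  have hle : mixedPow μ q p.toReal (fun i => F i)
      ≤ ∫⁻ x, (Fintype.card ι : ℝ≥0∞) ^ (p.toReal / q) * ‖∑ i, ‖F i x‖‖ₑ ^ p.toReal ∂μ := by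
    refine lintegral_mono fun x => ?_
    have h1 : ∀ i, ‖F i x‖ₑ ≤ ‖∑ i, ‖F i x‖‖ₑ := by
      intro i
      rw [enorm_le_iff_norm_le, Real.norm_of_nonneg (Finset.sum_nonneg fun _ _ => norm_nonneg _)]
      exact Finset.single_le_sum (f := fun i => ‖F i x‖) (fun _ _ => norm_nonneg _)
        (Finset.mem_univ i)
    calc (∑ i, ‖F i x‖ₑ ^ q) ^ (p.toReal / q)
        ≤ (∑ _i : ι, ‖∑ i, ‖F i x‖‖ₑ ^ q) ^ (p.toReal / q) := by
          gcongr with i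
          exact h1 i
      _ = _ := by
          rw [Finset.sum_const, nsmul_eq_mul, Finset.card_univ,
            ENNReal.mul_rpow_of_nonneg _ _ (by positivity), ← ENNReal.rpow_mul]
          congr 2
          field_simp
  refine ne_top_of_le_ne_top ?_ hle
  rw [lintegral_const_mul' _ _ (ENNReal.rpow_ne_top_of_nonneg (by positivity)
    (ENNReal.natCast_ne_top _)), lintegral_enorm_rpow_eq h0 hp]
  exact ENNReal.mul_ne_top (ENNReal.rpow_ne_top_of_nonneg (by positivity)
    (ENNReal.natCast_ne_top _)) (ENNReal.rpow_ne_top_of_nonneg hP.le hS.2.ne)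

variable [Fact (1 ≤ p)] [Fact (1 ≤ p')]

omit [NormedSpace ℝ B] [Fact (1 ≤ p)] in
theorem aemeasurable_enorm_Lp (f : Lp B p μ) : AEMeasurable (fun x => ‖f x‖ₑ) μ :=
  (Lp.aestronglyMeasurable f).enorm

omit [NormedSpace ℝ B] [Fact (1 ≤ p)] in
theorem aemeasurable_sum_rpow (a b : ℝ) (F : ι → Lp B p μ) :
    AEMeasurable (fun x => (∑ i, ‖F i x‖ₑ ^ a) ^ b) μ :=
  (Finset.aemeasurable_fun_sum _ fun i _ =>
    (aemeasurable_enorm_Lp (F i)).pow_const a).pow_const b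

theorem enorm_lpPairing_le_lintegral [ENNReal.HolderConjugate p' p] {β : B' →L[ℝ] B →L[ℝ] ℝ}
    (hβ : ‖β‖ ≤ 1) (g : Lp B' p' μ) (f : Lp B p μ) :
    ‖β.lpPairing μ p' p g f‖ₑ ≤ ∫⁻ x, ‖g x‖ₑ * ‖f x‖ₑ ∂μ := by
  rw [ContinuousLinearMap.lpPairing_eq_integral]
  refine (enorm_integral_le_lintegral_enorm _).trans (lintegral_mono fun x => ?_)
  refine (β.le_opENorm₂ _ _).trans ?_
  have hβ' : ‖β‖ₑ ≤ 1 := by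
    rw [← ofReal_norm]
    exact ENNReal.ofReal_le_one.2 hβ
  calc ‖β‖ₑ * ‖g x‖ₑ * ‖f x‖ₑ ≤ 1 * ‖g x‖ₑ * ‖f x‖ₑ := by gcongr
    _ = _ := by rw [one_mul]

/-- Hölder's inequality for the pairing of mixed norms. -/
theorem sum_lpPairing_le [ENNReal.HolderConjugate p' p] {β : B' →L[ℝ] B →L[ℝ] ℝ} (hβ : ‖β‖ ≤ 1)
    {q q' : ℝ} (hq : q.HolderConjugate q') (hP : p.toReal.HolderConjugate p'.toReal)
    (h : ι → Lp B' p' μ) (F : ι → Lp B p μ) :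
    ENNReal.ofReal (∑ i, β.lpPairing μ p' p (h i) (F i))
      ≤ mixedPow μ q' p'.toReal (fun i => h i) ^ (1 / p'.toReal)
        * mixedPow μ q p.toReal (fun i => F i) ^ (1 / p.toReal) := by
  have h1 : ∀ i, ENNReal.ofReal (β.lpPairing μ p' p (h i) (F i))
      ≤ ∫⁻ x, ‖h i x‖ₑ * ‖F i x‖ₑ ∂μ := fun i => by
    refine (ENNReal.ofReal_le_ofReal (le_abs_self _)).trans ?_
    rw [← Real.enorm_eq_ofReal_abs]
    exact enorm_lpPairing_le_lintegral hβ _ _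
  have h2 : ENNReal.ofReal (∑ i, β.lpPairing μ p' p (h i) (F i))
      ≤ ∑ i, ENNReal.ofReal (β.lpPairing μ p' p (h i) (F i)) := by
    classical
    induction (Finset.univ : Finset ι) using Finset.induction_on with
    | empty => simp
    | insert i s hi ih =>
      rw [Finset.sum_insert hi, Finset.sum_insert hi]
      exact ENNReal.ofReal_add_le.trans (by gcongr)
  have hm : ∀ i, AEMeasurable (fun x => ‖h i x‖ₑ * ‖F i x‖ₑ) μ := fun i =>
    (aemeasurable_enorm_Lp _).mul (aemeasurable_enorm_Lp _)
  calc ENNReal.ofReal (∑ i, β.lpPairing μ p' p (h i) (F i))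
      ≤ ∑ i, ∫⁻ x, ‖h i x‖ₑ * ‖F i x‖ₑ ∂μ := h2.trans (Finset.sum_le_sum fun i _ => h1 i)
    _ = ∫⁻ x, ∑ i, ‖h i x‖ₑ * ‖F i x‖ₑ ∂μ := (lintegral_finsetSum' _ fun i _ => hm i).symm
    _ ≤ ∫⁻ x, (∑ i, ‖h i x‖ₑ ^ q') ^ (1 / q') * (∑ i, ‖F i x‖ₑ ^ q) ^ (1 / q) ∂μ :=
        lintegral_mono fun x => ENNReal.inner_le_Lp_mul_Lq _ _ _ hq.symm
    _ ≤ (∫⁻ x, ((∑ i, ‖h i x‖ₑ ^ q') ^ (1 / q')) ^ p'.toReal ∂μ) ^ (1 / p'.toReal)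
        * (∫⁻ x, ((∑ i, ‖F i x‖ₑ ^ q) ^ (1 / q)) ^ p.toReal ∂μ) ^ (1 / p.toReal) :=
        ENNReal.lintegral_mul_le_Lp_mul_Lq μ hP.symm (aemeasurable_sum_rpow _ _ _)
          (aemeasurable_sum_rpow _ _ _)
    _ = _ := by
        simp only [← ENNReal.rpow_mul, one_div_mul_eq_div]
        rfl

/-- Every finite family in `L^p(Ω; B)` is normed, in `L^p(Ω; ℓ^q_B)` and up to a factor, by a
family in `L^{p'}(Ω; B')`. -/
theorem exists_norming_family [ENNReal.HolderConjugate p' p] (hp : p ≠ ∞) (hp' : p' ≠ ∞)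
    {β : B' →L[ℝ] B →L[ℝ] ℝ} (hβ : ‖β‖ ≤ 1) (hn : ∀ b, ∃ b', ‖b'‖ ≤ 1 ∧ ‖b‖ / 2 ≤ β b' b)
    {q q' : ℝ} (hq : q.HolderConjugate q') (hP : p.toReal.HolderConjugate p'.toReal)
    (F : ι → Lp B p μ) :
    ∃ h : ι → Lp B' p' μ, mixedPow μ q' p'.toReal (fun i => h i) ≤ mixedPow μ q p.toReal (fun i => F i)
      ∧ mixedPow μ q p.toReal (fun i => F i)
        ≤ 4 * ENNReal.ofReal (∑ i, β.lpPairing μ p' p (h i) (F i)) := by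
  have h1p : 1 ≤ p := Fact.out
  have h1p' : 1 ≤ p' := Fact.out
  have hp0 : p ≠ 0 := (zero_lt_one.trans_le h1p).ne'
  have hp0' : p' ≠ 0 := (zero_lt_one.trans_le h1p').ne'
  have hfin := mixedPow_ne_top hp0 hp hq.pos F
  choose ξ hξm hξ1 hξ using fun i => exists_norming_selection hβ hn (Lp.stronglyMeasurable (F i))
  -- `h_i = c_i ξ_i`, with `c_i` the extremal family of `sum_rpow_norming` and `ξ_i` norming `F_i`
  set c : ι → Ω → ℝ≥0 := fun i x =>
    ‖F i x‖₊ ^ (q - 1) * (∑ j, ‖F j x‖₊ ^ q) ^ ((p.toReal - q) / q) with hc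
  have hcm : ∀ i, Measurable (c i) := by
    intro i
    have hF : ∀ j, Measurable fun x => ‖F j x‖₊ := fun j =>
      (Lp.stronglyMeasurable (F j)).nnnorm.measurable
    exact ((hF i).pow_const _).mul
      ((Finset.measurable_fun_sum _ fun j _ => (hF j).pow_const q).pow_const _)
  have hptw : ∀ x, ((∑ i, (c i x : ℝ≥0∞) ^ q') ^ (p'.toReal / q')
      = (∑ i, ‖F i x‖ₑ ^ q) ^ (p.toReal / q)) ∧
      ∑ i, (c i x : ℝ) * ‖F i x‖ = (((∑ i, ‖F i x‖₊ ^ q) ^ (p.toReal / q) : ℝ≥0) : ℝ) := by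
    intro x
    obtain ⟨h1, h2⟩ := sum_rpow_norming hq hP fun i => ‖F i x‖₊
    constructor
    · have := congrArg (fun y : ℝ≥0 => (y : ℝ≥0∞)) h2
      have e1 := hq.nonneg
      have e2 := hq.symm.nonneg
      have e3 := hP.nonneg
      have e4 := hP.symm.nonneg
      rw [ENNReal.coe_rpow_of_nonneg _ (by positivity), ENNReal.coe_rpow_of_nonneg _ (by positivity),
        ENNReal.ofNNReal_finsetSum, ENNReal.ofNNReal_finsetSum] at this
      simp only [ENNReal.coe_rpow_of_nonneg _ e1, ENNReal.coe_rpow_of_nonneg _ e2] at this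
      exact this
    · rw [← h1, NNReal.coe_sum]
      exact Finset.sum_congr rfl fun i _ => (NNReal.coe_mul (c i x) ‖F i x‖₊).symm
  set H : ι → Ω → B' := fun i x => (c i x : ℝ) • ξ i x with hH
  have hHm : ∀ i, StronglyMeasurable (H i) := fun i =>
    (hcm i).coe_nnreal_real.stronglyMeasurable.smul (hξm i)
  have hHc : ∀ i x, ‖H i x‖ₑ ≤ c i x := by
    intro i x
    rw [hH]
    simp only
    rw [enorm_smul]
    have h1 : ‖(c i x : ℝ)‖ₑ = c i x := by
      rw [Real.enorm_of_nonneg (c i x).coe_nonneg]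
      exact ENNReal.ofReal_coe_nnreal
    have h2 : ‖ξ i x‖ₑ ≤ 1 := by
      rw [← ofReal_norm]
      exact ENNReal.ofReal_le_one.2 (hξ1 i x)
    rw [h1]
    exact mul_le_of_le_one_right zero_le h2
  have hle : mixedPow μ q' p'.toReal H ≤ mixedPow μ q p.toReal (fun i => F i) := by
    refine lintegral_mono fun x => ?_
    rw [← (hptw x).1]
    have e2 := hq.symm.nonneg
    have e4 := hP.symm.nonneg
    gcongr with i
    exact hHc i x
  have hHL : ∀ i, MemLp (H i) p' μ := by
    intro i
    refine ⟨(hHm i).aestronglyMeasurable, ?_⟩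
    have h1 : eLpNorm (H i) p' μ ^ p'.toReal ≤ mixedPow μ q' p'.toReal H := by
      rw [← lintegral_enorm_rpow_eq hp0' hp']
      refine lintegral_mono fun x => ?_
      have e2 := hq.symm.pos
      have e4 := hP.symm.nonneg
      calc ‖H i x‖ₑ ^ p'.toReal = (‖H i x‖ₑ ^ q') ^ (p'.toReal / q') := by
            rw [← ENNReal.rpow_mul]
            congr 1
            field_simp
        _ ≤ _ := by
            gcongr
            exact Finset.single_le_sum (f := fun i => ‖H i x‖ₑ ^ q') (fun _ _ => zero_le)
              (Finset.mem_univ i)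
    have h2 : eLpNorm (H i) p' μ ^ p'.toReal ≠ ∞ :=
      ne_top_of_le_ne_top hfin (h1.trans hle)
    by_contra h3
    rw [not_lt, top_le_iff] at h3
    exact h2 (by rw [h3, ENNReal.top_rpow_of_pos hP.symm.pos])
  have hco : ∀ i, ((hHL i).toLp (H i) : Ω → B') =ᵐ[μ] H i := fun i => (hHL i).coeFn_toLp
  refine ⟨fun i => (hHL i).toLp (H i), ?_, ?_⟩
  · refine (mixedPow_mono hq.symm.nonneg hP.symm.nonneg fun i => ?_).trans hle
    filter_upwards [hco i] with x hx
    rw [hx]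
  · have hint : ∀ i, Integrable (fun x => β (H i x) (F i x)) μ := fun i =>
      memLp_one_iff_integrable.1 (β.memLp_of_bilin 1 (hHL i) (Lp.memLp (F i)))
    have hpair : ∑ i, β.lpPairing μ p' p ((hHL i).toLp (H i)) (F i)
        = ∫ x, ∑ i, β (H i x) (F i x) ∂μ := by
      rw [integral_finsetSum _ fun i _ => hint i]
      refine Finset.sum_congr rfl fun i _ => ?_
      rw [ContinuousLinearMap.lpPairing_eq_integral]
      refine integral_congr_ae ?_
      filter_upwards [hco i] with x hx
      rw [hx]
    have hlow : ∀ x, (((∑ i, ‖F i x‖₊ ^ q) ^ (p.toReal / q) : ℝ≥0) : ℝ)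
        ≤ 4 * ∑ i, β (H i x) (F i x) := by
      intro x
      rw [← (hptw x).2, Finset.mul_sum]
      refine Finset.sum_le_sum fun i _ => ?_
      have h1 := hξ i x
      have h2 : β (H i x) (F i x) = c i x * β (ξ i x) (F i x) := by
        rw [hH]
        simp
      rw [h2]
      have h3 := mul_le_mul_of_nonneg_left h1 (c i x).coe_nonneg
      linarith
    rw [hpair, ofReal_integral_eq_lintegral_ofReal (integrable_finsetSum _ fun i _ => hint i)
      (Eventually.of_forall fun x => ?_), ← lintegral_const_mul' _ _ (by norm_num)]
    · refine lintegral_mono fun x => ?_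
      have h1 := ENNReal.ofReal_le_ofReal (hlow x)
      rw [ENNReal.ofReal_coe_nnreal, ENNReal.ofReal_mul (by norm_num)] at h1
      have e1 := hq.nonneg
      have e3 := hP.nonneg
      rw [ENNReal.coe_rpow_of_nonneg _ (by positivity), ENNReal.ofNNReal_finsetSum] at h1
      simp only [ENNReal.coe_rpow_of_nonneg _ e1] at h1
      have h4 : (4 : ℝ≥0∞) = ENNReal.ofReal 4 := by simp
      rw [h4]
      exact h1
    · have h1 := hlow x
      have h2 : (0 : ℝ) ≤ (((∑ i, ‖F i x‖₊ ^ q) ^ (p.toReal / q) : ℝ≥0) : ℝ) := NNReal.coe_nonneg _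
      change 0 ≤ ∑ i, β (H i x) (F i x)
      linarith

end MixedNorm

/-! ### Domination, Harnack's inequality and the maximal function -/

section LpOrderLemmas

variable {Ω : Type*} [MeasurableSpace Ω] {μ : Measure Ω} {p : ℝ≥0∞}

theorem ae_enorm_le_of_le {f g : Lp ℝ p μ} (hf : 0 ≤ f) (hfg : f ≤ g) :
    ∀ᵐ x ∂μ, ‖f x‖ₑ ≤ ‖g x‖ₑ := by
  filter_upwards [(Lp.coeFn_nonneg _).2 hf, (Lp.coeFn_le _ _).2 hfg] with x h1 h2
  have h1' : 0 ≤ f x := h1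
  rw [Real.enorm_of_nonneg h1', Real.enorm_of_nonneg (h1'.trans h2)]
  exact ENNReal.ofReal_le_ofReal h2

theorem ae_enorm_normLp {B : Type*} [NormedAddCommGroup B] (f : Lp B p μ) :
    ∀ᵐ x ∂μ, ‖normLp f x‖ₑ = ‖f x‖ₑ := by
  filter_upwards [coeFn_normLp f] with x hx
  rw [hx, enorm_norm]

theorem exists_holderConjugate (h1p : 1 < p) (hp : p ≠ ∞) :
    ∃ p' : ℝ≥0∞, 1 < p' ∧ p' ≠ ∞ ∧ p'.HolderConjugate p := by
  have h : p.HolderConjugate (ENNReal.conjExponent p) := ENNReal.HolderConjugate.conjExponent h1p.le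
  refine ⟨ENNReal.conjExponent p, ?_, ?_, h.symm⟩
  · exact (ENNReal.HolderConjugate.lt_top_iff_one_lt p _).1 (lt_top_iff_ne_top.2 hp)
  · exact (ENNReal.HolderConjugate.ne_top_iff_ne_one _ p).2 h1p.ne'

theorem toReal_holderConjugate {p' : ℝ≥0∞} [h : ENNReal.HolderConjugate p' p] (hp : p ≠ ∞)
    (hp' : p' ≠ ∞) : p.toReal.HolderConjugate p'.toReal :=
  (ENNReal.HolderConjugate.toReal_of_ne_top hp' hp).symm

end LpOrderLemmas

/-- The kernel of `t² ∂_t² P_t` is dominated by that of `P_{t/2}`: with `y = t² v` the claim reads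
`|4 y² - 6 y| ≤ 15 e^{3 y / 4}`. -/
theorem abs_subordKernelDeriv2_le {t : ℝ} (ht : 0 < t) {v : ℝ} (hv : 0 < v) :
    |t ^ 2 * subordKernelDeriv2 t v| ≤ 30 * subordKernel (t / 2) v := by
  set y := t ^ 2 * v with hy
  have hy0 : 0 < y := by positivity
  have hsv : 0 < √v := Real.sqrt_pos.2 hv
  have hsp : 0 < (√Real.pi)⁻¹ := by positivity
  have e1 : t ^ 2 * subordKernelDeriv2 t v
      = ((√Real.pi)⁻¹ * (t / √v) * Real.exp (-y)) * (4 * y ^ 2 - 6 * y) := by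
    simp only [subordKernelDeriv2, laplaceKernel, hy]
    ring
  have e2 : 30 * subordKernel (t / 2) v
      = ((√Real.pi)⁻¹ * (t / √v) * Real.exp (-y)) * (15 * Real.exp (3 * y / 4)) := by
    have : Real.exp (-((t / 2) ^ 2 * v)) = Real.exp (-y) * Real.exp (3 * y / 4) := by
      rw [← Real.exp_add, hy]; congr 1; ring
    rw [subordKernel, this]
    ring
  rw [e1, e2, abs_mul, abs_of_pos (by positivity)]
  refine mul_le_mul_of_nonneg_left ?_ (by positivity)
  have h := Real.quadratic_le_exp_of_nonneg (x := 3 * y / 4) (by positivity)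
  rw [abs_le]
  constructor <;> nlinarith

theorem subordKernel_harnack {s t : ℝ} (hs : 0 < s) (hst : s ≤ t) {v : ℝ} (hv : 0 < v) :
    subordKernel t v ≤ t / s * subordKernel s v := by
  have ht : 0 < t := hs.trans_le hst
  have e : t / s * subordKernel s v = (√Real.pi)⁻¹ * (t * (Real.exp (-(s ^ 2 * v)) / √v)) := by
    rw [subordKernel]
    field_simp
  rw [e, subordKernel]
  gcongr

namespace SymmetricDiffusionSemigroup

variable {Ω : Type*} [MeasurableSpace Ω] {μ : Measure Ω} (S : SymmetricDiffusionSemigroup μ)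
  {p : ℝ≥0∞} [Fact (1 ≤ p)]

theorem poisson_real (hp : p ≠ ∞) (t : ℝ) (f : Lp ℝ p μ) :
    S.poisson t f = subordinate (fun s => S.T s p) t f := by
  simp only [poisson, S.bochnerT_real hp]

theorem poisson_nonneg (h1p : 1 < p) (hp : p ≠ ∞) {t : ℝ} (ht : 0 < t) {f : Lp ℝ p μ}
    (hf : 0 ≤ f) : 0 ≤ S.poisson t f := by
  rw [S.poisson_real hp]
  exact S.subordinate_nonneg h1p hp ht hf

theorem poisson_mono (h1p : 1 < p) (hp : p ≠ ∞) {t : ℝ} (ht : 0 < t) {f g : Lp ℝ p μ}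
    (hfg : f ≤ g) : S.poisson t f ≤ S.poisson t g := by
  rw [S.poisson_real hp, S.poisson_real hp]
  exact S.subordinate_mono h1p hp ht hfg

theorem poisson_le_const (h1p : 1 < p) (hp : p ≠ ∞) {t : ℝ} (ht : 0 < t) {f : Lp ℝ p μ}
    (hf : 0 ≤ f) {c : ℝ} (hc : 0 ≤ c) (hfc : ∀ᵐ x ∂μ, f x ≤ c) : ∀ᵐ x ∂μ, S.poisson t f x ≤ c := by
  rw [S.poisson_real hp]
  exact S.subordinate_le_const h1p hp ht hf hc hfc

theorem poisson_consistent {r : ℝ≥0∞} [Fact (1 ≤ r)] (h1p : 1 < p) (hp : p ≠ ∞) (h1r : 1 < r)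
    (hr : r ≠ ∞) {t : ℝ} (ht : 0 < t) {f : Lp ℝ p μ} {g : Lp ℝ r μ} (hfg : (f : Ω → ℝ) =ᵐ[μ] g) :
    S.poisson t f =ᵐ[μ] S.poisson t g := by
  rw [S.poisson_real hp, S.poisson_real hr]
  exact S.subordinate_consistent h1p hp h1r hr ht hfg

/-- Harnack's inequality: `t ↦ P_t f / t` decreases for `f ≥ 0`. -/
theorem poisson_harnack (h1p : 1 < p) (hp : p ≠ ∞) {s t : ℝ} (hs : 0 < s) (hst : s ≤ t)
    {f : Lp ℝ p μ} (hf : 0 ≤ f) : S.poisson t f ≤ (t / s) • S.poisson s f := by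
  rw [S.poisson_real hp, S.poisson_real hp, subordinate_eq_kernelOp hs,
    subordinate_eq_kernelOp (hs.trans_le hst), ← IsContractionSemigroup.kernelOp_const_mul]
  exact S.kernelOp_mono_kernel h1p hp (integrableOn_subordKernel (hs.trans_le hst))
    ((integrableOn_subordKernel hs).const_mul _) (fun v hv => subordKernel_harnack hs hst hv) hf

section Bochner

variable {B : Type*} [NormedAddCommGroup B] [NormedSpace ℝ B] [CompleteSpace B]

/-- The Poisson operator `P_t` on `L^p_B(Ω)` as a bounded operator. -/
def poissonCLM (B : Type*) [NormedAddCommGroup B] [NormedSpace ℝ B] [CompleteSpace B]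
    (h1p : 1 < p) (hp : p ≠ ∞) {t : ℝ} (ht : 0 < t) : Lp B p μ →L[ℝ] Lp B p μ :=
  (S.isContractionSemigroup_bochnerT h1p hp).subordCLM ht

theorem poissonCLM_apply (h1p : 1 < p) (hp : p ≠ ∞) {t : ℝ} (ht : 0 < t) (f : Lp B p μ) :
    S.poissonCLM B h1p hp ht f = S.poisson t f :=
  (S.isContractionSemigroup_bochnerT h1p hp).subordCLM_apply ht f

theorem norm_poisson_le (h1p : 1 < p) (hp : p ≠ ∞) {t : ℝ} (ht : 0 < t) (f : Lp B p μ) :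
    ‖S.poisson t f‖ ≤ ‖f‖ :=
  (S.isContractionSemigroup_bochnerT h1p hp).norm_subordinate_le ht f

theorem normLp_poisson_le (h1p : 1 < p) (hp : p ≠ ∞) {t : ℝ} (ht : 0 < t) (f : Lp B p μ) :
    normLp (S.poisson t f) ≤ S.poisson t (normLp f) := by
  rw [S.poisson_real hp, poisson, subordinate_eq_kernelOp ht, subordinate_eq_kernelOp ht]
  exact S.normLp_kernelOp_le h1p hp (integrableOn_subordKernel ht) (integrableOn_subordKernel ht)
    (fun v _ => (abs_of_nonneg (subordKernel_nonneg ht.le v)).le) f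

theorem normLp_subordDeriv2_le (h1p : 1 < p) (hp : p ≠ ∞) {t : ℝ} (ht : 0 < t) (f : Lp B p μ) :
    normLp (t ^ 2 • subordDeriv2 (fun s => S.bochnerT s) t f)
      ≤ (30 : ℝ) • S.poisson (t / 2) (normLp f) := by
  rw [S.poisson_real hp, subordinate_eq_kernelOp (half_pos ht), subordDeriv2,
    ← IsContractionSemigroup.kernelOp_const_mul, ← IsContractionSemigroup.kernelOp_const_mul]
  exact S.normLp_kernelOp_le h1p hp ((integrableOn_subordKernelDeriv2 ht).const_mul _)
    ((integrableOn_subordKernel (half_pos ht)).const_mul _)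
    (fun v hv => abs_subordKernelDeriv2_le ht hv) f

end Bochner

/-- Symmetry of `P_t`, for nonnegative functions and with values in `[0, ∞]`. -/
theorem lintegral_poisson_mul {p' : ℝ≥0∞} [Fact (1 ≤ p')] [ENNReal.HolderConjugate p' p]
    (h1p : 1 < p) (hp : p ≠ ∞) (h1p' : 1 < p') (hp' : p' ≠ ∞) {t : ℝ} (ht : 0 < t)
    {u : Lp ℝ p' μ} {w : Lp ℝ p μ} (hu : 0 ≤ u) (hw : 0 ≤ w) :
    ∫⁻ x, ‖S.poisson t u x‖ₑ * ‖w x‖ₑ ∂μ = ∫⁻ x, ‖u x‖ₑ * ‖S.poisson t w x‖ₑ ∂μ := by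
  have key : ∀ {u : Lp ℝ p' μ} {w : Lp ℝ p μ}, 0 ≤ u → 0 ≤ w →
      ∫⁻ x, ‖u x‖ₑ * ‖w x‖ₑ ∂μ
        = ENNReal.ofReal ((ContinuousLinearMap.mul ℝ ℝ).lpPairing μ p' p u w) := by
    intro u w hu hw
    rw [ContinuousLinearMap.lpPairing_eq_integral, ofReal_integral_eq_lintegral_ofReal]
    · refine lintegral_congr_ae ?_
      filter_upwards [(Lp.coeFn_nonneg _).2 hu, (Lp.coeFn_nonneg _).2 hw] with x h1 h2
      rw [Real.enorm_of_nonneg h1, Real.enorm_of_nonneg h2, ← ENNReal.ofReal_mul h1]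
      rfl
    · exact memLp_one_iff_integrable.1 ((ContinuousLinearMap.mul ℝ ℝ).memLp_of_bilin 1
        (Lp.memLp u) (Lp.memLp w))
    · filter_upwards [(Lp.coeFn_nonneg _).2 hu, (Lp.coeFn_nonneg _).2 hw] with x h1 h2
      exact mul_nonneg h1 h2
  rw [key (S.poisson_nonneg h1p' hp' ht hu) hw, key hu (S.poisson_nonneg h1p hp ht hw),
    S.lpPairing_poisson h1p hp h1p' hp' _ ht]

/-- Contractivity of `P_t` on `L^1`, by duality with `P_t 1_E ≤ 1`. -/
theorem setIntegral_poisson_le (h1p : 1 < p) (hp : p ≠ ∞) {t : ℝ} (ht : 0 < t) {f : Lp ℝ p μ}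
    (hf : 0 ≤ f) (hfi : Integrable f μ) {E : Set Ω} (hE : MeasurableSet E) (hμE : μ E ≠ ∞) :
    ∫ x in E, S.poisson t f x ∂μ ≤ ∫ x, f x ∂μ := by
  obtain ⟨p', h1p', hp', hconj⟩ := exists_holderConjugate h1p hp
  have : Fact (1 ≤ p') := ⟨h1p'.le⟩
  have hf0 := (Lp.coeFn_nonneg _).2 hf
  have hP0 := (Lp.coeFn_nonneg _).2 (S.poisson_nonneg h1p hp ht hf)
  have hind : (0 : Lp ℝ p' μ) ≤ indicatorConstLp p' hE hμE (1 : ℝ) := by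
    rw [← Lp.coeFn_nonneg]
    filter_upwards [indicatorConstLp_coeFn (p := p') (hs := hE) (hμs := hμE) (c := (1 : ℝ))]
      with x hx
    rw [hx]
    exact Set.indicator_nonneg (fun _ _ => zero_le_one) _
  have hle1 : ∀ᵐ x ∂μ, indicatorConstLp p' hE hμE (1 : ℝ) x ≤ 1 := by
    filter_upwards [indicatorConstLp_coeFn (p := p') (hs := hE) (hμs := hμE) (c := (1 : ℝ))]
      with x hx
    rw [hx]
    exact Set.indicator_le_self' (fun _ _ => zero_le_one) x
  have h1 : ∫⁻ x in E, ‖S.poisson t f x‖ₑ ∂μ ≤ ∫⁻ x, ‖f x‖ₑ ∂μ := by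
    calc ∫⁻ x in E, ‖S.poisson t f x‖ₑ ∂μ
        = ∫⁻ x, ‖indicatorConstLp p' hE hμE (1 : ℝ) x‖ₑ * ‖S.poisson t f x‖ₑ ∂μ := by
          rw [← lintegral_indicator hE]
          refine lintegral_congr_ae ?_
          filter_upwards [indicatorConstLp_coeFn (p := p') (hs := hE) (hμs := hμE) (c := (1 : ℝ))]
            with x hx
          rw [hx]
          by_cases hxE : x ∈ E <;> simp [hxE]
      _ = ∫⁻ x, ‖S.poisson t (indicatorConstLp p' hE hμE (1 : ℝ)) x‖ₑ * ‖f x‖ₑ ∂μ :=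
          (S.lintegral_poisson_mul h1p hp h1p' hp' ht hind hf).symm
      _ ≤ ∫⁻ x, ‖f x‖ₑ ∂μ := by
          refine lintegral_mono_ae ?_
          filter_upwards [S.poisson_le_const h1p' hp' ht hind zero_le_one hle1,
            (Lp.coeFn_nonneg _).2 (S.poisson_nonneg h1p' hp' ht hind)] with x hx hx0
          refine mul_le_of_le_one_left zero_le ?_
          rw [Real.enorm_of_nonneg hx0]
          exact ENNReal.ofReal_le_one.2 hx
  have h2 : ∫⁻ x, ‖f x‖ₑ ∂μ = ENNReal.ofReal (∫ x, f x ∂μ) := by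
    rw [ofReal_integral_eq_lintegral_ofReal hfi hf0]
    refine lintegral_congr_ae ?_
    filter_upwards [hf0] with x hx
    rw [Real.enorm_of_nonneg hx]
  have h3 : ∫⁻ x in E, ‖S.poisson t f x‖ₑ ∂μ = ENNReal.ofReal (∫ x in E, S.poisson t f x ∂μ) := by
    rw [ofReal_integral_eq_lintegral_ofReal (integrableOn_Lp_of_measure_ne_top _ h1p.le hμE)
      (ae_restrict_of_ae hP0)]
    refine lintegral_congr_ae (ae_restrict_of_ae ?_)
    filter_upwards [hP0] with x hx
    rw [Real.enorm_of_nonneg hx]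
  rw [h2, h3] at h1
  exact (ENNReal.ofReal_le_ofReal_iff (integral_nonneg_of_ae hf0)).1 h1

/-- The maximal theorem for finite sets of times. By Harnack's inequality `P_t f` is at most
four times an ergodic average of the powers of `P_δ`, for `δ ≤ t`. -/
theorem exists_maximal_const (h1p : 1 < p) (hp : p ≠ ∞) :
    ∃ C : ℝ≥0∞, C ≠ ∞ ∧ ∀ (ι : Type) [Fintype ι] (t : ι → ℝ), (∀ i, 0 < t i) →
      ∀ f : Lp ℝ p μ, 0 ≤ f → ∃ Φ : Ω → ℝ≥0∞, Measurable Φ ∧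
        (∀ i, ∀ᵐ x ∂μ, ‖S.poisson (t i) f x‖ₑ ≤ Φ x) ∧
        ∫⁻ x, Φ x ^ p.toReal ∂μ ≤ C * ∫⁻ x, ‖f x‖ₑ ^ p.toReal ∂μ := by
  have hP : 0 < p.toReal := ENNReal.toReal_pos (zero_lt_one.trans h1p).ne' hp
  refine ⟨4 ^ p.toReal * ENNReal.ofReal (p.toReal / (p.toReal - 1)) ^ p.toReal,
    ENNReal.mul_ne_top (ENNReal.rpow_ne_top_of_nonneg hP.le (by norm_num))
      (ENNReal.rpow_ne_top_of_nonneg hP.le ENNReal.ofReal_ne_top), fun ι _ t ht f hf => ?_⟩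
  obtain ⟨δ, hδ0, hδ⟩ : ∃ δ : ℝ, 0 < δ ∧ ∀ i, δ ≤ t i := by
    rcases isEmpty_or_nonempty ι with hι | hι
    · exact ⟨1, one_pos, fun i => isEmptyElim i⟩
    · obtain ⟨i, hi⟩ := Finite.exists_min t
      exact ⟨t i, ht i, hi⟩
  have hT := S.isContractionSemigroup_bochnerT (B := ℝ) h1p hp
  set T := S.poissonCLM ℝ h1p hp hδ0 with hTdef
  have hTa : ∀ f, T f = S.poisson δ f := S.poissonCLM_apply h1p hp hδ0
  have hT0 : ∀ f, 0 ≤ f → 0 ≤ T f := fun f hf => by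
    rw [hTa]; exact S.poisson_nonneg h1p hp hδ0 hf
  have hpow : ∀ k : ℕ, ∀ f : Lp ℝ p μ, (T ^ (k + 1)) f = S.poisson ((k + 1 : ℕ) * δ) f := by
    intro k
    induction k with
    | zero => intro f; simp [hTa]
    | succ k ih =>
      intro f
      rw [pow_succ']
      change T ((T ^ (k + 1)) f) = _
      rw [ih, hTa]
      have := hT.subordinate_add hδ0 (t := (k + 1 : ℕ) * δ) (by positivity) f
      have e : ((k + 1 + 1 : ℕ) : ℝ) * δ = δ + (k + 1 : ℕ) * δ := by push_cast; ring
      rw [e]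
      exact this.symm
  set n : ι → ℕ := fun i => ⌊t i / δ⌋₊ with hn
  obtain ⟨N, hN⟩ : ∃ N, ∀ i, n i ≤ N :=
    ⟨Finset.univ.sup n, fun i => Finset.le_sup (Finset.mem_univ i)⟩
  obtain ⟨Φ, hΦm, hΦle, hΦ⟩ := lintegral_iSup_ergodicAverage_le h1p hp hT0
    (fun f c hf hc hfc => by rw [hTa]; exact S.poisson_le_const h1p hp hδ0 hf hc hfc)
    (fun f hf hfi E hE hμE => by rw [hTa]; exact S.setIntegral_poisson_le h1p hp hδ0 hf hfi hE hμE)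
    hf N
  refine ⟨fun x => 4 * ENNReal.ofReal (Φ x), hΦm.ennreal_ofReal.const_mul 4, fun i => ?_, ?_⟩
  · have hn1 : 1 ≤ n i := Nat.le_floor (by rw [Nat.cast_one, le_div_iff₀ hδ0]; linarith [hδ i])
    have hn1' : (1 : ℝ) ≤ n i := by exact_mod_cast hn1
    have hle1 : n i * δ ≤ t i := by
      rw [← le_div_iff₀ hδ0]; exact Nat.floor_le (div_nonneg (ht i).le hδ0.le)
    have hle2 : t i ≤ (n i + 1) * δ := by
      rw [← div_le_iff₀ hδ0]; exact (Nat.lt_floor_add_one _).le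
    -- each of the summands `k ≤ n` is at least `k δ / t` times `P_t f`
    have hterm : ∀ k ∈ Finset.range (n i + 1), (k * δ / t i) • S.poisson (t i) f ≤ (T ^ k) f := by
      intro k hk
      cases k with
      | zero => simpa using hf
      | succ k =>
        have hk' : ((k + 1 : ℕ) : ℝ) ≤ n i := by
          exact_mod_cast Nat.lt_succ_iff.1 (Finset.mem_range.1 hk)
        have hkpos : (0 : ℝ) < (k + 1 : ℕ) * δ := by positivity
        have h := S.poisson_harnack h1p hp hkpos
          ((mul_le_mul_of_nonneg_right hk' hδ0.le).trans hle1) hf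
        have h2 := smul_le_smul_of_nonneg_left h (div_nonneg hkpos.le (ht i).le)
        rw [smul_smul, div_mul_div_cancel₀ (ht i).ne', div_self hkpos.ne', one_smul] at h2
        rw [hpow]
        exact h2
    have hsum : (∑ k ∈ Finset.range (n i + 1), (k * δ / t i)) • S.poisson (t i) f
        ≤ ergodicSum T f (n i + 1) := by
      rw [Finset.sum_smul]
      exact Finset.sum_le_sum hterm
    have hcoef : (n i : ℝ) / 2 ≤ ∑ k ∈ Finset.range (n i + 1), (k * δ / t i) := by
      have e : ∑ k ∈ Finset.range (n i + 1), ((k : ℝ) * δ / t i) = (n i * (n i + 1) / 2) * δ / t i := by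
        rw [← Finset.sum_div, ← Finset.sum_mul]
        congr 2
        have h := Finset.sum_range_id_mul_two (n i + 1)
        rw [Nat.add_sub_cancel] at h
        have h' := congrArg (Nat.cast : ℕ → ℝ) h
        push_cast at h'
        linarith
      rw [e, le_div_iff₀ (ht i)]
      nlinarith
    have hP0 := S.poisson_nonneg h1p hp (ht i) hf
    filter_upwards [(Lp.coeFn_le _ _).2 hsum, (Lp.coeFn_nonneg _).2 hP0,
      Lp.coeFn_smul (∑ k ∈ Finset.range (n i + 1), (k * δ / t i)) (S.poisson (t i) f)]
      with x h1 h2 h3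
    have h2' : 0 ≤ S.poisson (t i) f x := h2
    rw [h3, Pi.smul_apply, smul_eq_mul] at h1
    have h4 := hΦle (n i) (hN i) x
    rw [Real.enorm_of_nonneg h2']
    have h5 : (4 : ℝ≥0∞) = ENNReal.ofReal 4 := by simp
    rw [h5, ← ENNReal.ofReal_mul (by norm_num)]
    refine ENNReal.ofReal_le_ofReal ?_
    rw [inv_mul_eq_div, div_le_iff₀ (by positivity)] at h4
    have h6 := mul_le_mul_of_nonneg_right hcoef h2'
    have h7 : 0 ≤ Φ x := by
      by_contra h8
      nlinarith
    nlinarith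
  · calc ∫⁻ x, (4 * ENNReal.ofReal (Φ x)) ^ p.toReal ∂μ
        = 4 ^ p.toReal * ∫⁻ x, ENNReal.ofReal (Φ x) ^ p.toReal ∂μ := by
          rw [← lintegral_const_mul _ (hΦm.ennreal_ofReal.pow_const _)]
          refine lintegral_congr fun x => ?_
          rw [ENNReal.mul_rpow_of_nonneg _ _ hP.le]
      _ ≤ _ := by
          rw [mul_assoc]
          gcongr

end SymmetricDiffusionSemigroup

/-! ### Jensen's inequality and Stein's inequality -/

namespace SymmetricDiffusionSemigroup

variable {Ω : Type*} [MeasurableSpace Ω] {μ : Measure Ω} (S : SymmetricDiffusionSemigroup μ)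
  {p : ℝ≥0∞} [Fact (1 ≤ p)]

/-- Jensen's inequality `(P_t h)^q ≤ P_t (h^q)`, from the tangents `q a^{q-1} h ≤ h^q + (q-1) a^q`.
As constants need not be integrable, `q a^{q-1} h` is split into its minimum with `h^q`, which
lies in both spaces, and a remainder bounded by `(q-1) a^q`. -/
theorem poisson_rpow_le {r : ℝ≥0∞} [Fact (1 ≤ r)] (h1p : 1 < p) (hp : p ≠ ∞) (h1r : 1 < r)
    (hr : r ≠ ∞) {q : ℝ} (hq : 1 < q) {t : ℝ} (ht : 0 < t) {h : Lp ℝ p μ} (hh : 0 ≤ h)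
    {w : Lp ℝ r μ} (hw : ∀ᵐ x ∂μ, w x = h x ^ q) :
    ∀ᵐ x ∂μ, S.poisson t h x ^ q ≤ S.poisson t w x := by
  have hh0 := (Lp.coeFn_nonneg _).2 hh
  have hq0 : 0 < q := by linarith
  have htan : ∀ a : ℝ, 0 ≤ a → ∀ᵐ x ∂μ,
      q * a ^ (q - 1) * S.poisson t h x ≤ (q - 1) * a ^ q + S.poisson t w x := by
    intro a ha
    set c := q * a ^ (q - 1) with hc
    have hc0 : 0 ≤ c := by positivity
    have htan0 : ∀ y : ℝ, 0 ≤ y → c * y ≤ y ^ q + (q - 1) * a ^ q := by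
      intro y hy
      have hY := Real.young_inequality_of_nonneg hy (Real.rpow_nonneg ha (q - 1))
        (Real.HolderConjugate.conjExponent hq)
      have e1 : (a ^ (q - 1)) ^ (Real.conjExponent q) = a ^ q := by
        rw [← Real.rpow_mul ha, (Real.HolderConjugate.conjExponent hq).sub_one_mul_conj]
      rw [e1, Real.conjExponent] at hY
      have e2 : q * (y ^ q / q + a ^ q / (q / (q - 1))) = y ^ q + (q - 1) * a ^ q := by
        have : q - 1 ≠ 0 := by linarith
        field_simp
      have := mul_le_mul_of_nonneg_left hY hq0.le
      rw [e2] at this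
      calc c * y = q * (y * a ^ (q - 1)) := by rw [hc]; ring
        _ ≤ _ := this
    -- the part below the graph of `y ↦ y^q`
    have hm0 : ∀ᵐ x ∂μ, 0 ≤ min (h x ^ q) (c * h x) := by
      filter_upwards [hh0] with x hx
      have hx' : 0 ≤ h x := hx
      exact le_min (by positivity) (by positivity)
    have hmm : AEStronglyMeasurable (fun x => min (h x ^ q) (c * h x)) μ := by
      have := (Lp.stronglyMeasurable h).measurable
      exact ((this.pow_const q).min (this.const_mul c)).aestronglyMeasurable
    have hmp : MemLp (fun x => min (h x ^ q) (c * h x)) p μ := by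
      refine ((Lp.memLp h).const_mul c).mono hmm ?_
      filter_upwards [hm0, hh0] with x h1 h2
      have h2' : 0 ≤ h x := h2
      rw [Real.norm_of_nonneg h1, Real.norm_of_nonneg (by positivity)]
      exact min_le_right _ _
    have hmr : MemLp (fun x => min (h x ^ q) (c * h x)) r μ := by
      refine (Lp.memLp w).mono hmm ?_
      filter_upwards [hm0, hh0, hw] with x h1 h2 h3
      have h2' : 0 ≤ h x := h2
      rw [h3, Real.norm_of_nonneg h1, Real.norm_of_nonneg (by positivity)]
      exact min_le_left _ _
    have hcons : S.poisson t (hmp.toLp _) =ᵐ[μ] S.poisson t (hmr.toLp _) :=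
      S.poisson_consistent h1p hp h1r hr ht (hmp.coeFn_toLp.trans hmr.coeFn_toLp.symm)
    have hle : S.poisson t (hmr.toLp _) ≤ S.poisson t w := by
      refine S.poisson_mono h1r hr ht ?_
      rw [← Lp.coeFn_le]
      filter_upwards [hmr.coeFn_toLp, hw] with x h1 h2
      rw [h1, h2]
      exact min_le_left _ _
    have hu : ∀ᵐ x ∂μ, (c • h - hmp.toLp _ : Lp ℝ p μ) x = c * h x - min (h x ^ q) (c * h x) := by
      filter_upwards [Lp.coeFn_sub (c • h) (hmp.toLp _), Lp.coeFn_smul c h, hmp.coeFn_toLp]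
        with x h1 h2 h3
      rw [h1, Pi.sub_apply, h2, h3, Pi.smul_apply, smul_eq_mul]
    have hu0 : 0 ≤ c • h - hmp.toLp _ := by
      rw [← Lp.coeFn_nonneg]
      filter_upwards [hu] with x h1
      rw [h1]
      exact sub_nonneg.2 (min_le_right _ _)
    have huc : ∀ᵐ x ∂μ, (c • h - hmp.toLp _ : Lp ℝ p μ) x ≤ (q - 1) * a ^ q := by
      filter_upwards [hu, hh0] with x h1 h2
      rw [h1]
      have h3 := htan0 _ h2
      have hnn : 0 ≤ (q - 1) * a ^ q := mul_nonneg (by linarith) (by positivity)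
      rcases le_total (h x ^ q) (c * h x) with h4 | h4
      · rw [min_eq_left h4]; linarith
      · rw [min_eq_right h4]; linarith
    have hP := S.poisson_le_const h1p hp ht hu0
      (mul_nonneg (by linarith) (by positivity) : 0 ≤ (q - 1) * a ^ q) huc
    have hlin : S.poisson t (c • h - hmp.toLp _) = c • S.poisson t h - S.poisson t (hmp.toLp _) := by
      simp only [← S.poissonCLM_apply h1p hp ht, map_sub, map_smul]
    rw [hlin] at hP
    filter_upwards [hP, hcons, (Lp.coeFn_le _ _).2 hle,
      Lp.coeFn_sub (c • S.poisson t h) (S.poisson t (hmp.toLp _)),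
      Lp.coeFn_smul c (S.poisson t h)] with x h1 h2 h3 h4 h5
    rw [h4, Pi.sub_apply, h5, Pi.smul_apply, smul_eq_mul, h2] at h1
    linarith
  have hall : ∀ᵐ x ∂μ, ∀ a : ℚ, 0 ≤ (a : ℝ) →
      q * (a : ℝ) ^ (q - 1) * S.poisson t h x ≤ (q - 1) * (a : ℝ) ^ q + S.poisson t w x := by
    rw [ae_all_iff]
    intro a
    by_cases ha : 0 ≤ (a : ℝ)
    · filter_upwards [htan a ha] with x hx _ using hx
    · exact Eventually.of_forall fun x h => absurd h ha
  filter_upwards [hall, (Lp.coeFn_nonneg _).2 (S.poisson_nonneg h1p hp ht hh)] with x hx hx0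
  set y := S.poisson t h x with hy
  have hy0 : 0 ≤ y := hx0
  -- the tangent at the point `y` itself, as a limit of rational ones
  have hcl : q * y ^ (q - 1) * y ≤ (q - 1) * y ^ q + S.poisson t w x := by
    obtain ⟨u, hu, hul⟩ : ∃ u : ℕ → ℚ, (∀ n, 0 ≤ (u n : ℝ)) ∧
        Tendsto (fun n => (u n : ℝ)) atTop (𝓝 y) := by
      obtain ⟨u, _, hu2, hu3⟩ := Real.exists_seq_rat_strictAnti_tendsto y
      exact ⟨u, fun n => hy0.trans (hu2 n).le, hu3⟩
    refine le_of_tendsto_of_tendsto' (((hul.rpow_const (Or.inr (by linarith))).const_mul q).mul_const y)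
      (((hul.rpow_const (Or.inr hq0.le)).const_mul (q - 1)).add_const _) fun n => hx (u n) (hu n)
  have e : y ^ (q - 1) * y = y ^ q := by
    rcases hy0.eq_or_lt with h0 | h0
    · rw [← h0, Real.zero_rpow hq0.ne', mul_zero]
    · rw [Real.rpow_sub_one h0.ne']
      field_simp
  rw [mul_assoc, e] at hcl
  linarith

omit [Fact (1 ≤ p)] in
theorem memLp_rpow {P q : ℝ} (hq : 0 < q) (hP : p.toReal = P) (hp : p ≠ ∞) (f : Lp ℝ p μ) :
    MemLp (fun x => |f x| ^ q) (ENNReal.ofReal (P / q)) μ := by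
  have := (Lp.memLp f).norm_rpow_div (ENNReal.ofReal q)
  rw [ENNReal.toReal_ofReal hq.le] at this
  rw [ENNReal.ofReal_div_of_pos hq, ← hP, ENNReal.ofReal_toReal hp]
  exact this

/-- Stein's inequality in `L^p(ℓ^q)`, `q < p`: by Jensen's inequality and duality it follows
from the maximal theorem on the dual of `L^{p/q}`. -/
theorem exists_stein_const_of_lt (h1p : 1 < p) (hp : p ≠ ∞) {q : ℝ} (hq : 1 < q)
    (hqp : q < p.toReal) :
    ∃ C : ℝ≥0∞, C ≠ ∞ ∧ ∀ (ι : Type) [Fintype ι] (t : ι → ℝ), (∀ i, 0 < t i) →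
      ∀ h : ι → Lp ℝ p μ, (∀ i, 0 ≤ h i) →
        mixedPow μ q p.toReal (fun i => S.poisson (t i) (h i))
          ≤ C * mixedPow μ q p.toReal (fun i => h i) := by
  have hq0 : 0 < q := by linarith
  set P := p.toReal with hPdef
  set R := P / q with hR
  have hR1 : 1 < R := by rw [hR, lt_div_iff₀ hq0]; linarith
  have hR0 : 0 < R := by linarith
  set r := ENNReal.ofReal R with hr
  have h1r : 1 < r := by rw [hr]; exact ENNReal.one_lt_ofReal.2 hR1
  have hrt : r ≠ ∞ := ENNReal.ofReal_ne_top
  have hrR : r.toReal = R := ENNReal.toReal_ofReal hR0.le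
  obtain ⟨r', h1r', hrt', hconj⟩ := exists_holderConjugate h1r hrt
  have : Fact (1 ≤ r) := ⟨h1r.le⟩
  have : Fact (1 ≤ r') := ⟨h1r'.le⟩
  have hRR := toReal_holderConjugate (p' := r') hrt hrt'
  rw [hrR] at hRR
  set R' := r'.toReal with hR'
  have hrr' : ENNReal.ofReal (R / (R - 1)) = r' := by
    rw [← hRR.conjugate_eq, hR', ENNReal.ofReal_toReal hrt']
  obtain ⟨C, hC, hmax⟩ := S.exists_maximal_const h1r' hrt'
  refine ⟨(C ^ (1 / R')) ^ R, ENNReal.rpow_ne_top_of_nonneg hR0.le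
    (ENNReal.rpow_ne_top_of_nonneg (by positivity) hC), fun ι _ t ht h hh => ?_⟩
  set y : ι → Lp ℝ p μ := fun i => S.poisson (t i) (h i) with hy
  have hy0 : ∀ i, 0 ≤ y i := fun i => S.poisson_nonneg h1p hp (ht i) (hh i)
  -- `φ = (∑ y_i^q)^{R-1}` is the function in the dual of `L^R` that norms `∑ y_i^q`
  have hG : MemLp (fun x => ∑ i, |y i x| ^ q) r μ :=
    memLp_finsetSum _ fun i _ => memLp_rpow hq0 rfl hp (y i)
  set G := hG.toLp _ with hGdef
  have hGx : ∀ᵐ x ∂μ, ‖G x‖ₑ = ∑ i, ‖y i x‖ₑ ^ q := by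
    filter_upwards [hG.coeFn_toLp] with x hx
    rw [hx, Real.enorm_of_nonneg (Finset.sum_nonneg fun i _ => by positivity),
      ENNReal.ofReal_sum_of_nonneg (fun i _ => by positivity)]
    refine Finset.sum_congr rfl fun i _ => ?_
    rw [← ENNReal.ofReal_rpow_of_nonneg (abs_nonneg _) hq0.le, Real.enorm_eq_ofReal_abs]
  have hφ : MemLp (fun x => |G x| ^ (R - 1)) r' μ := by
    have := memLp_rpow (sub_pos.2 hR1) hrR hrt G
    rwa [hrr'] at this
  set φ := hφ.toLp _ with hφdef
  have hφ0 : 0 ≤ φ := by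
    rw [← Lp.coeFn_nonneg]
    filter_upwards [hφ.coeFn_toLp] with x hx
    rw [hx]
    change 0 ≤ |G x| ^ (R - 1)
    positivity
  have hφx : ∀ᵐ x ∂μ, ‖φ x‖ₑ = ‖G x‖ₑ ^ (R - 1) := by
    filter_upwards [hφ.coeFn_toLp] with x hx
    rw [hx, Real.enorm_of_nonneg (by positivity),
      ← ENNReal.ofReal_rpow_of_nonneg (abs_nonneg _) (by linarith), Real.enorm_eq_ofReal_abs]
  obtain ⟨Φ, hΦm, hΦle, hΦ⟩ := hmax ι t ht φ hφ0
  set A := mixedPow μ q P (fun i => y i) with hA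
  have hAG : A = ∫⁻ x, ‖G x‖ₑ ^ R ∂μ := by
    refine lintegral_congr_ae ?_
    filter_upwards [hGx] with x hx
    rw [hx]
  have hφA : ∫⁻ x, ‖φ x‖ₑ ^ R' ∂μ = A := by
    rw [hAG]
    refine lintegral_congr_ae ?_
    filter_upwards [hφx] with x hx
    rw [hx, ← ENNReal.rpow_mul, hRR.sub_one_mul_conj]
  have hAfin : A ≠ ∞ := mixedPow_ne_top (zero_lt_one.trans h1p).ne' hp hq0 y
  have hw : ∀ i, MemLp (fun x => |h i x| ^ q) r μ := fun i => memLp_rpow hq0 rfl hp (h i)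
  have hwx : ∀ i, ∀ᵐ x ∂μ, (hw i).toLp _ x = h i x ^ q := fun i => by
    filter_upwards [(hw i).coeFn_toLp, (Lp.coeFn_nonneg _).2 (hh i)] with x h1 h2
    rw [h1, abs_of_nonneg h2]
  have hw0 : ∀ i, 0 ≤ (hw i).toLp _ := fun i => by
    rw [← Lp.coeFn_nonneg]
    filter_upwards [(hw i).coeFn_toLp] with x h1
    rw [h1]
    change 0 ≤ |h i x| ^ q
    positivity
  have hwe : ∀ i, ∀ᵐ x ∂μ, ‖(hw i).toLp _ x‖ₑ = ‖h i x‖ₑ ^ q := fun i => by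
    filter_upwards [(hw i).coeFn_toLp] with x h1
    rw [h1, Real.enorm_of_nonneg (by positivity),
      ← ENNReal.ofReal_rpow_of_nonneg (abs_nonneg _) hq0.le, Real.enorm_eq_ofReal_abs]
  have hterm : ∀ i, ∫⁻ x, ‖y i x‖ₑ ^ q * ‖φ x‖ₑ ∂μ ≤ ∫⁻ x, ‖h i x‖ₑ ^ q * Φ x ∂μ := by
    intro i
    calc ∫⁻ x, ‖y i x‖ₑ ^ q * ‖φ x‖ₑ ∂μ
        ≤ ∫⁻ x, ‖φ x‖ₑ * ‖S.poisson (t i) ((hw i).toLp _) x‖ₑ ∂μ := by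
          refine lintegral_mono_ae ?_
          filter_upwards [S.poisson_rpow_le h1p hp h1r hrt hq (ht i) (hh i) (hwx i),
            (Lp.coeFn_nonneg _).2 (hy0 i)] with x h1 h2
          have h2' : 0 ≤ y i x := h2
          rw [mul_comm]
          gcongr
          rw [Real.enorm_of_nonneg h2', ENNReal.ofReal_rpow_of_nonneg h2' hq0.le,
            Real.enorm_eq_ofReal_abs]
          exact ENNReal.ofReal_le_ofReal (h1.trans (le_abs_self _))
      _ = ∫⁻ x, ‖S.poisson (t i) φ x‖ₑ * ‖(hw i).toLp _ x‖ₑ ∂μ :=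
          (S.lintegral_poisson_mul h1r hrt h1r' hrt' (ht i) hφ0 (hw0 i)).symm
      _ ≤ _ := by
          refine lintegral_mono_ae ?_
          filter_upwards [hΦle i, hwe i] with x h1 h2
          rw [h2, mul_comm]
          gcongr
  -- the power of `A` on the right is absorbed afterwards, as `A < ∞` for a finite family
  have hmain : A ≤ (C ^ (1 / R') * mixedPow μ q P (fun i => h i) ^ (1 / R)) * A ^ (1 / R') := by
    calc A = ∫⁻ x, ∑ i, ‖y i x‖ₑ ^ q * ‖φ x‖ₑ ∂μ := by
          rw [hAG]
          refine lintegral_congr_ae ?_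
          filter_upwards [hGx, hφx] with x h1 h2
          rw [← Finset.sum_mul, ← h1, h2]
          conv_rhs => rw [← ENNReal.rpow_one ‖G x‖ₑ, ← ENNReal.rpow_mul,
            ← ENNReal.rpow_add_of_nonneg _ _ one_pos.le (by linarith)]
          congr 1
          ring
      _ = ∑ i, ∫⁻ x, ‖y i x‖ₑ ^ q * ‖φ x‖ₑ ∂μ := lintegral_finsetSum' _ fun i _ =>
          ((aemeasurable_enorm_Lp _).pow_const q).mul (aemeasurable_enorm_Lp _)
      _ ≤ ∑ i, ∫⁻ x, ‖h i x‖ₑ ^ q * Φ x ∂μ := Finset.sum_le_sum fun i _ => hterm i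
      _ = ∫⁻ x, (∑ i, ‖h i x‖ₑ ^ q) * Φ x ∂μ := by
          simp only [Finset.sum_mul]
          exact (lintegral_finsetSum' _ fun i _ =>
            ((aemeasurable_enorm_Lp (h i)).pow_const q).mul hΦm.aemeasurable).symm
      _ ≤ (∫⁻ x, (∑ i, ‖h i x‖ₑ ^ q) ^ R ∂μ) ^ (1 / R) * (∫⁻ x, Φ x ^ R' ∂μ) ^ (1 / R') :=
          ENNReal.lintegral_mul_le_Lp_mul_Lq μ hRR (Finset.aemeasurable_fun_sum _ fun i _ =>
            (aemeasurable_enorm_Lp (h i)).pow_const q) hΦm.aemeasurable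
      _ ≤ mixedPow μ q P (fun i => h i) ^ (1 / R) * (C * A) ^ (1 / R') := by
          rw [hφA] at hΦ
          gcongr
          exact le_rfl
      _ = _ := by
          rw [ENNReal.mul_rpow_of_nonneg _ _ hRR.symm.one_div_nonneg]
          ring
  have h5 := rpow_one_sub_le_of_le_mul_rpow hAfin
    (by rw [div_lt_one hRR.symm.pos]; exact hRR.symm.lt) hmain
  have e3 : 1 - 1 / R' = R⁻¹ := by rw [one_div]; exact hRR.symm.one_sub_inv
  rw [e3, ENNReal.rpow_inv_le_iff hR0, ENNReal.mul_rpow_of_nonneg _ _ hR0.le,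
    ← ENNReal.rpow_mul (mixedPow _ _ _ _), one_div_mul_cancel hR0.ne', ENNReal.rpow_one] at h5
  exact h5

/-- Stein's inequality `‖(∑ |P_{t_i} h_i|^q)^{1/q}‖_p ≤ C ‖(∑ |h_i|^q)^{1/q}‖_p`. -/
theorem exists_stein_const (h1p : 1 < p) (hp : p ≠ ∞) {q : ℝ} (hq : 1 < q) :
    ∃ C : ℝ≥0∞, C ≠ ∞ ∧ ∀ (ι : Type) [Fintype ι] (t : ι → ℝ), (∀ i, 0 < t i) →
      ∀ h : ι → Lp ℝ p μ, (∀ i, 0 ≤ h i) →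
        mixedPow μ q p.toReal (fun i => S.poisson (t i) (h i))
          ≤ C * mixedPow μ q p.toReal (fun i => h i) := by
  have hp0 : p ≠ 0 := (zero_lt_one.trans h1p).ne'
  rcases lt_trichotomy q p.toReal with hlt | heq | hgt
  · exact S.exists_stein_const_of_lt h1p hp hq hlt
  · refine ⟨1, ENNReal.one_ne_top, fun ι _ t ht h hh => ?_⟩
    have hq0 : q ≠ 0 := by linarith
    have e : ∀ f : ι → Lp ℝ p μ, mixedPow μ q p.toReal (fun i => f i)
        = ∑ i, ‖f i‖ₑ ^ p.toReal := by
      intro f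
      simp only [mixedPow, ← heq, div_self hq0, ENNReal.rpow_one]
      rw [lintegral_finsetSum' _ fun i _ => (aemeasurable_enorm_Lp (f i)).pow_const q]
      refine Finset.sum_congr rfl fun i _ => ?_
      rw [heq, lintegral_enorm_rpow_eq hp0 hp, Lp.enorm_def]
    rw [e, e, one_mul]
    gcongr with i
    rw [enorm_le_iff_norm_le]
    exact S.norm_poisson_le h1p hp (ht i) (h i)
  · -- by duality, from the case of the conjugate exponents
    obtain ⟨p', h1p', hp', hconj⟩ := exists_holderConjugate h1p hp
    have : Fact (1 ≤ p') := ⟨h1p'.le⟩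
    have hPP := toReal_holderConjugate (p' := p') hp hp'
    have hqq := Real.HolderConjugate.conjExponent hq
    set q' := Real.conjExponent q with hq'
    have hlt' : q' < p'.toReal := by
      have h1 := hPP.inv_add_inv_eq_one
      have h2 := hqq.inv_add_inv_eq_one
      have h3 : q⁻¹ < p.toReal⁻¹ := inv_strictAnti₀ hPP.pos hgt
      have h4 : p'.toReal⁻¹ < q'⁻¹ := by linarith
      exact (inv_lt_inv₀ hPP.symm.pos hqq.symm.pos).1 h4
    obtain ⟨C, hC, hst⟩ := S.exists_stein_const_of_lt h1p' hp' hqq.symm.lt hlt'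
    have hP0 := hPP.pos
    refine ⟨(4 * C ^ (1 / p'.toReal)) ^ p.toReal, ENNReal.rpow_ne_top_of_nonneg hP0.le
      (ENNReal.mul_ne_top (by norm_num) (ENNReal.rpow_ne_top_of_nonneg
        hPP.symm.one_div_nonneg hC)), fun ι _ t ht h hh => ?_⟩
    set y : ι → Lp ℝ p μ := fun i => S.poisson (t i) (h i) with hy
    have hβ : ‖ContinuousLinearMap.mul ℝ ℝ‖ ≤ 1 := ContinuousLinearMap.opNorm_mul_le ℝ ℝ
    obtain ⟨k, hk1, hk2⟩ := exists_norming_family (p := p) (p' := p') hp hp' hβ (fun b => by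
      refine ⟨SignType.sign b, ?_, ?_⟩
      · rcases lt_trichotomy b 0 with h | h | h <;> simp [h]
      · rw [ContinuousLinearMap.mul_apply', sign_mul_self, Real.norm_eq_abs]
        linarith [abs_nonneg b]) hqq hPP y
    set A := mixedPow μ q p.toReal (fun i => y i) with hA
    have hAfin : A ≠ ∞ := mixedPow_ne_top hp0 hp hqq.pos y
    have hle : ∑ i, (ContinuousLinearMap.mul ℝ ℝ).lpPairing μ p' p (k i) (y i)
        ≤ ∑ i, (ContinuousLinearMap.mul ℝ ℝ).lpPairing μ p' p
          (S.poisson (t i) (normLp (k i))) (h i) := by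
      refine Finset.sum_le_sum fun i _ => ?_
      rw [S.lpPairing_poisson h1p hp h1p' hp' _ (ht i), ContinuousLinearMap.lpPairing_eq_integral,
        ContinuousLinearMap.lpPairing_eq_integral]
      have hint : ∀ u : Lp ℝ p' μ,
          Integrable (fun x => ContinuousLinearMap.mul ℝ ℝ (u x) (y i x)) μ := fun u =>
        memLp_one_iff_integrable.1 ((ContinuousLinearMap.mul ℝ ℝ).memLp_of_bilin 1
          (Lp.memLp u) (Lp.memLp (y i)))
      refine integral_mono_ae (hint _) (hint _) ?_
      filter_upwards [coeFn_normLp (k i), (Lp.coeFn_nonneg _).2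
        (S.poisson_nonneg h1p hp (ht i) (hh i))] with x h1 h2
      simp only [ContinuousLinearMap.mul_apply', h1]
      exact mul_le_mul_of_nonneg_right (le_abs_self _) h2
    have hH := sum_lpPairing_le hβ hqq hPP (fun i => S.poisson (t i) (normLp (k i))) h
    have hS := hst ι t ht (fun i => normLp (k i)) (fun i => normLp_nonneg _)
    have hkn : mixedPow μ q' p'.toReal (fun i => normLp (k i)) ≤ A := by
      refine (mixedPow_mono hqq.symm.nonneg hPP.symm.nonneg fun i => ?_).trans hk1
      filter_upwards [ae_enorm_normLp (k i)] with x hx using hx.le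
    have hmain : A ≤ (4 * C ^ (1 / p'.toReal) * mixedPow μ q p.toReal (fun i => h i)
        ^ (1 / p.toReal)) * A ^ (1 / p'.toReal) := by
      have e4 := hPP.symm.one_div_nonneg
      calc A ≤ 4 * ENNReal.ofReal (∑ i, (ContinuousLinearMap.mul ℝ ℝ).lpPairing μ p' p
            (S.poisson (t i) (normLp (k i))) (h i)) := hk2.trans (by gcongr)
        _ ≤ 4 * ((C * A) ^ (1 / p'.toReal) * mixedPow μ q p.toReal (fun i => h i)
              ^ (1 / p.toReal)) := by
            gcongr
            refine hH.trans ?_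
            gcongr
            exact hS.trans (by gcongr)
        _ = _ := by
            rw [ENNReal.mul_rpow_of_nonneg _ _ e4]
            ring
    have h5 := rpow_one_sub_le_of_le_mul_rpow hAfin
      (by rw [div_lt_one hPP.symm.pos]; exact hPP.symm.lt) hmain
    have e3 : 1 - 1 / p'.toReal = p.toReal⁻¹ := by rw [one_div]; exact hPP.symm.one_sub_inv
    rw [e3, ENNReal.rpow_inv_le_iff hP0, ENNReal.mul_rpow_of_nonneg _ _ hP0.le,
      ← ENNReal.rpow_mul (mixedPow _ _ _ _), one_div_mul_cancel hP0.ne', ENNReal.rpow_one] at h5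
    exact h5

end SymmetricDiffusionSemigroup

/-! ### Pointwise differentiable versions of the Poisson semigroup -/

section PowerSeries

open Set

variable {Ω : Type*} [MeasurableSpace Ω] {μ : Measure Ω} {p : ℝ≥0∞} [Fact (1 ≤ p)]
  {B : Type*} [NormedAddCommGroup B] [NormedSpace ℝ B] [CompleteSpace B]

theorem analyticOnNhd_tsum_pow {c : ℕ → B} {ρ : ℝ} (hρ : 0 < ρ)
    (hc : Summable fun n => ρ ^ n * ‖c n‖) :
    AnalyticOnNhd ℝ (fun z : ℝ => ∑' n, z ^ n • c n) (Metric.ball 0 ρ) := by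
  set P : FormalMultilinearSeries ℝ ℝ B := fun n =>
    ContinuousMultilinearMap.mkPiRing ℝ (Fin n) (c n) with hP
  have hr : ENNReal.ofReal ρ ≤ P.radius := by
    refine P.le_radius_of_summable_norm (r := ρ.toNNReal) ?_
    refine hc.congr fun n => ?_
    rw [hP, ContinuousMultilinearMap.norm_mkPiRing, Real.coe_toNNReal _ hρ.le, mul_comm]
  have h1 : HasFPowerSeriesOnBall P.sum P 0 P.radius :=
    P.hasFPowerSeriesOnBall ((ENNReal.ofReal_pos.2 hρ).trans_le hr)
  have h2 := h1.analyticOnNhd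
  have h3 : P.sum = fun z : ℝ => ∑' n, z ^ n • c n := by
    ext z
    simp [FormalMultilinearSeries.sum, hP]
  rw [← h3]
  refine h2.mono fun z hz => ?_
  refine lt_of_lt_of_le ?_ hr
  rw [Metric.mem_ball, dist_zero_right] at hz
  rw [edist_zero_right, ← ofReal_norm]
  exact (ENNReal.ofReal_lt_ofReal_iff hρ).2 hz

/-- A power series with coefficients in `L^p_B` that converges normally on `|z| < ρ` defines,
for almost every `x`, a function of `z` that is analytic on `|z| < ρ`. -/
theorem ae_analyticOnNhd_tsum {c : ℕ → Lp B p μ} {ρ : ℝ} (hρ : 0 < ρ)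
    (hc : Summable fun n => ρ ^ n * ‖c n‖) :
    ∀ᵐ x ∂μ, AnalyticOnNhd ℝ (fun z : ℝ => ∑' n, z ^ n • c n x) (Metric.ball 0 ρ) := by
  have h : ∑' n, eLpNorm (fun x => ρ ^ n • (c n : Ω → B) x) p μ ≠ ∞ := by
    have : ∀ n, eLpNorm (fun x => ρ ^ n • (c n : Ω → B) x) p μ = ‖ρ ^ n • c n‖ₑ := fun n => by
      rw [Lp.enorm_def]
      exact eLpNorm_congr_ae (Lp.coeFn_smul _ _).symm
    simp only [this]
    refine tsum_enorm_ne_top_iff_summable_norm.2 (hc.congr fun n => ?_)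
    rw [norm_smul, Real.norm_of_nonneg (by positivity)]
  filter_upwards [summable_norm_of_tsum_eLpNorm_ne_top Fact.out
    (fun n => ((Lp.aestronglyMeasurable (c n)).const_smul (ρ ^ n))) h] with x hx
  refine analyticOnNhd_tsum_pow hρ (hx.congr fun n => ?_)
  simp only [Pi.smul_apply]
  rw [norm_smul, Real.norm_of_nonneg (by positivity)]

theorem ae_eq_tsum_of_hasSum {c : ℕ → Lp B p μ} {ρ z : ℝ} (hz : |z| ≤ ρ)
    (hc : Summable fun n => ρ ^ n * ‖c n‖) {g : Lp B p μ} (hg : HasSum (fun n => z ^ n • c n) g) :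
    g =ᵐ[μ] fun x => ∑' n, z ^ n • c n x := by
  have h : ∑' n, ‖z ^ n • c n‖ₑ ≠ ∞ := by
    refine tsum_enorm_ne_top_iff_summable_norm.2
      (Summable.of_nonneg_of_le (fun _ => norm_nonneg _) (fun n => ?_) hc)
    rw [norm_smul, norm_pow, Real.norm_eq_abs]
    gcongr
  filter_upwards [Lp.hasSum_coeFn_tsum h, ae_all_iff.2 fun n => Lp.coeFn_smul (z ^ n) (c n)]
    with x hx h2
  rw [hg.tsum_eq] at hx
  rw [← hx.tsum_eq]
  exact tsum_congr fun n => h2 n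

theorem eqOn_of_eqOn_rat {X : Type*} [TopologicalSpace X] [T2Space X] {u v : ℝ → X} {U : Set ℝ}
    (hU : IsOpen U) (hu : ContinuousOn u U) (hv : ContinuousOn v U)
    (h : ∀ r : ℚ, (r : ℝ) ∈ U → u r = v r) : EqOn u v U := by
  have hd : U ⊆ closure (U ∩ range ((↑) : ℚ → ℝ)) :=
    Rat.denseRange_cast.open_subset_closure_inter hU
  refine EqOn.of_subset_closure (s := U ∩ range ((↑) : ℚ → ℝ)) ?_ hu hv inter_subset_left hd
  rintro _ ⟨hs, r, rfl⟩
  exact h r hs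

end PowerSeries

namespace SymmetricDiffusionSemigroup

open Set

variable {Ω : Type*} [MeasurableSpace Ω] {μ : Measure Ω} (S : SymmetricDiffusionSemigroup μ)
  {p : ℝ≥0∞} [Fact (1 ≤ p)]
  {B : Type*} [NormedAddCommGroup B] [NormedSpace ℝ B] [CompleteSpace B]

/-- The Taylor expansion at `N²` of the Laplace transform in the variable `t²` converges normally
for `1/N < t < N`, hence also pointwise almost everywhere; its sum is a smooth version of `P_t f` on
this interval. -/
theorem exists_local_version (h1p : 1 < p) (hp : p ≠ ∞) (f : Lp B p μ) {N : ℝ} (hN : 1 < N) :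
    ∃ w : ℝ → Ω → B, (∀ t ∈ Ioo N⁻¹ N, w t =ᵐ[μ] S.poisson t f) ∧
      ∀ᵐ x ∂μ, ContDiffOn ℝ 1 (fun t => w t x) (Ioo N⁻¹ N) := by
  have hT := S.isContractionSemigroup_bochnerT (B := B) h1p hp
  have hN0 : 0 < N := by linarith
  have hNi : N⁻¹ < 1 := inv_lt_one_of_one_lt₀ hN
  have hNi0 : 0 < N⁻¹ := inv_pos.2 hN0
  set ρ : ℝ := N ^ 2 - N⁻¹ ^ 2 with hρ
  have hρ0 : 0 < ρ := by rw [hρ]; nlinarith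
  have hρlt : ρ < N ^ 2 := by rw [hρ]; nlinarith
  set c : ℕ → Lp B p μ := fun n =>
    ((n.factorial : ℝ)⁻¹) • kernelOp (fun s => S.bochnerT s) (laplaceKernel n (N ^ 2)) f with hcdef
  have hc : Summable fun n => ρ ^ n * ‖c n‖ := by
    refine (hT.summable_taylor hρ0.le hρlt f).congr fun n => ?_
    rw [hcdef, norm_smul, Real.norm_of_nonneg (by positivity), div_eq_mul_inv, mul_assoc]
  have hz : ∀ t ∈ Ioo N⁻¹ N, |N ^ 2 - t ^ 2| < ρ := by
    rintro t ⟨h1, h2⟩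
    rw [abs_of_nonneg (by nlinarith), hρ]
    nlinarith
  refine ⟨fun t x => ((√Real.pi)⁻¹ * t) • ∑' n, (N ^ 2 - t ^ 2) ^ n • c n x, fun t ht => ?_, ?_⟩
  · have ht0 : 0 < t := hNi0.trans ht.1
    have hs := hT.hasSum_taylor (τ₀ := N ^ 2) (τ := t ^ 2) ((hz t ht).trans hρlt) f
    have hs' : HasSum (fun n => (N ^ 2 - t ^ 2) ^ n • c n)
        (kernelOp (fun s => S.bochnerT s) (laplaceKernel 0 (t ^ 2)) f) := by
      refine hs.congr_fun ?_
      intro n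
      rw [hcdef, smul_smul, div_eq_mul_inv]
    have h1 := ae_eq_tsum_of_hasSum (hz t ht).le hc hs'
    rw [poisson, IsContractionSemigroup.subordinate_eq_laplace ht0]
    filter_upwards [h1, Lp.coeFn_smul ((√Real.pi)⁻¹ * t)
      (kernelOp (fun s => S.bochnerT s) (laplaceKernel 0 (t ^ 2)) f)] with x hx h2
    rw [h2, Pi.smul_apply, hx]
  · filter_upwards [ae_analyticOnNhd_tsum hρ0 hc] with x hx
    have h1 : ContDiffOn ℝ 1 (fun z : ℝ => ∑' n, z ^ n • c n x) (Metric.ball 0 ρ) :=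
      hx.contDiffOn_of_completeSpace
    have h2 : ContDiff ℝ 1 (fun t : ℝ => N ^ 2 - t ^ 2) := by fun_prop
    have h3 : ContDiff ℝ 1 (fun t : ℝ => (√Real.pi)⁻¹ * t) := by fun_prop
    refine h3.contDiffOn.smul (h1.comp h2.contDiffOn fun t ht => ?_)
    rw [Metric.mem_ball, dist_zero_right]
    exact hz t ht

/-- The versions on the intervals `(1/N, N)` agree almost everywhere at rational times, hence, by
continuity, at all times, and can be glued. -/
theorem exists_version (h1p : 1 < p) (hp : p ≠ ∞) (f : Lp B p μ) :
    ∃ u : ℝ → Ω → B, (∀ t, 0 < t → u t =ᵐ[μ] S.poisson t f) ∧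
      ∀ᵐ x ∂μ, ContDiffOn ℝ 1 (fun t => u t x) (Ioi 0) := by
  have hN : ∀ n : ℕ, (1 : ℝ) < n + 2 := fun n => by
    have : (0 : ℝ) ≤ n := n.cast_nonneg
    linarith
  choose w hw1 hw2 using fun n : ℕ => S.exists_local_version h1p hp f (hN n)
  set I : ℕ → Set ℝ := fun n => Ioo ((n : ℝ) + 2)⁻¹ (n + 2) with hI
  have hI0 : ∀ n t, t ∈ I n → 0 < t := fun n t ht =>
    lt_of_le_of_lt (inv_nonneg.2 (by have := hN n; linarith)) ht.1
  have hk : ∀ t : ℝ, ∃ n : ℕ, 0 < t → t ∈ I n := by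
    intro t
    obtain ⟨n, hn⟩ := exists_nat_gt (max t t⁻¹)
    refine ⟨n, fun ht => ⟨?_, ?_⟩⟩
    · have : t⁻¹ < n + 2 := by have := (le_max_right t t⁻¹).trans_lt hn; linarith
      exact (inv_lt_comm₀ ht (by have := hN n; linarith)).1 this
    · have := (le_max_left t t⁻¹).trans_lt hn
      linarith
  choose k hk using hk
  have hcomp : ∀ᵐ x ∂μ, ∀ (m n : ℕ) (r : ℚ), (r : ℝ) ∈ I m ∩ I n → w m r x = w n r x := by
    refine ae_all_iff.2 fun m => ae_all_iff.2 fun n => ae_all_iff.2 fun r => ?_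
    by_cases hr : (r : ℝ) ∈ I m ∩ I n
    · filter_upwards [hw1 m r hr.1, hw1 n r hr.2] with x h1 h2 _
      rw [h1, h2]
    · exact Eventually.of_forall fun x h => absurd h hr
  refine ⟨fun t => w (k t) t, fun t ht => hw1 _ t (hk t ht), ?_⟩
  filter_upwards [hcomp, ae_all_iff.2 hw2] with x hx h2
  have heq : ∀ m n, EqOn (fun t => w m t x) (fun t => w n t x) (I m ∩ I n) := fun m n =>
    eqOn_of_eqOn_rat (isOpen_Ioo.inter isOpen_Ioo) ((h2 m).continuousOn.mono inter_subset_left)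
      ((h2 n).continuousOn.mono inter_subset_right) fun r hr => hx m n r hr
  intro t ht
  refine ContDiffAt.contDiffWithinAt ?_
  have hmem : I (k t) ∈ 𝓝 t := isOpen_Ioo.mem_nhds (hk t ht)
  refine ((h2 (k t)).contDiffAt hmem).congr_of_eventuallyEq ?_
  filter_upwards [hmem] with s hs
  exact heq (k s) (k t) ⟨hk s (hI0 _ s hs), hs⟩

variable {S} in
omit [CompleteSpace B] in
theorem IsPoissonVersion.ae_eq_all {f : Lp B p μ} {u v : ℝ → Ω → B}
    (hu : S.IsPoissonVersion f u) (hv : S.IsPoissonVersion f v) :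
    ∀ᵐ x ∂μ, ∀ t, 0 < t → u t x = v t x := by
  have h : ∀ᵐ x ∂μ, ∀ r : ℚ, (r : ℝ) ∈ Ioi (0 : ℝ) → u r x = v r x := by
    refine ae_all_iff.2 fun r => ?_
    by_cases hr : (0 : ℝ) < r
    · filter_upwards [hu.ae_eq r hr, hv.ae_eq r hr] with x h1 h2 _
      rw [h1, h2]
    · exact Eventually.of_forall fun x h => absurd h hr
  filter_upwards [h, hu.differentiable, hv.differentiable] with x hx h1 h2
  exact eqOn_of_eqOn_rat isOpen_Ioi
    (fun t ht => (h1 t ht).continuousAt.continuousWithinAt)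
    (fun t ht => (h2 t ht).continuousAt.continuousWithinAt) hx

theorem exists_isPoissonVersion (h1p : 1 < p) (hp : p ≠ ∞) (f : Lp B p μ) :
    ∃ u, S.IsPoissonVersion f u ∧ ∀ᵐ x ∂μ, ContDiffOn ℝ 1 (fun t => u t x) (Ioi 0) := by
  obtain ⟨u, h1, h2⟩ := S.exists_version h1p hp f
  refine ⟨u, ⟨h1, ?_⟩, h2⟩
  filter_upwards [h2] with x hx t ht
  exact (hx.contDiffAt (Ioi_mem_nhds ht)).differentiableAt one_ne_zero

theorem isPoissonVersion_poissonVersion (h1p : 1 < p) (hp : p ≠ ∞) (f : Lp B p μ) :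
    S.IsPoissonVersion f (S.poissonVersion f) := by
  have h : ∃ u, S.IsPoissonVersion f u :=
    (S.exists_isPoissonVersion h1p hp f).imp fun _ hu => hu.1
  rw [poissonVersion, dif_pos h]
  exact h.choose_spec

theorem contDiffOn_poissonVersion (h1p : 1 < p) (hp : p ≠ ∞) (f : Lp B p μ) :
    ∀ᵐ x ∂μ, ContDiffOn ℝ 1 (fun t => S.poissonVersion f t x) (Ioi 0) := by
  obtain ⟨u, hu, h2⟩ := S.exists_isPoissonVersion h1p hp f
  filter_upwards [h2, (S.isPoissonVersion_poissonVersion h1p hp f).ae_eq_all hu] with x hx he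
  exact hx.congr fun t ht => he t ht

/-- The derivative `∂_t P_t f` in `L^p_B(Ω)`. -/
abbrev dPoisson (t : ℝ) (f : Lp B p μ) : Lp B p μ := subordDeriv (fun s => S.bochnerT s) t f

/-- The pointwise derivative `∂_t P_t f(x)`. -/
def poissonDeriv (f : Lp B p μ) (t : ℝ) (x : Ω) : B := deriv (fun s => S.poissonVersion f s x) t

theorem continuousOn_poissonDeriv (h1p : 1 < p) (hp : p ≠ ∞) (f : Lp B p μ) :
    ∀ᵐ x ∂μ, ContinuousOn (fun t => S.poissonDeriv f t x) (Ioi 0) := by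
  filter_upwards [S.contDiffOn_poissonVersion h1p hp f] with x hx
  exact hx.continuousOn_deriv_of_isOpen isOpen_Ioi le_rfl

/-- The pointwise derivative is the derivative in `L^p_B(Ω)`: along a subsequence, the difference
quotients converge in both senses. -/
theorem poissonDeriv_ae_eq (h1p : 1 < p) (hp : p ≠ ∞) {t : ℝ} (ht : 0 < t) (f : Lp B p μ) :
    S.poissonDeriv f t =ᵐ[μ] S.dPoisson t f := by
  have hT := S.isContractionSemigroup_bochnerT (B := B) h1p hp
  have hv := S.isPoissonVersion_poissonVersion h1p hp f
  set δ : ℕ → ℝ := fun n => 1 / ((n : ℝ) + 1) with hδ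
  have hδ0 : ∀ n, 0 < δ n := fun n => by rw [hδ]; positivity
  have hδt : Tendsto δ atTop (𝓝[≠] 0) := by
    refine tendsto_nhdsWithin_iff.2 ⟨tendsto_one_div_add_atTop_nhds_zero_nat, ?_⟩
    exact Eventually.of_forall fun n => (hδ0 n).ne'
  have h1 : Tendsto (fun n => (δ n)⁻¹ • (S.poisson (t + δ n) f - S.poisson t f)) atTop
      (𝓝 (S.dPoisson t f)) :=
    (hT.hasDerivAt_subordinate ht f).tendsto_slope_zero.comp hδt
  obtain ⟨ns, hns, hlim⟩ := (tendstoInMeasure_of_tendsto_Lp h1).exists_seq_tendsto_ae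
  have h2 : ∀ᵐ x ∂μ, ∀ n, ((δ n)⁻¹ • (S.poisson (t + δ n) f - S.poisson t f) : Lp B p μ) x
      = (δ n)⁻¹ • (S.poissonVersion f (t + δ n) x - S.poissonVersion f t x) := by
    refine ae_all_iff.2 fun n => ?_
    filter_upwards [Lp.coeFn_smul (δ n)⁻¹ (S.poisson (t + δ n) f - S.poisson t f),
      Lp.coeFn_sub (S.poisson (t + δ n) f) (S.poisson t f), hv.ae_eq (t + δ n)
      (add_pos ht (hδ0 n)), hv.ae_eq t ht] with x a b c d
    rw [a, Pi.smul_apply, b, Pi.sub_apply, c, d]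
  filter_upwards [hlim, h2, hv.differentiable] with x a b c
  have h3 := ((c t ht).hasDerivAt.tendsto_slope_zero.comp hδt).comp hns.tendsto_atTop
  refine tendsto_nhds_unique h3 (a.congr fun n => ?_)
  rw [b]
  rfl

omit [CompleteSpace B] in
theorem gFunction_eq (q : ℝ) (f : Lp B p μ) (x : Ω) :
    S.gFunction q f x = (∫⁻ t in Ioi (0 : ℝ),
      ‖t • S.poissonDeriv f t x‖ₑ ^ q / ENNReal.ofReal t) ^ (1 / q) := rfl

end SymmetricDiffusionSemigroup

/-! ### Measurability and discretization of the `g`-function -/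

theorem lintegral_inv_Ioc_two_mul_le {a : ℝ} (ha : 0 < a) :
    ∫⁻ t in Set.Ioc a (2 * a), (ENNReal.ofReal t)⁻¹ ≤ 1 := by
  calc ∫⁻ t in Set.Ioc a (2 * a), (ENNReal.ofReal t)⁻¹
      ≤ ∫⁻ _ in Set.Ioc a (2 * a), (ENNReal.ofReal a)⁻¹ := by
        refine setLIntegral_mono measurable_const fun t ht => ?_
        exact ENNReal.inv_le_inv.2 (ENNReal.ofReal_le_ofReal ht.1.le)
    _ = 1 := by
        rw [setLIntegral_const, Real.volume_Ioc, show 2 * a - a = a by ring]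
        exact ENNReal.inv_mul_cancel (ENNReal.ofReal_pos.2 ha).ne' ENNReal.ofReal_ne_top

theorem iUnion_dyadic : Set.Ioi (0 : ℝ) ⊆ ⋃ l : ℤ, Set.Ioc ((2 : ℝ) ^ l) (2 * 2 ^ l) := by
  intro t ht
  obtain ⟨l, hl⟩ := exists_mem_Ioc_zpow (Set.mem_Ioi.1 ht) (one_lt_two : (1 : ℝ) < 2)
  refine Set.mem_iUnion.2 ⟨l, hl.1, ?_⟩
  rw [mul_comm, ← zpow_add_one₀ two_ne_zero]
  exact hl.2

/-- The dyadic rationals `⌈2^n t⌉ / 2^n` decrease to `t`. -/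
def dyadicApprox (n : ℕ) (t : ℝ) : ℝ := (⌈t * 2 ^ n⌉ : ℝ) / 2 ^ n

theorem le_dyadicApprox (n : ℕ) (t : ℝ) : t ≤ dyadicApprox n t := by
  rw [dyadicApprox, le_div_iff₀ (by positivity)]
  exact Int.le_ceil _

theorem tendsto_dyadicApprox (t : ℝ) :
    Tendsto (fun n => dyadicApprox n t) atTop (𝓝 t) := by
  have h : Tendsto (fun n : ℕ => t + (1 / 2 : ℝ) ^ n) atTop (𝓝 (t + 0)) :=
    tendsto_const_nhds.add
      (tendsto_pow_atTop_nhds_zero_of_lt_one (by norm_num) (by norm_num))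
  rw [add_zero] at h
  refine tendsto_of_tendsto_of_tendsto_of_le_of_le tendsto_const_nhds h
    (fun n => le_dyadicApprox n t) fun n => ?_
  rw [dyadicApprox, div_le_iff₀ (by positivity), add_mul, ← mul_pow]
  norm_num
  exact (Int.ceil_lt_add_one _).le

/-- A sequence of functions in `L^p`, `p < ∞`, is carried by a set on which `μ` is s-finite; on it
Tonelli's theorem is available. -/
theorem exists_sFinite_restrict {Ω : Type*} [MeasurableSpace Ω] {μ : Measure Ω} {p : ℝ≥0∞}
    (hp0 : p ≠ 0) (hp : p ≠ ∞)
    {B : Type*} [NormedAddCommGroup B] {ι : Type*} [Countable ι] (d : ι → Lp B p μ) :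
    ∃ s : Set Ω, MeasurableSet s ∧ SFinite (μ.restrict s) ∧ ∀ i, ∀ᵐ x ∂μ, x ∉ s → d i x = 0 := by
  rcases isEmpty_or_nonempty ι with hι | hι
  · refine ⟨∅, MeasurableSet.empty, ?_, fun i => hι.elim i⟩
    rw [Measure.restrict_empty]
    infer_instance
  obtain ⟨e, he⟩ := exists_surjective_nat ι
  have hf : ∀ i, AEFinStronglyMeasurable (d i) μ := fun i =>
    ((Lp.memLp (d i)).finStronglyMeasurable_of_stronglyMeasurable
      (Lp.stronglyMeasurable (d i)) hp0 hp).aefinStronglyMeasurable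
  set s : ℕ → Set Ω := fun n => (hf (e n)).sigmaFiniteSet with hs
  have hsm : ∀ n, MeasurableSet (s n) := fun n => (hf (e n)).measurableSet
  refine ⟨⋃ n, s n, MeasurableSet.iUnion hsm, ?_, fun i => ?_⟩
  · rw [← iUnion_disjointed, Measure.restrict_iUnion (disjoint_disjointed s)
      (MeasurableSet.disjointed hsm)]
    have : ∀ n, SFinite (μ.restrict (disjointed s n)) := fun n => by
      have h1 : SigmaFinite (μ.restrict (s n)) := (hf (e n)).sigmaFinite_restrict
      have h2 : SigmaFinite (μ.restrict (disjointed s n)) :=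
        Measure.sigmaFinite_of_le (μ.restrict (s n)) (Measure.restrict_mono (disjointed_subset s n) le_rfl)
      infer_instance
    infer_instance
  · obtain ⟨n, rfl⟩ := he i
    have h := (hf (e n)).ae_eq_zero_compl
    rw [Filter.EventuallyEq, ae_restrict_iff' (hf (e n)).measurableSet.compl] at h
    filter_upwards [h] with x hx hxs
    exact hx fun hxn => hxs (Set.mem_iUnion.2 ⟨n, hxn⟩)

theorem measurable_limsup_dyadic {Ω : Type*} [MeasurableSpace Ω] {F : ℝ → Ω → ℝ≥0∞}
    (hF : ∀ t, Measurable (F t)) :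
    Measurable fun z : ℝ × Ω => limsup (fun n => F (dyadicApprox n z.1) z.2) atTop := by
  refine Measurable.limsup fun n => ?_
  have h1 : Measurable fun y : ℤ × Ω => F ((y.1 : ℝ) / 2 ^ n) y.2 :=
    measurable_from_prod_countable_right fun k => hF ((k : ℝ) / 2 ^ n)
  have h2 : Measurable fun z : ℝ × Ω => (⌈z.1 * 2 ^ n⌉, z.2) :=
    ((measurable_fst.mul_const _).ceil).prodMk measurable_snd
  exact h1.comp h2

namespace SymmetricDiffusionSemigroup

open Set

variable {Ω : Type*} [MeasurableSpace Ω] {μ : Measure Ω} (S : SymmetricDiffusionSemigroup μ)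
  {p : ℝ≥0∞} [Fact (1 ≤ p)]
  {B : Type*} [NormedAddCommGroup B] [NormedSpace ℝ B]

/-- A jointly measurable substitute for `(t, x) ↦ ‖∂_t P_t f(x)‖`, built from representatives of
`∂_t P_t f` at dyadic times. -/
def enormDeriv (f : Lp B p μ) (z : ℝ × Ω) : ℝ≥0∞ :=
  limsup (fun n => ‖(S.dPoisson (dyadicApprox n z.1) f : Ω → B) z.2‖ₑ) atTop

theorem measurable_enormDeriv (f : Lp B p μ) : Measurable (S.enormDeriv f) :=
  measurable_limsup_dyadic (F := fun t x => ‖(S.dPoisson t f : Ω → B) x‖ₑ)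
    fun t => (Lp.stronglyMeasurable (S.dPoisson t f)).enorm

variable [CompleteSpace B]

theorem enormDeriv_eq (h1p : 1 < p) (hp : p ≠ ∞) (f : Lp B p μ) :
    ∀ᵐ x ∂μ, ∀ t, 0 < t → S.enormDeriv f (t, x) = ‖S.poissonDeriv f t x‖ₑ := by
  have h : ∀ᵐ x ∂μ, ∀ (n : ℕ) (k : ℤ), 0 < (k : ℝ) / 2 ^ n →
      S.poissonDeriv f ((k : ℝ) / 2 ^ n) x = S.dPoisson ((k : ℝ) / 2 ^ n) f x := by
    refine ae_all_iff.2 fun n => ae_all_iff.2 fun k => ?_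
    by_cases hk : 0 < (k : ℝ) / 2 ^ n
    · filter_upwards [S.poissonDeriv_ae_eq h1p hp hk f] with x hx _ using hx
    · exact Eventually.of_forall fun x h => absurd h hk
  filter_upwards [h, S.continuousOn_poissonDeriv h1p hp f] with x hx hc t ht
  have h1 : Tendsto (fun n => S.poissonDeriv f (dyadicApprox n t) x) atTop
      (𝓝 (S.poissonDeriv f t x)) :=
    ((hc.continuousAt (Ioi_mem_nhds ht)).tendsto).comp (tendsto_dyadicApprox t)
  refine ((h1.enorm).congr fun n => ?_).limsup_eq
  exact congrArg _ (hx n _ (ht.trans_le (le_dyadicApprox n t)))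

/-- A measurable substitute for the `g`-function. -/
def gProxy (q : ℝ) (f : Lp B p μ) (x : Ω) : ℝ≥0∞ :=
  (∫⁻ t in Ioi (0 : ℝ), (ENNReal.ofReal t * S.enormDeriv f (t, x)) ^ q / ENNReal.ofReal t) ^ (1 / q)

omit [CompleteSpace B] in
theorem measurable_gProxy (q : ℝ) (f : Lp B p μ) : Measurable (S.gProxy q f) := by
  refine Measurable.pow_const ?_ _
  have h := S.measurable_enormDeriv f
  refine Measurable.lintegral_prod_left' (f := fun z : ℝ × Ω =>
    (ENNReal.ofReal z.1 * S.enormDeriv f z) ^ q / ENNReal.ofReal z.1) ?_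
  fun_prop

theorem gFunction_ae_eq (h1p : 1 < p) (hp : p ≠ ∞) (q : ℝ) (f : Lp B p μ) :
    S.gFunction q f =ᵐ[μ] S.gProxy q f := by
  filter_upwards [S.enormDeriv_eq h1p hp f] with x hx
  rw [S.gFunction_eq, gProxy]
  congr 1
  refine setLIntegral_congr_fun measurableSet_Ioi fun t ht => ?_
  have ht' : (0 : ℝ) < t := ht
  rw [hx t ht, enorm_smul, Real.enorm_eq_ofReal ht'.le]

/-- On a dyadic interval `∂_t P_t f` is controlled by a single function: one has
`t ∂P_t = (t/s) P_{t-s} (s ∂P_s)`, with `P_{t-s} ≤ ((t-s)/s) P_s` on nonnegative functions by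
Harnack's inequality, and `t/s ≤ 4`, `(t-s)/s ≤ 3`. -/
theorem poissonDeriv_le (h1p : 1 < p) (hp : p ≠ ∞) (f : Lp B p μ) {s : ℝ} (hs : 0 < s) :
    ∀ᵐ x ∂μ, ∀ t ∈ Ioc (2 * s) (4 * s), ‖t • S.poissonDeriv f t x‖ₑ
      ≤ 12 * ‖S.poisson s (normLp (s • S.dPoisson s f)) x‖ₑ := by
  have hT := S.isContractionSemigroup_bochnerT (B := B) h1p hp
  set m : Lp ℝ p μ := S.poisson s (normLp (s • S.dPoisson s f)) with hm
  have key : ∀ t, 2 * s ≤ t → t ≤ 4 * s → ∀ᵐ x ∂μ, ‖t • S.poissonDeriv f t x‖ₑ ≤ 12 * ‖m x‖ₑ := by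
    intro t h1 h2
    have ht : 0 < t := by linarith
    have e1 : t • S.dPoisson t f = (t / s) • S.poisson (t - s) (s • S.dPoisson s f) := by
      have h3 := hT.subordDeriv_add (s := t - s) (t := s) (by linarith) hs f
      rw [sub_add_cancel] at h3
      rw [dPoisson, h3, poisson, ← hT.subordCLM_apply (t := t - s) (by linarith),
        ← hT.subordCLM_apply (t := t - s) (by linarith), map_smul, smul_smul,
        div_mul_cancel₀ _ hs.ne']
    have h4 : normLp (S.poisson (t - s) (s • S.dPoisson s f)) ≤ ((t - s) / s) • m :=
      (S.normLp_poisson_le h1p hp (by linarith) _).trans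
        (S.poisson_harnack h1p hp hs (by linarith) (normLp_nonneg _))
    have hm0 : 0 ≤ m := S.poisson_nonneg h1p hp hs (normLp_nonneg _)
    have h5 := ae_enorm_le_of_le (normLp_nonneg _) h4
    filter_upwards [h5, ae_enorm_normLp (S.poisson (t - s) (s • S.dPoisson s f)),
      Lp.coeFn_smul ((t - s) / s) m, S.poissonDeriv_ae_eq h1p hp ht f,
      Lp.coeFn_smul t (S.dPoisson t f),
      Lp.coeFn_smul (t / s) (S.poisson (t - s) (s • S.dPoisson s f))] with x a b c d e g
    rw [d, ← Pi.smul_apply, ← e, e1, g, Pi.smul_apply, enorm_smul, ← b]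
    refine (mul_le_mul_right a _).trans ?_
    rw [c, Pi.smul_apply, enorm_smul, ← mul_assoc]
    refine mul_le_mul_left ?_ _
    rw [Real.enorm_eq_ofReal (by positivity), Real.enorm_eq_ofReal (div_nonneg (by linarith) hs.le),
      ← ENNReal.ofReal_mul (by positivity),
      show (12 : ℝ≥0∞) = ENNReal.ofReal (4 * 3) by norm_num]
    refine ENNReal.ofReal_le_ofReal (mul_le_mul ?_ ?_ (div_nonneg (by linarith) hs.le) (by norm_num))
    · rw [div_le_iff₀ hs]; linarith
    · rw [div_le_iff₀ hs]; linarith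
  have h : ∀ᵐ x ∂μ, ∀ r : ℚ, (r : ℝ) ∈ Ioo (2 * s) (4 * s) →
      ‖(r : ℝ) • S.poissonDeriv f r x‖ₑ ≤ 12 * ‖m x‖ₑ := by
    refine ae_all_iff.2 fun r => ?_
    by_cases hr : (r : ℝ) ∈ Ioo (2 * s) (4 * s)
    · filter_upwards [key r hr.1.le hr.2.le] with x hx _ using hx
    · exact Eventually.of_forall fun x h => absurd h hr
  filter_upwards [h, S.continuousOn_poissonDeriv h1p hp f] with x hx hc t ht
  have ht0 : 0 < t := by have := ht.1; linarith
  have hcl : t ∈ closure (Ioo (2 * s) (4 * s) ∩ range ((↑) : ℚ → ℝ)) := by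
    refine closure_minimal (Rat.denseRange_cast.open_subset_closure_inter isOpen_Ioo)
      isClosed_closure ?_
    rw [closure_Ioo (by linarith)]
    exact Ioc_subset_Icc_self ht
  have hcont : ContinuousWithinAt (fun t => ‖t • S.poissonDeriv f t x‖ₑ)
      (Ioo (2 * s) (4 * s) ∩ range ((↑) : ℚ → ℝ)) t := by
    have h1 : ContinuousAt (fun t => S.poissonDeriv f t x) t := hc.continuousAt (Ioi_mem_nhds ht0)
    exact ((continuousAt_id.smul h1).enorm).continuousWithinAt
  refine ContinuousWithinAt.closure_le hcl hcont continuousWithinAt_const ?_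
  rintro _ ⟨hs, r, rfl⟩
  exact hx r hs

/-- The `g`-function is dominated by a dyadic square function. -/
theorem gFunction_rpow_le_tsum (h1p : 1 < p) (hp : p ≠ ∞) {q : ℝ} (hq : 1 < q) (f : Lp B p μ) :
    ∀ᵐ x ∂μ, S.gFunction q f x ^ q ≤ ∑' l : ℤ,
      (12 * ‖S.poisson (2 ^ l) (normLp ((2 : ℝ) ^ l • S.dPoisson (2 ^ l) f)) x‖ₑ) ^ q := by
  have hq0 : q ≠ 0 := by linarith
  filter_upwards [ae_all_iff.2 fun l : ℤ => S.poissonDeriv_le h1p hp f (s := 2 ^ l) (by positivity)]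
    with x hx
  rw [S.gFunction_eq, ← ENNReal.rpow_mul, one_div_mul_cancel hq0, ENNReal.rpow_one]
  have hU : Ioi (0 : ℝ) ⊆ ⋃ l : ℤ, Ioc (2 * (2 : ℝ) ^ l) (2 * (2 * 2 ^ l)) := by
    refine iUnion_dyadic.trans (iUnion_subset fun l => ?_)
    have := subset_iUnion (fun l : ℤ => Ioc (2 * (2 : ℝ) ^ l) (2 * (2 * 2 ^ l))) (l - 1)
    refine subset_trans (subset_of_eq ?_) this
    rw [mul_comm 2 ((2 : ℝ) ^ (l - 1)), ← zpow_add_one₀ two_ne_zero, sub_add_cancel]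
  refine (lintegral_mono_set hU).trans ((lintegral_iUnion_le _ _).trans
    (ENNReal.tsum_le_tsum fun l => ?_))
  set K := (12 * ‖S.poisson (2 ^ l) (normLp ((2 : ℝ) ^ l • S.dPoisson (2 ^ l) f)) x‖ₑ) ^ q
  calc _ ≤ ∫⁻ t in Ioc (2 * (2 : ℝ) ^ l) (2 * (2 * 2 ^ l)), K * (ENNReal.ofReal t)⁻¹ := by
        refine setLIntegral_mono (by fun_prop) fun t ht => ?_
        rw [div_eq_mul_inv]
        refine mul_le_mul_left (ENNReal.rpow_le_rpow (hx l t ⟨ht.1, ht.2.trans_eq (by ring)⟩)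
          (by linarith)) _
    _ ≤ K := by
        rw [lintegral_const_mul _ (by fun_prop)]
        exact (mul_le_mul_right (lintegral_inv_Ioc_two_mul_le (by positivity)) K).trans_eq (mul_one K)

/-- A bound for the dyadic square functions of `f` over all finite ranges bounds the `g`-function
of `f` in `L^p`. -/
theorem exists_gFunction_le (h1p : 1 < p) (hp : p ≠ ∞) {q : ℝ} (hq : 1 < q) :
    ∃ C : ℝ≥0∞, C ≠ ∞ ∧ ∀ (B : Type*) [NormedAddCommGroup B] [NormedSpace ℝ B] [CompleteSpace B]
      (f : Lp B p μ) (K : ℝ≥0∞),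
      (∀ N : ℕ, mixedPow μ q p.toReal (fun l : ↥(Finset.Icc (-N : ℤ) N) =>
        ((2 : ℝ) ^ (l : ℤ) • S.dPoisson (2 ^ (l : ℤ)) f : Lp B p μ)) ≤ K) →
      eLpNorm (S.gFunction q f) p μ ^ p.toReal ≤ C * K := by
  obtain ⟨C, hC, hstein⟩ := S.exists_stein_const h1p hp hq
  have hP : 0 < p.toReal := ENNReal.toReal_pos (zero_lt_one.trans h1p).ne' hp
  have hq0 : 0 < q := by linarith
  refine ⟨12 ^ p.toReal * C, ENNReal.mul_ne_top (by simp) hC, ?_⟩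
  intro B _ _ _ f K hK
  set m : ℤ → Lp ℝ p μ := fun l =>
    S.poisson (2 ^ l) (normLp ((2 : ℝ) ^ l • S.dPoisson (2 ^ l) f)) with hm
  have hmono : Monotone fun N : ℕ => Finset.Icc (-N : ℤ) N := fun M N h =>
    Finset.Icc_subset_Icc (by simpa using h) (by simpa using h)
  have htop : Tendsto (fun N : ℕ => Finset.Icc (-N : ℤ) N) atTop atTop :=
    tendsto_atTop_finset_of_monotone hmono fun l => ⟨l.natAbs, by
      rw [Finset.mem_Icc]; omega⟩
  have hfin : ∀ N : ℕ, ∫⁻ x, (∑ l ∈ Finset.Icc (-N : ℤ) N, ‖m l x‖ₑ ^ q) ^ (p.toReal / q) ∂μ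
      ≤ C * K := by
    intro N
    have h1 := hstein ↥(Finset.Icc (-N : ℤ) N) (fun l => 2 ^ (l : ℤ)) (fun l => by positivity)
      (fun l => normLp ((2 : ℝ) ^ (l : ℤ) • S.dPoisson (2 ^ (l : ℤ)) f)) fun l => normLp_nonneg _
    have h2 : mixedPow μ q p.toReal (fun l : ↥(Finset.Icc (-N : ℤ) N) =>
        normLp ((2 : ℝ) ^ (l : ℤ) • S.dPoisson (2 ^ (l : ℤ)) f)) ≤ K :=
      (mixedPow_mono hq0.le hP.le fun l => (ae_enorm_normLp _).mono fun x hx => hx.le).trans (hK N)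
    refine le_trans (le_of_eq ?_) (h1.trans (mul_le_mul_right h2 C))
    unfold mixedPow
    refine lintegral_congr fun x => ?_
    rw [← Finset.sum_coe_sort (Finset.Icc (-N : ℤ) N)]
  have hsup : ∫⁻ x, (∑' l : ℤ, ‖m l x‖ₑ ^ q) ^ (p.toReal / q) ∂μ ≤ C * K := by
    have hlim : ∀ x, Tendsto (fun N : ℕ =>
        (∑ l ∈ Finset.Icc (-N : ℤ) N, ‖m l x‖ₑ ^ q) ^ (p.toReal / q)) atTop
        (𝓝 ((∑' l : ℤ, ‖m l x‖ₑ ^ q) ^ (p.toReal / q))) := fun x =>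
      ((ENNReal.continuous_rpow_const).tendsto _).comp (ENNReal.summable.hasSum.comp htop)
    refine le_of_tendsto' (lintegral_tendsto_of_tendsto_of_monotone (fun N => ?_)
      (Eventually.of_forall fun x M N h => ?_) (Eventually.of_forall hlim)) hfin
    · refine AEMeasurable.pow_const ?_ _
      exact Finset.aemeasurable_fun_sum _ fun l _ => (aemeasurable_enorm_Lp (m l)).pow_const _
    · exact ENNReal.rpow_le_rpow (Finset.sum_le_sum_of_subset (hmono h)) (by positivity)
  rw [eLpNorm_eq_lintegral_rpow_enorm_toReal (zero_lt_one.trans h1p).ne' hp, ← ENNReal.rpow_mul,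
    one_div_mul_cancel hP.ne', ENNReal.rpow_one]
  calc ∫⁻ x, ‖S.gFunction q f x‖ₑ ^ p.toReal ∂μ
      ≤ ∫⁻ x, 12 ^ p.toReal * (∑' l : ℤ, ‖m l x‖ₑ ^ q) ^ (p.toReal / q) ∂μ := by
        refine lintegral_mono_ae ?_
        filter_upwards [S.gFunction_rpow_le_tsum h1p hp hq f] with x hx
        rw [enorm_eq_self]
        calc S.gFunction q f x ^ p.toReal
            = (S.gFunction q f x ^ q) ^ (p.toReal / q) := by
              rw [← ENNReal.rpow_mul, mul_div_cancel₀ _ hq0.ne']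
          _ ≤ (∑' l : ℤ, (12 * ‖m l x‖ₑ) ^ q) ^ (p.toReal / q) :=
              ENNReal.rpow_le_rpow hx (by positivity)
          _ = _ := by
              simp only [ENNReal.mul_rpow_of_nonneg _ _ hq0.le]
              rw [ENNReal.tsum_mul_left, ENNReal.mul_rpow_of_nonneg _ _ (by positivity),
                ← ENNReal.rpow_mul, mul_div_cancel₀ _ hq0.ne']
    _ ≤ _ := by
        rw [lintegral_const_mul' _ _ (by simp), mul_assoc]
        exact mul_le_mul_right hsup _

end SymmetricDiffusionSemigroup

/-! ### The `g`-functions control the pairing up to the fixed points -/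

section RealVariable

open Set

/-- A point where the mean value theorem makes `ξ φ'(ξ)` small. -/
theorem exists_abs_mul_deriv_le {φ φ' : ℝ → ℝ} (h1 : ∀ t, 0 < t → HasDerivAt φ (φ' t) t) {a : ℝ}
    (ha : 0 < a) : ∃ ξ ∈ Ioo a (2 * a), |ξ * φ' ξ| ≤ 2 * |φ (2 * a) - φ a| := by
  obtain ⟨ξ, hξ, h⟩ := exists_hasDerivAt_eq_slope φ φ' (show a < 2 * a by linarith)
    (fun t ht => (h1 t (ha.trans_le ht.1)).continuousAt.continuousWithinAt)
    fun t ht => h1 t (ha.trans ht.1)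
  refine ⟨ξ, hξ, ?_⟩
  have hξ0 : 0 < ξ := ha.trans hξ.1
  rw [h, show 2 * a - a = a by ring, abs_mul, abs_div, abs_of_pos hξ0, abs_of_pos ha]
  calc ξ * (|φ (2 * a) - φ a| / a) ≤ (2 * a) * (|φ (2 * a) - φ a| / a) :=
        mul_le_mul_of_nonneg_right hξ.2.le (by positivity)
    _ = 2 * |φ (2 * a) - φ a| := by field_simp

/-- `φ(0+) - φ(∞) = ∫_0^∞ t φ''(t) dt`, as an inequality. An antiderivative of `t φ''` is
`t φ' - φ`, and `t φ'(t)` is small along some sequences tending to `0` and to `∞`. -/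
theorem ofReal_abs_sub_le_of_deriv2 {φ φ' φ'' : ℝ → ℝ} (h1 : ∀ t, 0 < t → HasDerivAt φ (φ' t) t)
    (h2 : ∀ t, 0 < t → HasDerivAt φ' (φ'' t) t) (h3 : ContinuousOn φ'' (Ioi 0)) {L₀ L₁ : ℝ}
    (h0 : Tendsto φ (𝓝[>] 0) (𝓝 L₀)) (hinf : Tendsto φ atTop (𝓝 L₁)) :
    ENNReal.ofReal |L₀ - L₁| ≤ ∫⁻ t in Ioi (0 : ℝ), ENNReal.ofReal t * ‖φ'' t‖ₑ := by
  set M := ∫⁻ t in Ioi (0 : ℝ), ENNReal.ofReal t * ‖φ'' t‖ₑ with hM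
  set G : ℝ → ℝ := fun t => t * φ' t - φ t with hG
  have hGd : ∀ t, 0 < t → HasDerivAt G (t * φ'' t) t := by
    intro t ht
    have h := ((hasDerivAt_id t).mul (h2 t ht)).sub (h1 t ht)
    convert! h using 1
    simp
  have hFTC : ∀ a b, 0 < a → a ≤ b → ENNReal.ofReal |G b - G a| ≤ M := by
    intro a b ha hab
    have hc : ContinuousOn (fun t => t * φ'' t) (uIcc a b) := by
      rw [uIcc_of_le hab]
      exact continuousOn_id.mul (h3.mono fun t ht => ha.trans_le ht.1)
    have h := intervalIntegral.integral_eq_sub_of_hasDerivAt (f := G) (f' := fun t => t * φ'' t)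
      (a := a) (b := b) (fun t ht => hGd t (by
        rw [uIcc_of_le hab] at ht
        exact ha.trans_le ht.1)) hc.intervalIntegrable
    rw [← h, ← Real.enorm_eq_ofReal_abs, intervalIntegral.integral_of_le hab]
    refine (enorm_integral_le_lintegral_enorm _).trans ?_
    calc ∫⁻ t in Ioc a b, ‖t * φ'' t‖ₑ = ∫⁻ t in Ioc a b, ENNReal.ofReal t * ‖φ'' t‖ₑ := by
          refine setLIntegral_congr_fun measurableSet_Ioc fun t ht => ?_
          rw [enorm_mul, Real.enorm_eq_ofReal (ha.trans ht.1).le]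
      _ ≤ M := lintegral_mono_set fun t ht => ha.trans ht.1
  have hhalf : ∀ n : ℕ, (0 : ℝ) < (1 / 2) ^ (n + 1) := fun n => by positivity
  have htwo : ∀ n : ℕ, (0 : ℝ) < 2 ^ n := fun n => by positivity
  choose ξ hξ hξb using fun n : ℕ => exists_abs_mul_deriv_le h1 (hhalf n)
  choose η hη hηb using fun n : ℕ => exists_abs_mul_deriv_le h1 (htwo n)
  have t1 : Tendsto (fun n : ℕ => (1 / 2 : ℝ) ^ (n + 1)) atTop (𝓝 0) :=
    (tendsto_pow_atTop_nhds_zero_of_lt_one (by norm_num) (by norm_num)).comp (tendsto_add_atTop_nat 1)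
  have t2 : Tendsto (fun n : ℕ => 2 * (1 / 2 : ℝ) ^ (n + 1)) atTop (𝓝 0) := by
    simpa using t1.const_mul 2
  have t3 : Tendsto (fun n : ℕ => (2 : ℝ) ^ n) atTop atTop :=
    tendsto_pow_atTop_atTop_of_one_lt one_lt_two
  have t4 : Tendsto (fun n : ℕ => 2 * (2 : ℝ) ^ n) atTop atTop :=
    t3.const_mul_atTop two_pos
  have up : ∀ {v : ℕ → ℝ}, Tendsto v atTop (𝓝 0) → (∀ n, 0 < v n) →
      Tendsto (fun n => φ (v n)) atTop (𝓝 L₀) := fun hv hv0 =>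
    h0.comp (tendsto_nhdsWithin_iff.2 ⟨hv, Eventually.of_forall hv0⟩)
  have hξ0 : ∀ n, 0 < ξ n := fun n => (hhalf n).trans (hξ n).1
  have tξ : Tendsto ξ atTop (𝓝 0) :=
    tendsto_of_tendsto_of_tendsto_of_le_of_le t1 t2 (fun n => (hξ n).1.le) fun n => (hξ n).2.le
  have tη : Tendsto η atTop atTop := tendsto_atTop_mono (fun n => (hη n).1.le) t3
  have small : ∀ {v w : ℕ → ℝ} {L : ℝ}, Tendsto v atTop (𝓝 L) → Tendsto w atTop (𝓝 L) →
      Tendsto (fun n => 2 * |v n - w n|) atTop (𝓝 0) := fun hv hw => by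
    simpa using ((hv.sub hw).abs).const_mul 2
  have d1 : Tendsto (fun n => ξ n * φ' (ξ n)) atTop (𝓝 0) :=
    squeeze_zero_norm hξb (small (up t2 fun n => mul_pos two_pos (hhalf n)) (up t1 hhalf))
  have d2 : Tendsto (fun n => η n * φ' (η n)) atTop (𝓝 0) :=
    squeeze_zero_norm hηb (small (hinf.comp t4) (hinf.comp t3))
  have g1 : Tendsto (fun n => G (ξ n)) atTop (𝓝 (0 - L₀)) := d1.sub (up tξ hξ0)
  have g2 : Tendsto (fun n => G (η n)) atTop (𝓝 (0 - L₁)) := d2.sub (hinf.comp tη)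
  have g3 : Tendsto (fun n => ENNReal.ofReal |G (η n) - G (ξ n)|) atTop
      (𝓝 (ENNReal.ofReal |L₀ - L₁|)) := by
    have := ENNReal.tendsto_ofReal (g2.sub g1).abs
    rwa [show 0 - L₁ - (0 - L₀) = L₀ - L₁ by ring] at this
  refine le_of_tendsto' g3 fun n => hFTC _ _ (hξ0 n) ?_
  have e1 : 2 * (1 / 2 : ℝ) ^ (n + 1) ≤ 1 := by
    rw [pow_succ]
    have : (1 / 2 : ℝ) ^ n ≤ 1 := pow_le_one₀ (by norm_num) (by norm_num)
    linarith
  exact ((hξ n).2.le.trans e1).trans ((one_le_pow₀ one_le_two).trans (hη n).1.le)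

/-- Hölder's inequality with respect to `dt / t`. -/
theorem lintegral_mul_mul_le {q q' : ℝ} (hq : q.HolderConjugate q') {a b : ℝ → ℝ≥0∞}
    (ha : Measurable a) (hb : Measurable b) :
    ∫⁻ t in Ioi (0 : ℝ), ENNReal.ofReal t * (a t * b t)
      ≤ (∫⁻ t in Ioi (0 : ℝ), (ENNReal.ofReal t * a t) ^ q' / ENNReal.ofReal t) ^ (1 / q')
        * (∫⁻ t in Ioi (0 : ℝ), (ENNReal.ofReal t * b t) ^ q / ENNReal.ofReal t) ^ (1 / q) := by
  have hpow : ∀ {r : ℝ}, 0 < r → ∀ y t : ℝ≥0∞, (y * t ^ (-r⁻¹)) ^ r = y ^ r / t := by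
    intro r hr y t
    rw [ENNReal.mul_rpow_of_nonneg _ _ hr.le, ← ENNReal.rpow_mul, neg_mul,
      inv_mul_cancel₀ hr.ne', ENNReal.rpow_neg_one, div_eq_mul_inv]
  have h := ENNReal.lintegral_mul_le_Lp_mul_Lq (volume.restrict (Ioi (0 : ℝ))) hq.symm
    (f := fun t => ENNReal.ofReal t * a t * ENNReal.ofReal t ^ (-q'⁻¹))
    (g := fun t => ENNReal.ofReal t * b t * ENNReal.ofReal t ^ (-q⁻¹))
    (by fun_prop) (by fun_prop)
  simp only [hpow hq.pos, hpow hq.symm.pos] at h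
  refine le_trans (le_of_eq ?_) h
  refine setLIntegral_congr_fun measurableSet_Ioi fun t ht => ?_
  have h0 : ENNReal.ofReal t ≠ 0 := (ENNReal.ofReal_pos.2 ht).ne'
  have h1 : ENNReal.ofReal t ^ (-q'⁻¹) * ENNReal.ofReal t ^ (-q⁻¹) = (ENNReal.ofReal t)⁻¹ := by
    rw [← ENNReal.rpow_add _ _ h0 ENNReal.ofReal_ne_top, ← neg_add, add_comm,
      hq.inv_add_inv_eq_one, ENNReal.rpow_neg_one]
  simp only [Pi.mul_apply]
  calc ENNReal.ofReal t * (a t * b t)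
      = ENNReal.ofReal t * (ENNReal.ofReal t * (ENNReal.ofReal t)⁻¹) * (a t * b t) := by
        rw [ENNReal.mul_inv_cancel h0 ENNReal.ofReal_ne_top, mul_one]
    _ = _ := by rw [← h1]; ring

end RealVariable

section Norming

variable {Ω : Type*} [MeasurableSpace Ω] {μ : Measure Ω} {p p' : ℝ≥0∞} [Fact (1 ≤ p)]
  [Fact (1 ≤ p')] {B B' : Type*} [NormedAddCommGroup B] [NormedSpace ℝ B]
  [NormedAddCommGroup B'] [NormedSpace ℝ B']

theorem lpPairing_flip [ENNReal.HolderConjugate p' p] [ENNReal.HolderConjugate p p']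
    (β : B' →L[ℝ] B →L[ℝ] ℝ) (g : Lp B' p' μ) (f : Lp B p μ) :
    β.flip.lpPairing μ p p' f g = β.lpPairing μ p' p g f := by
  rw [ContinuousLinearMap.lpPairing_eq_integral, ContinuousLinearMap.lpPairing_eq_integral]
  rfl

theorem mixedPow_unit {E : Type*} [NormedAddCommGroup E] {q : ℝ} (hq : 0 < q) (hp0 : p ≠ 0)
    (hp : p ≠ ∞) (f : Lp E p μ) : mixedPow μ q p.toReal (fun _ : Unit => f) = ‖f‖ₑ ^ p.toReal := by
  simp only [mixedPow, Finset.univ_unique, Finset.sum_singleton, ← ENNReal.rpow_mul,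
    mul_div_cancel₀ _ hq.ne']
  rw [lintegral_enorm_rpow_eq hp0 hp, Lp.enorm_def]

theorem ofReal_lpPairing_le [ENNReal.HolderConjugate p' p] (hp : p ≠ ∞) (hp' : p' ≠ ∞)
    {β : B' →L[ℝ] B →L[ℝ] ℝ} (hβ : ‖β‖ ≤ 1) (g : Lp B' p' μ) (f : Lp B p μ) :
    ENNReal.ofReal (β.lpPairing μ p' p g f) ≤ ‖g‖ₑ * ‖f‖ₑ := by
  have hP := toReal_holderConjugate (p := p) (p' := p') hp hp'
  have hp0 : p ≠ 0 := (zero_lt_one.trans_le (Fact.out : 1 ≤ p)).ne'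
  have hp0' : p' ≠ 0 := (zero_lt_one.trans_le (Fact.out : 1 ≤ p')).ne'
  have h := sum_lpPairing_le hβ hP hP (fun _ : Unit => g) (fun _ : Unit => f)
  rw [mixedPow_unit hP.symm.pos hp0' hp', mixedPow_unit hP.pos hp0 hp, ← ENNReal.rpow_mul,
    ← ENNReal.rpow_mul, mul_one_div_cancel hP.symm.pos.ne', mul_one_div_cancel hP.pos.ne',
    ENNReal.rpow_one, ENNReal.rpow_one] at h
  simpa using h

/-- The pairing with `L^p_B` norms `L^{p'}_{B'}` up to a factor `4`. -/
theorem enorm_le_of_forall_lpPairing_le [ENNReal.HolderConjugate p' p]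
    [ENNReal.HolderConjugate p p'] (hp : p ≠ ∞) (hp' : p' ≠ ∞) {β : B' →L[ℝ] B →L[ℝ] ℝ}
    (hβ : ‖β‖ ≤ 1) (hn : ∀ b', ∃ b, ‖b‖ ≤ 1 ∧ ‖b'‖ / 2 ≤ β b' b) {g : Lp B' p' μ} {K : ℝ≥0∞}
    (h : ∀ f : Lp B p μ, ENNReal.ofReal (β.lpPairing μ p' p g f) ≤ K * ‖f‖ₑ) :
    ‖g‖ₑ ≤ 4 * K := by
  have hP := toReal_holderConjugate (p := p') (p' := p) hp' hp
  have hp0 : p ≠ 0 := (zero_lt_one.trans_le (Fact.out : 1 ≤ p)).ne'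
  have hp0' : p' ≠ 0 := (zero_lt_one.trans_le (Fact.out : 1 ≤ p')).ne'
  obtain ⟨f, h1, h2⟩ := exists_norming_family (p := p') (p' := p) hp' hp (β := β.flip)
    (by rwa [ContinuousLinearMap.opNorm_flip]) hn hP hP (fun _ : Unit => g)
  simp only [Finset.univ_unique, Finset.sum_singleton, lpPairing_flip] at h2
  have hf : (fun i : Unit => (f i : Ω → B)) = fun _ : Unit => (f () : Ω → B) := rfl
  rw [hf, mixedPow_unit hP.symm.pos hp0 hp, mixedPow_unit hP.pos hp0' hp'] at h1
  rw [mixedPow_unit hP.pos hp0' hp'] at h2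
  have h3 : ‖f ()‖ₑ ≤ (‖g‖ₑ ^ p'.toReal) ^ (1 / p.toReal) := by
    rw [one_div, ENNReal.le_rpow_inv_iff hP.symm.pos]
    exact h1
  have h4 : ‖g‖ₑ ^ p'.toReal ≤ 4 * K * (‖g‖ₑ ^ p'.toReal) ^ (1 / p.toReal) :=
    h2.trans ((mul_le_mul_right (h (f ())) 4).trans (by
      rw [← mul_assoc]
      exact mul_le_mul_right h3 _))
  have h5 := rpow_one_sub_le_of_le_mul_rpow (ENNReal.rpow_ne_top_of_nonneg hP.pos.le enorm_ne_top)
    (by rw [div_lt_one hP.symm.pos]; exact hP.symm.lt) h4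
  rwa [← ENNReal.rpow_mul, one_div, hP.symm.one_sub_inv, mul_inv_cancel₀ hP.pos.ne', ENNReal.rpow_one] at h5

end Norming

namespace SymmetricDiffusionSemigroup

open Set

variable {Ω : Type*} [MeasurableSpace Ω] {μ : Measure Ω} (S : SymmetricDiffusionSemigroup μ)
  {p p' : ℝ≥0∞} [Fact (1 ≤ p)] [Fact (1 ≤ p')]
  {B B' : Type*} [NormedAddCommGroup B] [NormedSpace ℝ B] [CompleteSpace B]
  [NormedAddCommGroup B'] [NormedSpace ℝ B'] [CompleteSpace B']

omit [CompleteSpace B] [CompleteSpace B'] in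
theorem lintegral_enormDeriv_mul_le {q q' : ℝ} (hq : q.HolderConjugate q') (g : Lp B' p' μ)
    (f : Lp B p μ) (x : Ω) :
    ∫⁻ t in Ioi (0 : ℝ), ENNReal.ofReal t * (S.enormDeriv g (t, x) * S.enormDeriv f (t, x))
      ≤ S.gProxy q' g x * S.gProxy q f x := by
  exact lintegral_mul_mul_le hq ((S.measurable_enormDeriv g).comp measurable_prodMk_right)
    ((S.measurable_enormDeriv f).comp measurable_prodMk_right)

/-- The `g`-functions of `g` and `f` control the pairing of `g` and `f` modulo the fixed
points: apply `ofReal_abs_sub_le_of_deriv2` to `φ(t) = ⟨P_{2t} g, f⟩`, for which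
`φ''(t) = 4 ⟨∂P_t g, ∂P_t f⟩` by the semigroup law and symmetry. -/
theorem ofReal_abs_lpPairing_sub_le [ENNReal.HolderConjugate p' p] (h1p : 1 < p) (hp : p ≠ ∞)
    (h1p' : 1 < p') (hp' : p' ≠ ∞) {β : B' →L[ℝ] B →L[ℝ] ℝ} (hβ : ‖β‖ ≤ 1) {q q' : ℝ}
    (hq : q.HolderConjugate q') (g : Lp B' p' μ) (f : Lp B p μ) :
    ENNReal.ofReal |β.lpPairing μ p' p g f - β.lpPairing μ p' p (S.fixProj g) f|
      ≤ 4 * (eLpNorm (S.gFunction q' g) p' μ * eLpNorm (S.gFunction q f) p μ) := by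
  have hT := S.isContractionSemigroup_bochnerT (B := B') h1p' hp'
  have hP := toReal_holderConjugate (p := p) (p' := p') hp hp'
  set Λ : Lp B' p' μ →L[ℝ] ℝ := (β.lpPairing μ p' p).flip f with hΛ
  have hcomp : ∀ {u : ℝ → Lp B' p' μ} {u' : Lp B' p' μ} {t : ℝ}, HasDerivAt u u' (2 * t) →
      HasDerivAt (fun t => Λ (u (2 * t))) (2 * Λ u') t := by
    intro u u' t h
    have h1 : HasDerivAt (fun t : ℝ => 2 * t) 2 t := by simpa using (hasDerivAt_id t).const_mul (2 : ℝ)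
    have h2 : HasDerivAt (fun t => Λ (u (2 * t))) (Λ ((2 : ℝ) • u')) t :=
      Λ.hasFDerivAt.comp_hasDerivAt t (HasDerivAt.scomp (h := fun t : ℝ => 2 * t) t h h1)
    rwa [map_smul, smul_eq_mul] at h2
  have hψ : ∀ t, 0 < t → 2 * (2 * Λ (subordDeriv2 (fun s => S.bochnerT s) (2 * t) g))
      = 4 * β.lpPairing μ p' p (S.dPoisson t g) (S.dPoisson t f) := by
    intro t ht
    have h1 := hT.subordDeriv2_add ht ht g
    rw [← two_mul] at h1
    have h2 := S.lpPairing_kernelOp h1p hp h1p' hp' β (integrableOn_subordKernelDeriv ht)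
      (S.dPoisson t g) f
    rw [h1, hΛ, ContinuousLinearMap.flip_apply]
    rw [subordDeriv, h2]
    ring_nf
    rfl
  have key := ofReal_abs_sub_le_of_deriv2
    (φ := fun t => Λ (S.poisson (2 * t) g))
    (φ' := fun t => 2 * Λ (S.dPoisson (2 * t) g))
    (φ'' := fun t => 2 * (2 * Λ (subordDeriv2 (fun s => S.bochnerT s) (2 * t) g)))
    (L₀ := Λ g) (L₁ := Λ (S.fixProj g))
    (fun t ht => hcomp (u := fun t => S.poisson t g) (hT.hasDerivAt_subordinate (by positivity) g))
    (fun t ht => (hcomp (u := fun t => S.dPoisson t g)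
      (hT.hasDerivAt_subordDeriv (by positivity) g)).const_mul 2) ?_ ?_ ?_
  · refine key.trans ?_
    -- `μ` need not be s-finite, so that the order of integration is exchanged on a set `s` only
    obtain ⟨s, hsm, hsf, hs⟩ := exists_sFinite_restrict (zero_lt_one.trans h1p).ne' hp
      (fun r : ℕ × ℤ => S.dPoisson ((r.2 : ℝ) / 2 ^ r.1) f)
    have hs' : ∀ᵐ x ∂μ, x ∉ s → ∀ t, S.enormDeriv f (t, x) = 0 := by
      filter_upwards [ae_all_iff.2 hs] with x hx hxs t
      have : ∀ n, ‖(S.dPoisson (dyadicApprox n t) f : Ω → B) x‖ₑ = 0 := fun n => by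
        rw [enorm_eq_zero]
        exact hx (n, ⌈t * 2 ^ n⌉) hxs
      simp only [enormDeriv, this, limsup_const]
    have hb : ∀ t, 0 < t → ‖2 * (2 * Λ (subordDeriv2 (fun s => S.bochnerT s) (2 * t) g))‖ₑ
        ≤ 4 * ∫⁻ x in s, S.enormDeriv g (t, x) * S.enormDeriv f (t, x) ∂μ := by
      intro t ht
      rw [hψ t ht, enorm_mul]
      refine mul_le_mul' (by simp [Real.enorm_eq_ofReal]) ?_
      refine (enorm_lpPairing_le_lintegral hβ _ _).trans ?_
      rw [← lintegral_indicator hsm]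
      refine lintegral_mono_ae ?_
      filter_upwards [hs', S.enormDeriv_eq h1p hp f, S.enormDeriv_eq h1p' hp' g,
        S.poissonDeriv_ae_eq h1p hp ht f, S.poissonDeriv_ae_eq h1p' hp' ht g] with x a b c d e
      by_cases hx : x ∈ s
      · rw [indicator_of_mem hx, b t ht, c t ht, d, e]
      · rw [← d, ← b t ht, a hx t, mul_zero]
        exact zero_le
    have hmeas : Measurable fun z : ℝ × Ω =>
        ENNReal.ofReal z.1 * (S.enormDeriv g z * S.enormDeriv f z) :=
      (ENNReal.measurable_ofReal.comp measurable_fst).mul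
        ((S.measurable_enormDeriv g).mul (S.measurable_enormDeriv f))
    have hmeas' : ∀ t : ℝ, Measurable fun x : Ω => S.enormDeriv g (t, x) * S.enormDeriv f (t, x) :=
      fun t => ((S.measurable_enormDeriv g).mul (S.measurable_enormDeriv f)).comp measurable_prodMk_left
    calc _ ≤ ∫⁻ t in Ioi (0 : ℝ), 4 * ∫⁻ x in s,
          ENNReal.ofReal t * (S.enormDeriv g (t, x) * S.enormDeriv f (t, x)) ∂μ := by
          refine setLIntegral_mono' measurableSet_Ioi fun t ht => ?_
          rw [lintegral_const_mul _ (hmeas' t), mul_left_comm 4]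
          exact mul_le_mul_right (hb t ht) _
      _ = 4 * ∫⁻ x in s, (∫⁻ t in Ioi (0 : ℝ),
          ENNReal.ofReal t * (S.enormDeriv g (t, x) * S.enormDeriv f (t, x))) ∂μ := by
          rw [lintegral_const_mul' _ _ (by norm_num)]
          congr 1
          exact lintegral_lintegral_swap hmeas.aemeasurable
      _ ≤ 4 * ∫⁻ x, S.gProxy q' g x * S.gProxy q f x ∂μ :=
          mul_le_mul_right ((setLIntegral_le_lintegral _ _).trans
            (lintegral_mono fun x => S.lintegral_enormDeriv_mul_le hq g f x)) _
      _ ≤ _ := by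
          refine mul_le_mul_right ?_ _
          rw [eLpNorm_congr_ae (S.gFunction_ae_eq h1p' hp' q' g),
            eLpNorm_congr_ae (S.gFunction_ae_eq h1p hp q f),
            eLpNorm_eq_lintegral_rpow_enorm_toReal (zero_lt_one.trans h1p).ne' hp,
            eLpNorm_eq_lintegral_rpow_enorm_toReal (zero_lt_one.trans h1p').ne' hp']
          exact ENNReal.lintegral_mul_le_Lp_mul_Lq μ hP.symm
            (S.measurable_gProxy q' g).aemeasurable (S.measurable_gProxy q f).aemeasurable
  · have h := hT.continuousOn_subordDeriv2 g
    have h2 : ContinuousOn (fun t : ℝ => subordDeriv2 (fun s => S.bochnerT s) (2 * t) g) (Ioi 0) :=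
      h.comp (by fun_prop) fun t ht => mul_pos two_pos (mem_Ioi.1 ht)
    exact ((Λ.continuous.comp_continuousOn h2).const_mul 2).const_mul 2
  · have h := (Λ.continuous.tendsto g).comp (hT.tendsto_subordinate g)
    refine h.comp (tendsto_nhdsWithin_iff.2 ⟨?_, ?_⟩)
    · have : Tendsto (fun t : ℝ => 2 * t) (𝓝 0) (𝓝 (2 * 0)) := tendsto_id.const_mul 2
      rw [mul_zero] at this
      exact this.mono_left nhdsWithin_le_nhds
    · filter_upwards [self_mem_nhdsWithin] with t ht using mul_pos two_pos (mem_Ioi.1 ht)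
  · exact (Λ.continuous.tendsto _).comp ((S.tendsto_poisson_fixProj h1p' hp' g).comp
      (tendsto_id.const_mul_atTop two_pos))

end SymmetricDiffusionSemigroup

/-! ### Almost orthogonality of the dyadic pieces -/

/-- The decay factor `2^{-|k|}`. -/
def dyadicWeight (k : ℤ) : ℝ≥0 := (1 / 2) ^ k.natAbs

theorem dyadicWeight_neg (k : ℤ) : dyadicWeight (-k) = dyadicWeight k := by
  rw [dyadicWeight, Int.natAbs_neg, dyadicWeight]

theorem summable_dyadicWeight : Summable dyadicWeight := by
  rw [← NNReal.summable_coe]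
  have h : Summable fun n : ℕ => ((1 / 2 : ℝ)) ^ n := summable_geometric_two
  refine Summable.of_nat_of_neg ?_ ?_
  · simpa [dyadicWeight] using h
  · simpa [dyadicWeight] using h

theorem sum_dyadicWeight_le (s : Finset ℤ) (j : ℤ) :
    ∑ l : s, (dyadicWeight (j - l) : ℝ≥0∞) ≤ ((∑' k, dyadicWeight k : ℝ≥0) : ℝ≥0∞) := by
  rw [Finset.sum_coe_sort s fun l => (dyadicWeight (j - l) : ℝ≥0∞)]
  rw [ENNReal.coe_tsum summable_dyadicWeight,
    ← (Equiv.subLeft j).tsum_eq fun k => (dyadicWeight k : ℝ≥0∞)]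
  exact ENNReal.sum_le_tsum s

/-- The product `2^j 2^l` is `2^{-|j-l|}` times the square of the larger factor. -/
theorem zpow_mul_zpow_le_dyadicWeight (j l : ℤ) :
    (2 : ℝ) ^ j * 2 ^ l ≤ dyadicWeight (j - l) * (2 ^ j + 2 ^ l) ^ 2 := by
  wlog h : l ≤ j generalizing j l
  · have := this l j (by omega)
    rw [← dyadicWeight_neg, neg_sub] at this
    linarith
  obtain ⟨n, rfl⟩ : ∃ n : ℕ, j = l + n := ⟨(j - l).toNat, by omega⟩
  have h1 : (dyadicWeight (l + n - l) : ℝ) = (2 ^ n)⁻¹ := by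
    rw [add_sub_cancel_left, dyadicWeight]
    simp
  rw [h1, zpow_add₀ two_ne_zero, zpow_natCast, ← div_eq_inv_mul, le_div_iff₀ (by positivity)]
  have ha : (0 : ℝ) < 2 ^ l := by positivity
  have hb : (0 : ℝ) < 2 ^ n := by positivity
  generalize (2 : ℝ) ^ l = a at *
  generalize (2 : ℝ) ^ n = b at *
  nlinarith [mul_pos ha hb, mul_pos ha ha, mul_pos (mul_pos ha ha) hb]

/-- Schur's test for a kernel with bounded row and column sums. -/
theorem sum_sum_weight_rpow_le {ι κ : Type*} [Fintype ι] [Fintype κ] {q : ℝ} (hq : 1 ≤ q)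
    (w : ι → κ → ℝ≥0∞) (W : ℝ≥0∞) (hW : ∀ j, ∑ l, w j l ≤ W) (a : ι → κ → ℝ≥0∞) :
    ∑ j, (∑ l, w j l * a j l) ^ q ≤ W ^ (q - 1) * ∑ z : ι × κ, w z.1 z.2 * a z.1 z.2 ^ q := by
  have hq0 : 0 < q := by linarith
  rw [Fintype.sum_prod_type, Finset.mul_sum]
  refine Finset.sum_le_sum fun j _ => ?_
  calc (∑ l, w j l * a j l) ^ q
      ≤ ((∑ l, w j l) ^ (1 - q⁻¹) * (∑ l, w j l * a j l ^ q) ^ q⁻¹) ^ q :=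
        ENNReal.rpow_le_rpow (ENNReal.inner_le_weight_mul_Lp_of_nonneg _ hq _ _) hq0.le
    _ = (∑ l, w j l) ^ (q - 1) * ∑ l, w j l * a j l ^ q := by
        rw [ENNReal.mul_rpow_of_nonneg _ _ hq0.le, ← ENNReal.rpow_mul, ← ENNReal.rpow_mul,
          inv_mul_cancel₀ hq0.ne', ENNReal.rpow_one, sub_mul, inv_mul_cancel₀ hq0.ne', one_mul]
    _ ≤ _ := mul_le_mul_left (ENNReal.rpow_le_rpow (hW j) (by linarith)) _

namespace SymmetricDiffusionSemigroup

open Set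

variable {Ω : Type*} [MeasurableSpace Ω] {μ : Measure Ω} (S : SymmetricDiffusionSemigroup μ)
  {p p' : ℝ≥0∞} [Fact (1 ≤ p)] [Fact (1 ≤ p')]

section AlmostOrthogonality

variable {B : Type*} [NormedAddCommGroup B] [NormedSpace ℝ B] [CompleteSpace B]

/-- The synthesis operator `(h_l) ↦ ∑_l 2^l ∂P_{2^l} h_l`. -/
def dyadicSum {s : Finset ℤ} (h : s → Lp B p μ) : Lp B p μ :=
  ∑ l : s, (2 : ℝ) ^ (l : ℤ) • S.dPoisson (2 ^ (l : ℤ)) (h l)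

theorem dPoisson_dyadicSum (h1p : 1 < p) (hp : p ≠ ∞) {s : Finset ℤ} (h : s → Lp B p μ) (j : ℤ) :
    (2 : ℝ) ^ j • S.dPoisson (2 ^ j) (S.dyadicSum h) = ∑ l : s,
      ((2 : ℝ) ^ j * 2 ^ (l : ℤ)) • subordDeriv2 (fun s => S.bochnerT s) (2 ^ j + 2 ^ (l : ℤ)) (h l) := by
  have hT := S.isContractionSemigroup_bochnerT (B := B) h1p hp
  have hj : (0 : ℝ) < 2 ^ j := by positivity
  rw [dyadicSum, dPoisson, ← hT.derivCLM_apply hj, map_sum, Finset.smul_sum]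
  refine Finset.sum_congr rfl fun l _ => ?_
  have hl : (0 : ℝ) < 2 ^ (l : ℤ) := by positivity
  rw [map_smul, smul_smul, hT.derivCLM_apply hj, hT.subordDeriv2_add hj hl]

theorem ae_enorm_smul_subordDeriv2_le (h1p : 1 < p) (hp : p ≠ ∞) (f : Lp B p μ) (j l : ℤ) :
    ∀ᵐ x ∂μ, ‖(((2 : ℝ) ^ j * 2 ^ l) • subordDeriv2 (fun s => S.bochnerT s) (2 ^ j + 2 ^ l) f :
        Lp B p μ) x‖ₑ
      ≤ dyadicWeight (j - l) * (30 * ‖S.poisson ((2 ^ j + 2 ^ l) / 2) (normLp f) x‖ₑ) := by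
  set t : ℝ := 2 ^ j + 2 ^ l with ht
  have ht0 : 0 < t := by positivity
  set D : Lp B p μ := subordDeriv2 (fun s => S.bochnerT s) t f with hD
  set m : Lp ℝ p μ := S.poisson (t / 2) (normLp f)
  filter_upwards [ae_enorm_le_of_le (normLp_nonneg _) (S.normLp_subordDeriv2_le h1p hp ht0 f),
    ae_enorm_normLp (t ^ 2 • D), Lp.coeFn_smul (t ^ 2) D, Lp.coeFn_smul ((2 : ℝ) ^ j * 2 ^ l) D,
    Lp.coeFn_smul (30 : ℝ) m] with x a b c d e
  rw [← hD, b, c, e, Pi.smul_apply, Pi.smul_apply, enorm_smul, enorm_smul] at a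
  rw [d, Pi.smul_apply, enorm_smul]
  have h30 : ‖(30 : ℝ)‖ₑ = 30 := by simp [Real.enorm_eq_ofReal]
  have hw : ‖(2 : ℝ) ^ j * 2 ^ l‖ₑ ≤ dyadicWeight (j - l) * ‖t ^ 2‖ₑ := by
    rw [Real.enorm_eq_ofReal (by positivity), Real.enorm_eq_ofReal (by positivity),
      ← ENNReal.ofReal_coe_nnreal, ← ENNReal.ofReal_mul (by positivity)]
    exact ENNReal.ofReal_le_ofReal (zpow_mul_zpow_le_dyadicWeight j l)
  calc _ ≤ dyadicWeight (j - l) * ‖t ^ 2‖ₑ * ‖D x‖ₑ := mul_le_mul_left hw _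
    _ = dyadicWeight (j - l) * (‖t ^ 2‖ₑ * ‖D x‖ₑ) := mul_assoc _ _ _
    _ ≤ dyadicWeight (j - l) * (30 * ‖m x‖ₑ) := by
        rw [h30] at a
        exact mul_le_mul_right a _

/-- Analysis after synthesis is bounded in the mixed norm: `2^j ∂P_{2^j} 2^l ∂P_{2^l}` is, up to
the factor `2^{-|j-l|}`, dominated by a Poisson operator. -/
theorem exists_mixedPow_dyadicSum_le (h1p : 1 < p) (hp : p ≠ ∞) {q : ℝ} (hq : 1 < q) :
    ∃ C : ℝ≥0∞, C ≠ ∞ ∧ ∀ (B : Type*) [NormedAddCommGroup B] [NormedSpace ℝ B] [CompleteSpace B]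
      (s s' : Finset ℤ) (h : s → Lp B p μ),
      mixedPow μ q p.toReal (fun j : s' =>
        ((2 : ℝ) ^ (j : ℤ) • S.dPoisson (2 ^ (j : ℤ)) (S.dyadicSum h) : Lp B p μ))
      ≤ C * mixedPow μ q p.toReal (fun l => h l) := by
  obtain ⟨C, hC, hstein⟩ := S.exists_stein_const h1p hp hq
  have hP : 0 < p.toReal := ENNReal.toReal_pos (zero_lt_one.trans h1p).ne' hp
  have hq0 : 0 < q := by linarith
  set W : ℝ≥0∞ := ((∑' k, dyadicWeight k : ℝ≥0) : ℝ≥0∞) with hW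
  set K : ℝ≥0∞ := 30 ^ q * W ^ (q - 1) with hK
  have hWt : W ≠ ∞ := ENNReal.coe_ne_top
  have hKt : K ≠ ∞ := ENNReal.mul_ne_top (by simp)
    (ENNReal.rpow_ne_top_of_nonneg (by linarith) hWt)
  refine ⟨K ^ (p.toReal / q) * (C * W ^ (p.toReal / q)), ENNReal.mul_ne_top
    (ENNReal.rpow_ne_top_of_nonneg (by positivity) hKt) (ENNReal.mul_ne_top hC
    (ENNReal.rpow_ne_top_of_nonneg (by positivity) hWt)), ?_⟩
  intro B _ _ _ s s' h
  set τ : s' × s → ℝ := fun z => ((2 : ℝ) ^ (z.1 : ℤ) + 2 ^ (z.2 : ℤ)) / 2 with hτ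
  have hτ0 : ∀ z, 0 < τ z := fun z => by positivity
  set w : s' × s → ℝ≥0 := fun z => dyadicWeight ((z.1 : ℤ) - z.2) with hw
  have hwq : ∀ z, ‖((w z : ℝ) ^ q⁻¹)‖ₑ ^ q = w z := fun z => by
    rw [← NNReal.coe_rpow, Real.enorm_eq_ofReal NNReal.zero_le_coe, ENNReal.ofReal_coe_nnreal,
      ← ENNReal.coe_rpow_of_nonneg _ hq0.le, NNReal.rpow_inv_rpow hq0.ne']
  set m : s' × s → Lp ℝ p μ := fun z => S.poisson (τ z) (normLp (h z.2)) with hm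
  -- the weight enters Stein's inequality as `w^{1/q}` on both sides, so that Schur's test uses
  -- its row sums on the left and its column sums on the right
  set k : s' × s → Lp ℝ p μ := fun z => ((w z : ℝ) ^ q⁻¹) • normLp (h z.2) with hk
  have hmk : ∀ z, S.poisson (τ z) (k z) = ((w z : ℝ) ^ q⁻¹) • m z := fun z => by
    simp only [hk, hm, ← S.poissonCLM_apply h1p hp (hτ0 z), map_smul]
  have h1 := hstein (s' × s) τ hτ0 k fun z => smul_nonneg (by positivity) (normLp_nonneg _)
  have e1 : mixedPow μ q p.toReal (fun z => S.poisson (τ z) (k z))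
      = ∫⁻ x, (∑ z, w z * ‖m z x‖ₑ ^ q) ^ (p.toReal / q) ∂μ := by
    refine lintegral_congr_ae ?_
    filter_upwards [ae_all_iff.2 fun z => Lp.coeFn_smul ((w z : ℝ) ^ q⁻¹) (m z)] with x hx
    congr 1
    refine Finset.sum_congr rfl fun z _ => ?_
    rw [hmk, hx, Pi.smul_apply, enorm_smul, ENNReal.mul_rpow_of_nonneg _ _ hq0.le, hwq]
  have e2 : mixedPow μ q p.toReal (fun z => k z)
      ≤ W ^ (p.toReal / q) * mixedPow μ q p.toReal (fun l => h l) := by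
    rw [mixedPow, mixedPow, ← lintegral_const_mul' _ _
      (ENNReal.rpow_ne_top_of_nonneg (by positivity) hWt)]
    refine lintegral_mono_ae ?_
    filter_upwards [ae_all_iff.2 fun z : s' × s => Lp.coeFn_smul ((w z : ℝ) ^ q⁻¹) (normLp (h z.2)),
      ae_all_iff.2 fun l => ae_enorm_normLp (h l)] with x hx h2
    rw [← ENNReal.mul_rpow_of_nonneg _ _ (by positivity)]
    refine ENNReal.rpow_le_rpow ?_ (by positivity)
    rw [Fintype.sum_prod_type_right, Finset.mul_sum]
    refine Finset.sum_le_sum fun l _ => ?_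
    have : ∀ j : s', ‖(k (j, l) : Ω → ℝ) x‖ₑ ^ q = dyadicWeight ((l : ℤ) - j) * ‖h l x‖ₑ ^ q := by
      intro j
      rw [hk, hx (j, l), Pi.smul_apply, enorm_smul, ENNReal.mul_rpow_of_nonneg _ _ hq0.le, hwq,
        h2, hw, ← dyadicWeight_neg, neg_sub]
    simp only [this]
    rw [← Finset.sum_mul]
    exact mul_le_mul_left (sum_dyadicWeight_le s' l) _
  have e3 : mixedPow μ q p.toReal (fun j : s' =>
        ((2 : ℝ) ^ (j : ℤ) • S.dPoisson (2 ^ (j : ℤ)) (S.dyadicSum h) : Lp B p μ))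
      ≤ K ^ (p.toReal / q) * ∫⁻ x, (∑ z, w z * ‖m z x‖ₑ ^ q) ^ (p.toReal / q) ∂μ := by
    rw [mixedPow, ← lintegral_const_mul' _ _ (ENNReal.rpow_ne_top_of_nonneg (by positivity) hKt)]
    refine lintegral_mono_ae ?_
    have hsum : ∀ᵐ x ∂μ, ∀ j : s',
        ((2 : ℝ) ^ (j : ℤ) • S.dPoisson (2 ^ (j : ℤ)) (S.dyadicSum h) : Lp B p μ) x
        = ∑ l : s, (((2 : ℝ) ^ (j : ℤ) * 2 ^ (l : ℤ)) • subordDeriv2 (fun s => S.bochnerT s)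
            (2 ^ (j : ℤ) + 2 ^ (l : ℤ)) (h l) : Lp B p μ) x := ae_all_iff.2 fun j => by
      rw [S.dPoisson_dyadicSum h1p hp]
      exact Lp.coeFn_fun_finsetSum _ _
    filter_upwards [hsum, ae_all_iff.2 fun j : s' => ae_all_iff.2 fun l : s =>
      S.ae_enorm_smul_subordDeriv2_le h1p hp (h l) j l] with x hx h2
    rw [← ENNReal.mul_rpow_of_nonneg _ _ (by positivity)]
    refine ENNReal.rpow_le_rpow ?_ (by positivity)
    calc _ ≤ ∑ j : s', (∑ l : s, (w (j, l) : ℝ≥0∞) * (30 * ‖m (j, l) x‖ₑ)) ^ q := by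
          refine Finset.sum_le_sum fun j _ => ENNReal.rpow_le_rpow ?_ hq0.le
          rw [hx j]
          exact (enorm_sum_le _ _).trans (Finset.sum_le_sum fun l _ => h2 j l)
      _ ≤ W ^ (q - 1) * ∑ z : s' × s, (w z : ℝ≥0∞) * (30 * ‖m z x‖ₑ) ^ q :=
          sum_sum_weight_rpow_le hq.le (fun j l => (w (j, l) : ℝ≥0∞)) W
            (fun j => sum_dyadicWeight_le s j) fun j l => 30 * ‖m (j, l) x‖ₑ
      _ = _ := by
          rw [hK, mul_comm (30 ^ q) (W ^ (q - 1)), mul_assoc]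
          congr 1
          rw [Finset.mul_sum]
          refine Finset.sum_congr rfl fun z _ => ?_
          rw [ENNReal.mul_rpow_of_nonneg _ _ hq0.le, mul_left_comm]
  refine e3.trans ?_
  rw [mul_assoc]
  refine mul_le_mul_right ?_ _
  rw [← e1, mul_assoc]
  exact h1.trans (mul_le_mul_right e2 _)

end AlmostOrthogonality

section Duality

variable {B B' : Type*} [NormedAddCommGroup B] [NormedSpace ℝ B] [CompleteSpace B]
  [NormedAddCommGroup B'] [NormedSpace ℝ B'] [CompleteSpace B']

theorem fixProj_dyadicSum (h1p : 1 < p) (hp : p ≠ ∞) {s : Finset ℤ} (h : s → Lp B p μ) :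
    S.fixProj (S.dyadicSum h) = 0 := by
  rw [dyadicSum, map_sum]
  refine Finset.sum_eq_zero fun l _ => ?_
  rw [map_smul, S.fixProj_subordDeriv h1p hp (by positivity), smul_zero]

theorem lpPairing_dyadicSum [ENNReal.HolderConjugate p' p] (h1p : 1 < p) (hp : p ≠ ∞)
    (h1p' : 1 < p') (hp' : p' ≠ ∞) (β : B' →L[ℝ] B →L[ℝ] ℝ) {s : Finset ℤ} (h : s → Lp B' p' μ)
    (f : Lp B p μ) :
    ∑ l : s, β.lpPairing μ p' p (h l) ((2 : ℝ) ^ (l : ℤ) • S.dPoisson (2 ^ (l : ℤ)) f)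
      = β.lpPairing μ p' p (S.dyadicSum h) f := by
  rw [dyadicSum, map_sum, sum_apply]
  refine Finset.sum_congr rfl fun l _ => ?_
  rw [map_smul, map_smul, smul_apply, dPoisson, dPoisson, subordDeriv,
    subordDeriv, S.lpPairing_kernelOp h1p hp h1p' hp' β
      (integrableOn_subordKernelDeriv (by positivity))]

/-- The upper estimate for `𝔊_q` yields the lower estimate for `𝔊_{q'}` on the other side of a
norming pairing. -/
theorem lower_of_upper [ENNReal.HolderConjugate p' p] [ENNReal.HolderConjugate p p']
    (h1p : 1 < p) (hp : p ≠ ∞) (h1p' : 1 < p') (hp' : p' ≠ ∞) {β : B' →L[ℝ] B →L[ℝ] ℝ}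
    (hβ : ‖β‖ ≤ 1) (hn : ∀ b', ∃ b, ‖b‖ ≤ 1 ∧ ‖b'‖ / 2 ≤ β b' b) {q q' : ℝ}
    (hq : q.HolderConjugate q') {C : ℝ≥0∞}
    (hC : ∀ f : Lp B p μ, eLpNorm (S.gFunction q f) p μ ≤ C * ‖f‖ₑ) (g : Lp B' p' μ) :
    ‖g‖ₑ ≤ 4 * (‖S.fixProj g‖ₑ + 4 * (C * eLpNorm (S.gFunction q' g) p' μ)) := by
  refine enorm_le_of_forall_lpPairing_le hp hp' hβ hn fun f => ?_
  have h1 := S.ofReal_abs_lpPairing_sub_le h1p hp h1p' hp' hβ hq g f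
  have h2 := ofReal_lpPairing_le hp hp' hβ (S.fixProj g) f
  set a := β.lpPairing μ p' p g f
  set b := β.lpPairing μ p' p (S.fixProj g) f
  calc ENNReal.ofReal a = ENNReal.ofReal (b + (a - b)) := by rw [add_sub_cancel]
    _ ≤ ENNReal.ofReal b + ENNReal.ofReal |a - b| :=
        ENNReal.ofReal_add_le.trans (by gcongr; exact le_abs_self _)
    _ ≤ ‖S.fixProj g‖ₑ * ‖f‖ₑ + 4 * (eLpNorm (S.gFunction q' g) p' μ * (C * ‖f‖ₑ)) := by
        refine add_le_add h2 (h1.trans ?_)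
        gcongr
        exact hC f
    _ = _ := by ring

/-- The lower estimate for `𝔊_{q'}` yields the upper estimate for `𝔊_q` on the other side of a
norming pairing. If `(h_l)` norms the dyadic pieces of `f`, with mixed norm `A`, then `A` is at most
`4 ⟨g, f⟩` for `g = ∑ 2^l ∂P_{2^l} h_l`, where `F g = 0` and `𝔊_{q'} g` is again controlled by `A`. -/
theorem upper_of_lower [ENNReal.HolderConjugate p' p]
    (h1p : 1 < p) (hp : p ≠ ∞) (h1p' : 1 < p') (hp' : p' ≠ ∞) {β : B' →L[ℝ] B →L[ℝ] ℝ}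
    (hβ : ‖β‖ ≤ 1) (hn : ∀ b, ∃ b', ‖b'‖ ≤ 1 ∧ ‖b‖ / 2 ≤ β b' b) {q q' : ℝ}
    (hq : q.HolderConjugate q') {C : ℝ≥0∞} (hCt : C ≠ ∞)
    (hC : ∀ g : Lp B' p' μ,
      ‖g‖ₑ ≤ C * (‖S.fixProj g‖ₑ + eLpNorm (S.gFunction q' g) p' μ)) :
    ∃ C' : ℝ≥0∞, C' ≠ ∞ ∧ ∀ f : Lp B p μ, eLpNorm (S.gFunction q f) p μ ≤ C' * ‖f‖ₑ := by
  have hP := toReal_holderConjugate (p := p) (p' := p') hp hp'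
  have hP0 := hP.pos
  have hP0' := hP.symm.pos
  obtain ⟨C₁, hC₁, hg₁⟩ := S.exists_gFunction_le h1p' hp' hq.symm.lt
  obtain ⟨C₂, hC₂, hg₂⟩ := S.exists_mixedPow_dyadicSum_le h1p' hp' hq.symm.lt
  obtain ⟨C₄, hC₄, hg₄⟩ := S.exists_gFunction_le h1p hp hq.lt
  set C₃ : ℝ≥0∞ := 4 * (C * (C₁ * C₂) ^ (1 / p'.toReal)) with hC₃
  have hC₃t : C₃ ≠ ∞ := ENNReal.mul_ne_top (by norm_num) (ENNReal.mul_ne_top hCt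
    (ENNReal.rpow_ne_top_of_nonneg (by positivity) (ENNReal.mul_ne_top hC₁ hC₂)))
  refine ⟨C₄ ^ (1 / p.toReal) * C₃, ENNReal.mul_ne_top
    (ENNReal.rpow_ne_top_of_nonneg (by positivity) hC₄) hC₃t, fun f => ?_⟩
  have key : ∀ N : ℕ, mixedPow μ q p.toReal (fun l : ↥(Finset.Icc (-N : ℤ) N) =>
        ((2 : ℝ) ^ (l : ℤ) • S.dPoisson (2 ^ (l : ℤ)) f : Lp B p μ)) ≤ (C₃ * ‖f‖ₑ) ^ p.toReal := by
    intro N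
    set F : ↥(Finset.Icc (-N : ℤ) N) → Lp B p μ := fun l =>
      (2 : ℝ) ^ (l : ℤ) • S.dPoisson (2 ^ (l : ℤ)) f with hF
    set A := mixedPow μ q p.toReal (fun l => F l) with hA
    have hAt : A ≠ ∞ := mixedPow_ne_top (zero_lt_one.trans h1p).ne' hp hq.pos F
    obtain ⟨h, h1, h2⟩ := exists_norming_family hp hp' hβ hn hq hP F
    have hG : eLpNorm (S.gFunction q' (S.dyadicSum h)) p' μ ≤ (C₁ * (C₂ * A)) ^ (1 / p'.toReal) := by
      rw [one_div, ENNReal.le_rpow_inv_iff hP0']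
      exact hg₁ B' (S.dyadicSum h) (C₂ * A) fun M =>
        (hg₂ B' _ (Finset.Icc (-M : ℤ) M) h).trans (mul_le_mul_right h1 _)
    -- the power of `A` on the right is absorbed afterwards, as `A < ∞` for finitely many pieces
    have h3 : A ≤ C₃ * ‖f‖ₑ * A ^ (1 / p'.toReal) := by
      refine h2.trans ?_
      rw [hF, S.lpPairing_dyadicSum h1p hp h1p' hp' β h f]
      have h4 := ofReal_lpPairing_le hp hp' hβ (S.dyadicSum h) f
      have h5 := hC (S.dyadicSum h)
      rw [S.fixProj_dyadicSum h1p' hp' h, enorm_zero, zero_add] at h5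
      calc _ ≤ 4 * (C * (C₁ * (C₂ * A)) ^ (1 / p'.toReal) * ‖f‖ₑ) := by
            refine mul_le_mul_right (h4.trans (mul_le_mul_left (h5.trans ?_) _)) _
            exact mul_le_mul_right hG _
        _ = _ := by
            rw [← mul_assoc C₁ C₂ A, ENNReal.mul_rpow_of_nonneg _ _ (by positivity), hC₃]
            ring
    have h6 := rpow_one_sub_le_of_le_mul_rpow hAt
      (by rw [div_lt_one hP0']; exact hP.symm.lt) h3
    rw [one_div, hP.symm.one_sub_inv, ENNReal.rpow_inv_le_iff hP0] at h6
    exact h6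
  have h7 := hg₄ B f _ key
  rw [← ENNReal.le_rpow_inv_iff hP0, ENNReal.mul_rpow_of_nonneg _ _ (by positivity),
    ENNReal.rpow_rpow_inv hP0.ne', ← mul_assoc, ← one_div] at h7
  exact h7

end Duality

end SymmetricDiffusionSemigroup

/-! ### Duality between `B` and its dual -/

section DualPairing

variable (𝕜 : Type*) [RCLike 𝕜] (B : Type*) [NormedAddCommGroup B] [NormedSpace 𝕜 B]
  [NormedSpace ℝ B] [IsScalarTower ℝ 𝕜 B]

/-- The real part of the canonical pairing of a Banach space over `𝕜` with its dual. -/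
def reDualPairing : StrongDual 𝕜 B →L[ℝ] B →L[ℝ] ℝ :=
  LinearMap.mkContinuous₂
    (LinearMap.mk₂ ℝ (fun (b' : StrongDual 𝕜 B) (b : B) => RCLike.re (b' b))
      (fun _ _ _ => by simp) (fun _ _ _ => by simp [RCLike.smul_re]) (fun _ _ _ => by simp)
      (fun c b' b => by
        rw [← algebraMap_smul 𝕜 c b, map_smul]
        simp))
    1 fun b' b => by
      rw [one_mul]
      exact (RCLike.abs_re_le_norm _).trans (b'.le_opNorm b)

theorem reDualPairing_apply (b' : StrongDual 𝕜 B) (b : B) :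
    reDualPairing 𝕜 B b' b = RCLike.re (b' b) := rfl

theorem norm_reDualPairing_le : ‖reDualPairing 𝕜 B‖ ≤ 1 :=
  LinearMap.mkContinuous₂_norm_le _ zero_le_one _

variable {B} in
theorem exists_reDualPairing_ge (b : B) :
    ∃ b' : StrongDual 𝕜 B, ‖b'‖ ≤ 1 ∧ ‖b‖ / 2 ≤ reDualPairing 𝕜 B b' b := by
  obtain ⟨b', h1, h2⟩ := exists_dual_vector'' 𝕜 b
  refine ⟨b', h1, ?_⟩
  rw [reDualPairing_apply, h2, RCLike.ofReal_re]
  exact half_le_self (norm_nonneg b)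

variable {𝕜 B} in
theorem exists_reDualPairing_ge_dual (b' : StrongDual 𝕜 B) :
    ∃ b : B, ‖b‖ ≤ 1 ∧ ‖b'‖ / 2 ≤ reDualPairing 𝕜 B b' b := by
  rcases eq_or_ne b' 0 with rfl | h0
  · exact ⟨0, by simp, by simp⟩
  obtain ⟨b, h1, h2⟩ := b'.exists_lt_apply_of_lt_opNorm (half_lt_self (norm_pos_iff.2 h0))
  obtain ⟨c, hc, h3⟩ := RCLike.exists_norm_eq_mul_self (b' b)
  refine ⟨c • b, by rw [norm_smul, hc, one_mul]; exact h1.le, ?_⟩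
  rw [reDualPairing_apply, map_smul, smul_eq_mul, ← h3, RCLike.ofReal_re]
  exact h2.le

end DualPairing

end

theorem theorem3p1 {Ω : Type*} [MeasurableSpace Ω] (μ : Measure Ω)
    (S : SymmetricDiffusionSemigroup μ)
    {𝕜 : Type*} [RCLike 𝕜] (B : Type*) [NormedAddCommGroup B] [NormedSpace 𝕜 B]
    [NormedSpace ℝ B] [IsScalarTower ℝ 𝕜 B] [CompleteSpace B]
    (p p' : ℝ≥0∞) [Fact (1 ≤ p)] [Fact (1 ≤ p')] (hp : 1 < p) (hp_top : p < ∞)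
    (hpp' : ENNReal.HolderConjugate p p')
    (q q' : ℝ) (hq : 1 < q) (hqq' : Real.HolderConjugate q q') :
    (∃ C : ℝ≥0, 0 < C ∧ ∀ f : Lp B p μ,
      eLpNorm (S.gFunction q f) p μ ≤ C * ‖f‖ₑ) ↔
    (∃ C : ℝ≥0, 0 < C ∧ ∀ g : Lp (StrongDual 𝕜 B) p' μ,
      ‖g‖ₑ ≤ C * (‖S.fixProj g‖ₑ + eLpNorm (S.gFunction q' g) p' μ)) := by
  have hsymm : ENNReal.HolderConjugate p' p := hpp'.symm
  have h1p' : 1 < p' := (ENNReal.HolderConjugate.lt_top_iff_one_lt p p').1 hp_top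
  have hp' : p' ≠ ∞ := (ENNReal.HolderConjugate.ne_top_iff_ne_one p' p).2 hp.ne'
  have hβ := norm_reDualPairing_le 𝕜 B
  constructor
  · rintro ⟨C, -, h⟩
    refine ⟨4 + 16 * C, by positivity, fun g => ?_⟩
    refine (S.lower_of_upper hp hp_top.ne h1p' hp' hβ exists_reDualPairing_ge_dual hqq' h g).trans ?_
    set a := ‖S.fixProj g‖ₑ
    set b := eLpNorm (S.gFunction q' g) p' μ
    calc 4 * (a + 4 * (C * b)) = 4 * a + 16 * C * b := by ring
      _ ≤ (4 + 16 * C) * a + (4 + 16 * C) * b := by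
          gcongr
          · exact le_self_add
          · exact le_add_self
      _ = ((4 + 16 * C : ℝ≥0) : ℝ≥0∞) * (a + b) := by push_cast; ring
  · rintro ⟨C, -, h⟩
    obtain ⟨C', hC', h'⟩ := S.upper_of_lower hp hp_top.ne h1p' hp' hβ
      (exists_reDualPairing_ge 𝕜) hqq' ENNReal.coe_ne_top h
    refine ⟨C'.toNNReal + 1, by positivity, fun f => (h' f).trans ?_⟩
    gcongr
    push_cast
    rw [ENNReal.coe_toNNReal hC']
    exact le_self_add
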